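/- Let $(\mathbb B,\|\cdot\|)$ be a separable real Banach space which is $r$-smooth for some $r\in(1,2]$, that is, $\mathbb B$ has an equivalent norm $\|\cdot\|'$ such that $$\sup_{s>0}\ \sup_{\|x\|'=\|y\|'=1}\frac{\|x+sy\|'+\|x-sy\|'-2}{s^r}<\infty .$$ Let $(\xi_i)_{i\ge1}$ be an i.i.d. sequence of random variables with values in a measurable space $(S,\mathcal S)$, let $m\ge 1$ be an integer and let $h\colon S^m\to\mathbb B$ be a measurable function that is symmetric (invariant under all permutations of its $m$ arguments) and degenerate of order $d\in\{1,\dots,m\}$ with respect to $(\xi_i)_{i\ge1}$; that is, $h(\xi_1,\dots,\xi_m)$ is integrable, $$\mathbb E[h(\xi_1,\dots,\xi_m)\mid \xi_1,\dots,\xi_{d-1}]=0\ \text{ a.s.}\quad\text{and}\quad \mathbb E\big\|\mathbb E[h(\xi_1,\dots,\xi_m)\mid\xi_1,\dots,\xi_d]\big\|\ne0 .$$ For $n\ge m$ put $$U_{m,n}(h)=\sum_{1\le i_1<\dots<i_m\le n}h(\xi_{i_1},\dots,\xi_{i_m}),$$ and for $p\in(1,r]$ define the $[0,\infty]$-valued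 random variable $$H_p=\max_{0\le k\le m}\big(\mathbb E[\|h(\xi_1,\dots,\xi_m)\|^p\mid\xi_1,\dots,\xi_k]\big)^{1/p}.$$ Then for every $p\in(1,r]$, every $q>0$, every $t>0$ and every integer $N\ge 1$, $$\mathbb P\Big(\max_{m\le n\le N}\|U_{m,n}(h)\|>t\,N^{m-d+\frac dp}\Big)\le K\sum_{j=0}^m N^j\int_0^1u^{q-1}\,\mathbb P\Big(H_p>t\,N^{(\max\{d,j\}-d)\frac{p-1}{p}+\frac jp}\,u\Big)\,du ,$$ where the constant $K\in(0,\infty)$ depends only on $m$, $p$, $q$ and $\mathbb B$ (and, for $N<m$, the event on the left is understood to be empty). -/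

import Mathlib

open MeasureTheory ProbabilityTheory
open scoped ENNReal NNReal

/-- A real Banach space `B` is `r`-smooth if it has an equivalent norm `ν` such that
`(ν (x + t y) + ν (x - t y) - 2) / t ^ r` is bounded over `t > 0` and `ν x = ν y = 1`. -/
def IsRSmooth (r : ℝ) (B : Type*) [NormedAddCommGroup B] [NormedSpace ℝ B] : Prop :=
  ∃ ν : Seminorm ℝ B,
    (∃ a b : ℝ, 0 < a ∧ 0 < b ∧ ∀ x : B, a * ‖x‖ ≤ ν x ∧ ν x ≤ b * ‖x‖) ∧
    ∃ C : ℝ, ∀ t : ℝ, 0 < t → ∀ x y : B, ν x = 1 → ν y = 1 →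
      (ν (x + t • y) + ν (x - t • y) - 2) / t ^ r ≤ C

/-- The random variables `ξ 0, ξ 1, …` are independent and identically distributed. -/
structure IsIID {Ω S : Type*} [MeasurableSpace Ω] [MeasurableSpace S]
    (μ : Measure Ω) (ξ : ℕ → Ω → S) : Prop where
  measurable : ∀ i, Measurable (ξ i)
  indep : iIndepFun ξ μ
  identDistrib : ∀ i, IdentDistrib (ξ i) (ξ 0) μ μ

/-- The kernel `h` is invariant under all permutations of its `m` arguments. -/
def IsSymmetricKernel {S B : Type*} {m : ℕ} (h : (Fin m → S) → B) : Prop :=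
  ∀ (σ : Equiv.Perm (Fin m)) (x : Fin m → S), h (fun i => x (σ i)) = h x

/-- The σ-algebra generated by the first `k` variables `(ξ 0, …, ξ (k - 1))`. -/
@[reducible] def firstSigma {Ω S : Type*} [MeasurableSpace S] (ξ : ℕ → Ω → S) (k : ℕ) : MeasurableSpace Ω :=
  MeasurableSpace.comap (fun ω => fun i : Fin k => ξ i ω) MeasurableSpace.pi

/-- The random variable `h (ξ 0, …, ξ (m - 1))`. -/
def kernelAt {Ω S B : Type*} {m : ℕ} (h : (Fin m → S) → B) (ξ : ℕ → Ω → S) (ω : Ω) : B :=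
  h (fun i => ξ i ω)

/-- The (symmetric) kernel `h` is degenerate of order `d ∈ {1, …, m}`: the conditional expectation
of `h (ξ 0, …, ξ (m - 1))` given the first `d - 1` variables vanishes, and the one given the first
`d` variables does not. -/
structure IsDegenerateOfOrder {Ω S B : Type*} [MeasurableSpace Ω] [MeasurableSpace S]
    [NormedAddCommGroup B] [NormedSpace ℝ B] [CompleteSpace B] {m : ℕ}
    (μ : Measure Ω) (ξ : ℕ → Ω → S) (h : (Fin m → S) → B) (d : ℕ) : Prop where
  one_le : 1 ≤ d
  le_order : d ≤ m
  integrable : Integrable (kernelAt h ξ) μ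
  condExp_eq_zero : μ[kernelAt h ξ | firstSigma ξ (d - 1)] =ᵐ[μ] 0
  condExp_ne_zero : ∫ ω, ‖(μ[kernelAt h ξ | firstSigma ξ d]) ω‖ ∂μ ≠ 0

/-- `U_{m,n}(h)`: the sum of `h (ξ (i 0), …, ξ (i (m - 1)))` over all strictly increasing
`m`-tuples `i` of indices among the first `n` ones. -/
noncomputable def uStat {Ω S B : Type*} [AddCommMonoid B] {m : ℕ} (h : (Fin m → S) → B) (ξ : ℕ → Ω → S)
    (n : ℕ) (ω : Ω) : B :=
  ∑ i : Fin m ↪o Fin n, h (fun l => ξ (i l) ω)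

/-- `max_{m ≤ n ≤ N} ‖U_{m,n}(h)‖` (which is `0` if `N < m`). -/
noncomputable def maxUStat {Ω S B : Type*} [NormedAddCommGroup B] {m : ℕ}
    (h : (Fin m → S) → B) (ξ : ℕ → Ω → S) (N : ℕ) (ω : Ω) : ℝ≥0 :=
  (Finset.Icc m N).sup fun n => ‖uStat h ξ n ω‖₊

/-- `H_p = max_{0 ≤ k ≤ m} (E[‖h (ξ 0, …, ξ (m - 1))‖ ^ p | ξ 0, …, ξ (k - 1)]) ^ (1 / p)`, with
values in `[0, ∞]`. -/
noncomputable def maxCondMoment {Ω S B : Type*} [MeasurableSpace Ω] [MeasurableSpace S]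
    [NormedAddCommGroup B] {m : ℕ} (μ : Measure Ω) (ξ : ℕ → Ω → S) (h : (Fin m → S) → B)
    (p : ℝ) (ω : Ω) : ℝ≥0∞ :=
  (Finset.range (m + 1)).sup fun k =>
    (condLExp (firstSigma ξ k) μ (fun ω' => ‖kernelAt h ξ ω'‖ₑ ^ p) ω) ^ (1 / p)

/-!
A `B`-valued martingale whose values are read in `L^p(τ; B)` satisfies a good-`λ` inequality: an
equivalent `p`-smooth norm gives `B` martingale type `p`, which is applied to the martingale stopped
between the passage times of two levels. Hence the tail of the maximum of the martingale is
controlled by the tails of the largest increment and of the sum of the conditional `p`-th moments of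
the increments.

This is used by induction on the order. Grouping the terms of a `U`-statistic of order `m + 1` by
their largest index `k`, and centring the kernel in its last argument, one obtains a martingale plus
a sum of `U`-statistics of order `m`. The `k`-th increment of the martingale is again a `U`-statistic
of order `m`, in the variables of index less than `k`, with the variable of index `k` as an extra
parameter: fixing the parameter gives the increments, taking the norm of `L^p` in the parameter
gives their conditional moments. Kernels therefore carry a parameter throughout, and centring costs
one order of degeneracy.

For a general kernel the resulting bound involves the conditional `p`-th moments of the kernel given
any subset `J` of its arguments. For a symmetric kernel the law of such a moment depends only on the
cardinality `k` of `J`, and it is the law of the conditional moment given the first `k` variables.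
-/

section TailIntegral

/-- The measure on `ℝ` with density `u ^ (q - 1)` on `(0, 1]`, against which tail probabilities are
averaged. -/
noncomputable def powWeight (q : ℝ) : Measure ℝ :=
  (volume.restrict (Set.Ioc 0 1)).withDensity fun u => ENNReal.ofReal (u ^ (q - 1))

instance (q : ℝ) : SFinite (powWeight q) := by
  unfold powWeight; infer_instance

lemma lintegral_powWeight (q : ℝ) (φ : ℝ → ℝ≥0∞) :
    ∫⁻ u, φ u ∂powWeight q
      = ∫⁻ u in Set.Ioc (0 : ℝ) 1, ENNReal.ofReal (u ^ (q - 1)) * φ u :=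
  lintegral_withDensity_eq_lintegral_mul_non_measurable _ (by fun_prop)
    (.of_forall fun _ => ENNReal.ofReal_lt_top) φ

lemma ae_powWeight_mem_Ioc (q : ℝ) : ∀ᵐ u ∂powWeight q, u ∈ Set.Ioc (0 : ℝ) 1 :=
  (withDensity_absolutelyContinuous _ _).ae_le (ae_restrict_mem measurableSet_Ioc)

lemma lintegral_powWeight_mono {q : ℝ} {φ ψ : ℝ → ℝ≥0∞} (h : ∀ u, 0 < u → u ≤ 1 → φ u ≤ ψ u) :
    ∫⁻ u, φ u ∂powWeight q ≤ ∫⁻ u, ψ u ∂powWeight q :=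
  lintegral_mono_ae <| (ae_powWeight_mem_Ioc q).mono fun u hu => h u hu.1 hu.2

lemma powWeight_univ {q : ℝ} (hq : 0 < q) : powWeight q Set.univ = ENNReal.ofReal (1 / q) := by
  have hint : IntervalIntegrable (fun u : ℝ => u ^ (q - 1)) volume 0 1 :=
    intervalIntegral.intervalIntegrable_rpow' (by linarith)
  rw [intervalIntegrable_iff_integrableOn_Ioc_of_le zero_le_one] at hint
  rw [powWeight, withDensity_apply _ .univ, Measure.restrict_univ,
    ← ofReal_integral_eq_lintegral_ofReal hint]
  · rw [← intervalIntegral.integral_of_le zero_le_one, integral_rpow (Or.inl (by linarith))]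
    simp [hq.ne']
  · filter_upwards [ae_restrict_mem measurableSet_Ioc] with u hu using Real.rpow_nonneg hu.1.le _

lemma setLIntegral_Ioc_zero_eq_mul {c : ℝ} (hc : 0 < c) (g : ℝ → ℝ≥0∞) :
    ∫⁻ u in Set.Ioc 0 c, g u = ENNReal.ofReal c * ∫⁻ u in Set.Ioc (0 : ℝ) 1, g (c * u) := by
  have hemb : MeasurableEmbedding fun u : ℝ => c * u :=
    (Homeomorph.mulLeft₀ c hc.ne').measurableEmbedding
  have hpre : (fun u : ℝ => c * u) ⁻¹' Set.Ioc 0 c = Set.Ioc 0 1 := by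
    rw [Set.preimage_const_mul_Ioc₀ _ _ hc, zero_div, div_self hc.ne']
  conv_lhs => rw [← Real.smul_map_volume_mul_left hc.ne']
  rw [Measure.restrict_smul, lintegral_smul_measure, hemb.restrict_map, hemb.lintegral_map,
    abs_of_pos hc, hpre, smul_eq_mul]

lemma ofReal_rpow_mul_lintegral_powWeight_comp_mul_le {q c : ℝ} (hc : 0 < c) (hc1 : c ≤ 1)
    (φ : ℝ → ℝ≥0∞) :
    ENNReal.ofReal (c ^ q) * ∫⁻ u, φ (c * u) ∂powWeight q ≤ ∫⁻ u, φ u ∂powWeight q := by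
  have hscale : ∀ u ∈ Set.Ioc (0 : ℝ) 1, ENNReal.ofReal (c ^ q) * ENNReal.ofReal (u ^ (q - 1))
      = ENNReal.ofReal c * ENNReal.ofReal ((c * u) ^ (q - 1)) := fun u hu => by
    rw [← ENNReal.ofReal_mul (by positivity), ← ENNReal.ofReal_mul hc.le,
      Real.mul_rpow hc.le hu.1.le, ← mul_assoc, Real.rpow_sub hc, Real.rpow_one,
      mul_div_cancel₀ _ hc.ne']
  calc ENNReal.ofReal (c ^ q) * ∫⁻ u, φ (c * u) ∂powWeight q
      = ENNReal.ofReal c *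
        ∫⁻ u in Set.Ioc (0 : ℝ) 1, ENNReal.ofReal ((c * u) ^ (q - 1)) * φ (c * u) := by
        rw [lintegral_powWeight, ← lintegral_const_mul' _ _ ENNReal.ofReal_ne_top,
          ← lintegral_const_mul' _ _ ENNReal.ofReal_ne_top]
        refine setLIntegral_congr_fun measurableSet_Ioc fun u hu => ?_
        rw [← mul_assoc, hscale u hu, mul_assoc]
    _ = ∫⁻ u in Set.Ioc 0 c, ENNReal.ofReal (u ^ (q - 1)) * φ u :=
        (setLIntegral_Ioc_zero_eq_mul hc fun u => ENNReal.ofReal (u ^ (q - 1)) * φ u).symm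
    _ ≤ ∫⁻ u, φ u ∂powWeight q := by
        rw [lintegral_powWeight]
        exact lintegral_mono_set (Set.Ioc_subset_Ioc_right hc1)

lemma lintegral_powWeight_le_of_goodLambda {q b : ℝ} (hb : 1 < b) {ε : ℝ≥0∞}
    (hε : ENNReal.ofReal (b ^ q) * ε ≤ 1 / 2) {F M : ℝ → ℝ≥0∞} (hF : Measurable F)
    (hfin : ∫⁻ u, F u ∂powWeight q ≠ ∞) (h : ∀ u, 0 < u → F (b * u) ≤ ε * F u + M u) :
    ∫⁻ u, F u ∂powWeight q ≤ 2 * ENNReal.ofReal (b ^ q) * ∫⁻ u, M u ∂powWeight q := by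
  have hb0 : 0 < b := by linarith
  set I := ∫⁻ u, F u ∂powWeight q
  set J := ∫⁻ u, M u ∂powWeight q
  have hscale : ENNReal.ofReal (b⁻¹ ^ q) * I ≤ ε * I + J := by
    calc ENNReal.ofReal (b⁻¹ ^ q) * I
        ≤ ∫⁻ u, F (b * u) ∂powWeight q := by
          simpa only [mul_inv_cancel_left₀ hb0.ne'] using
            ofReal_rpow_mul_lintegral_powWeight_comp_mul_le (q := q) (inv_pos.2 hb0)
              (inv_le_one_of_one_le₀ hb.le) fun u => F (b * u)
      _ ≤ ∫⁻ u, (ε * F u + M u) ∂powWeight q := lintegral_powWeight_mono fun u hu _ => h u hu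
      _ = ε * I + J := by rw [lintegral_add_left (by fun_prop), lintegral_const_mul _ hF]
  have habsorb : I ≤ I / 2 + ENNReal.ofReal (b ^ q) * J := by
    calc I = ENNReal.ofReal (b ^ q) * (ENNReal.ofReal (b⁻¹ ^ q) * I) := by
          rw [← mul_assoc, ← ENNReal.ofReal_mul (by positivity),
            ← Real.mul_rpow hb0.le (by positivity), mul_inv_cancel₀ hb0.ne', Real.one_rpow,
            ENNReal.ofReal_one, one_mul]
      _ ≤ ENNReal.ofReal (b ^ q) * (ε * I + J) := by gcongr
      _ = ENNReal.ofReal (b ^ q) * ε * I + ENNReal.ofReal (b ^ q) * J := by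
          rw [mul_add, mul_assoc]
      _ ≤ 1 / 2 * I + ENNReal.ofReal (b ^ q) * J := by gcongr
      _ = I / 2 + ENNReal.ofReal (b ^ q) * J := by rw [one_div, ENNReal.div_eq_inv_mul]
  have hhalf : I / 2 ≤ ENNReal.ofReal (b ^ q) * J := by
    refine (ENNReal.add_le_add_iff_left (ENNReal.div_ne_top hfin two_ne_zero)).1 ?_
    rwa [ENNReal.add_halves]
  rwa [ENNReal.div_le_iff_le_mul (by simp) (by simp), mul_comm, ← mul_assoc] at hhalf

variable {α β : Type*} [MeasurableSpace α] [MeasurableSpace β]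

/-- `∫₀¹ u ^ (q - 1) μ(X > s u ^ p) du`: the form in which the tail of the `p`-th power `X` of a
norm enters all estimates. -/
noncomputable def tailIntegral (p q : ℝ) (μ : Measure α) (X : α → ℝ≥0∞) (s : ℝ) : ℝ≥0∞ :=
  ∫⁻ u, μ {a | ENNReal.ofReal (s * u ^ p) < X a} ∂powWeight q

variable {p q s : ℝ} {μ : Measure α} {ν : Measure β}

lemma antitone_measure_lt (μ : Measure α) (X : α → ℝ≥0∞) :
    Antitone fun r : ℝ≥0∞ => μ {a | r < X a} :=
  fun _ _ h => measure_mono fun _ ha => h.trans_lt ha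

lemma measurable_measure_lt (μ : Measure α) (X : α → ℝ≥0∞) (s p : ℝ) :
    Measurable fun u : ℝ => μ {a | ENNReal.ofReal (s * u ^ p) < X a} :=
  (antitone_measure_lt μ X).measurable.comp (by fun_prop : Measurable fun u : ℝ =>
    ENNReal.ofReal (s * u ^ p))

lemma tailIntegral_ne_top [IsFiniteMeasure μ] (hq : 0 < q) (X : α → ℝ≥0∞) :
    tailIntegral p q μ X s ≠ ∞ := by
  refine ne_top_of_le_ne_top ?_ (lintegral_mono fun u => measure_mono (Set.subset_univ _))
  rw [lintegral_const, powWeight_univ hq]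
  exact ENNReal.mul_ne_top (measure_ne_top _ _) ENNReal.ofReal_ne_top

lemma tailIntegral_zero : tailIntegral p q μ (fun _ => 0) s = 0 := by
  simp [tailIntegral]

lemma tailIntegral_mono_measure {X : α → ℝ≥0∞} {Y : β → ℝ≥0∞}
    (h : ∀ r, μ {a | r < X a} ≤ ν {b | r < Y b}) :
    tailIntegral p q μ X s ≤ tailIntegral p q ν Y s :=
  lintegral_mono fun _ => h _

lemma tailIntegral_mono_ae {X Y : α → ℝ≥0∞} (h : ∀ᵐ a ∂μ, X a ≤ Y a) :
    tailIntegral p q μ X s ≤ tailIntegral p q μ Y s :=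
  tailIntegral_mono_measure fun _ => measure_mono_ae <| h.mono fun _ ha hr => hr.trans_le ha

lemma tailIntegral_mono {X Y : α → ℝ≥0∞} (h : ∀ a, X a ≤ Y a) :
    tailIntegral p q μ X s ≤ tailIntegral p q μ Y s :=
  tailIntegral_mono_ae (.of_forall h)

lemma tailIntegral_antitone (X : α → ℝ≥0∞) : Antitone (tailIntegral p q μ X) :=
  fun _ _ h => lintegral_powWeight_mono fun _ _ _ => antitone_measure_lt _ _ (by gcongr)

lemma tailIntegral_add_le {X Y : α → ℝ≥0∞} :
    tailIntegral p q μ (fun a => X a + Y a) s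
      ≤ tailIntegral p q μ X (s / 2) + tailIntegral p q μ Y (s / 2) := by
  unfold tailIntegral
  rw [← lintegral_add_left (measurable_measure_lt _ _ _ _)]
  refine lintegral_mono fun u => ?_
  refine (measure_mono fun a ha => ?_).trans (measure_union_le _ _)
  have hhalves : ENNReal.ofReal (s * u ^ p)
      = ENNReal.ofReal (s / 2 * u ^ p) + ENNReal.ofReal (s / 2 * u ^ p) := by
    rw [← two_mul, show s * u ^ p = 2 * (s / 2 * u ^ p) by ring, ENNReal.ofReal_mul two_pos.le,
      ENNReal.ofReal_ofNat]
  contrapose! ha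
  simp only [Set.mem_union, Set.mem_ofPred_eq, not_or, not_lt] at ha ⊢
  exact (add_le_add ha.1 ha.2).trans hhalves.ge

lemma tailIntegral_sup_le {ι : Type*} (F : Finset ι) (X : ι → α → ℝ≥0∞) :
    tailIntegral p q μ (fun a => F.sup fun i => X i a) s
      ≤ ∑ i ∈ F, tailIntegral p q μ (X i) s := by
  unfold tailIntegral
  rw [← lintegral_finsetSum _ fun i _ => measurable_measure_lt _ _ _ _]
  refine lintegral_mono fun u => (measure_mono fun a ha => ?_).trans (measure_biUnion_finset_le F _)
  simpa [Finset.lt_sup_iff] using ha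

lemma tailIntegral_mul_le (hp : 0 < p) {c : ℝ} (hc : 0 < c) (hc1 : c ≤ 1) (X : α → ℝ≥0∞) :
    tailIntegral p q μ X (c * s) ≤ ENNReal.ofReal (c ^ (-(q / p))) * tailIntegral p q μ X s := by
  have hrescale : tailIntegral p q μ X (c * s)
      ≤ ∫⁻ u, μ {a | ENNReal.ofReal (s * (c ^ (1 / p) * u) ^ p) < X a} ∂powWeight q := by
    refine lintegral_powWeight_mono fun u hu _ => ?_
    rw [Real.mul_rpow (by positivity) hu.le, ← Real.rpow_mul hc.le, one_div_mul_cancel hp.ne',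
      Real.rpow_one, ← mul_assoc, mul_comm s c]
  have hle : ENNReal.ofReal (c ^ (q / p)) * tailIntegral p q μ X (c * s)
      ≤ tailIntegral p q μ X s := by
    refine le_trans ?_ (ofReal_rpow_mul_lintegral_powWeight_comp_mul_le (c := c ^ (1 / p))
      (by positivity) (Real.rpow_le_one hc.le hc1 (by positivity))
      fun u => μ {a | ENNReal.ofReal (s * u ^ p) < X a})
    rw [← Real.rpow_mul hc.le, one_div_mul_eq_div]
    gcongr
  rw [Real.rpow_neg hc.le, ENNReal.ofReal_inv_of_pos (by positivity)]
  exact (ENNReal.mul_le_iff_le_inv (ENNReal.ofReal_pos.2 (by positivity)).ne'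
    ENNReal.ofReal_ne_top).1 hle

lemma tailIntegral_const_mul (X : α → ℝ≥0∞) {c : ℝ} (hc : 0 < c) :
    tailIntegral p q μ (fun a => ENNReal.ofReal c * X a) (c * s) = tailIntegral p q μ X s := by
  simp only [tailIntegral, mul_assoc, ENNReal.ofReal_mul hc.le,
    ENNReal.mul_lt_mul_iff_right (ENNReal.ofReal_pos.2 hc).ne' ENNReal.ofReal_ne_top]

lemma measure_lt_le_tailIntegral (hp : 0 < p) (hq : 0 < q) (hs : 0 ≤ s) (X : α → ℝ≥0∞) :
    μ {a | ENNReal.ofReal s < X a} ≤ ENNReal.ofReal q * tailIntegral p q μ X s := by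
  calc μ {a | ENNReal.ofReal s < X a}
      = ENNReal.ofReal q * ∫⁻ _, μ {a | ENNReal.ofReal s < X a} ∂powWeight q := by
        rw [lintegral_const, powWeight_univ hq, mul_left_comm, ← ENNReal.ofReal_mul hq.le,
          mul_one_div_cancel hq.ne', ENNReal.ofReal_one, mul_one]
    _ ≤ ENNReal.ofReal q * tailIntegral p q μ X s := by
        gcongr
        refine lintegral_powWeight_mono fun u hu hu1 => antitone_measure_lt _ _ ?_
        gcongr
        exact mul_le_of_le_one_right hs (Real.rpow_le_one hu.le hu1 hp.le)

lemma tailIntegral_comp {f : α → β} (hf : MeasurePreserving f μ ν) {X : β → ℝ≥0∞}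
    (hX : Measurable X) : tailIntegral p q μ (fun a => X (f a)) s = tailIntegral p q ν X s :=
  lintegral_congr fun _ =>
    hf.measure_preimage (measurableSet_lt measurable_const hX).nullMeasurableSet

lemma measurable_tailIntegral_right [SFinite μ] {f : α × β → ℝ≥0∞} (hf : Measurable f) :
    Measurable fun b => tailIntegral p q μ (fun a => f (a, b)) s := by
  have hlt : MeasurableSet {w : (β × ℝ) × α | ENNReal.ofReal (s * w.1.2 ^ p) < f (w.2, w.1.1)} :=
    measurableSet_lt (by fun_prop) (by fun_prop)
  exact (measurable_measure_prodMk_left hlt).lintegral_prod_right'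

lemma tailIntegral_prod [SFinite μ] [SFinite ν] {X : α × β → ℝ≥0∞} (hX : Measurable X) :
    tailIntegral p q (μ.prod ν) X s = ∫⁻ b, tailIntegral p q μ (fun a => X (a, b)) s ∂ν := by
  have hlt : MeasurableSet {w : (β × ℝ) × α | ENNReal.ofReal (s * w.1.2 ^ p) < X (w.2, w.1.1)} :=
    measurableSet_lt (by fun_prop) (by fun_prop)
  unfold tailIntegral
  rw [lintegral_lintegral_swap (measurable_measure_prodMk_left hlt).aemeasurable]
  exact lintegral_congr fun u =>
    Measure.prod_apply_symm (measurableSet_lt measurable_const hX)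

end TailIntegral

section Smoothness

lemma rpow_le_quadratic {p A : ℝ} (hp : 1 < p) (hp2 : p ≤ 2) (hA : 0 ≤ A) :
    A ^ p ≤ 1 + p * (A - 1) + (A - 1) ^ 2 := by
  have hbernoulli := rpow_one_add_le_one_add_mul_self (s := A - 1) (p := p - 1) (by linarith)
    (by linarith) (by linarith)
  rw [add_sub_cancel] at hbernoulli
  calc A ^ p = A * A ^ (p - 1) := by
        rw [← Real.rpow_one_add' hA (by linarith), add_sub_cancel]
    _ ≤ A * (1 + (p - 1) * (A - 1)) := by gcongr
    _ ≤ 1 + p * (A - 1) + (A - 1) ^ 2 := by nlinarith [sq_nonneg (A - 1)]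

lemma rpow_add_rpow_le_of_add_le {p r s A D C : ℝ} (hp : 1 < p) (hpr : p ≤ r) (hr : r ≤ 2)
    (hC : 0 ≤ C) (hs : 0 < s) (hA : 0 ≤ A) (hD : 0 ≤ D) (hAs : |A - 1| ≤ s) (hDs : |D - 1| ≤ s)
    (h : A + D ≤ 2 + C * s ^ r) : A ^ p + D ^ p ≤ 2 + (10 + 2 * C) * s ^ p := by
  have hsp : 0 < s ^ p := Real.rpow_pos_of_pos hs p
  rcases le_or_gt 1 s with h1 | h1
  · have hcrude : ∀ x : ℝ, 0 ≤ x → |x - 1| ≤ s → x ^ p ≤ 4 * s ^ p := fun x hx hxs => by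
      calc x ^ p ≤ (2 * s) ^ p := by gcongr; linarith [(abs_le.1 hxs).2]
        _ = 2 ^ p * s ^ p := Real.mul_rpow two_pos.le hs.le
        _ ≤ 2 ^ (2 : ℝ) * s ^ p := by gcongr <;> linarith
        _ = 4 * s ^ p := by norm_num
    nlinarith [hcrude A hA hAs, hcrude D hD hDs, mul_nonneg hC hsp.le]
  · have hsr : s ^ r ≤ s ^ p := Real.rpow_le_rpow_of_exponent_ge hs h1.le hpr
    have hs2 : s ^ 2 ≤ s ^ p := by
      rw [← Real.rpow_two]
      exact Real.rpow_le_rpow_of_exponent_ge hs h1.le (by linarith)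
    have hlinear : p * (A + D - 2) ≤ 2 * (C * s ^ p) := by
      have hAD : A + D - 2 ≤ C * s ^ p := by nlinarith
      nlinarith [mul_nonneg hC hsp.le]
    have hAsq : (A - 1) ^ 2 ≤ s ^ 2 := sq_le_sq' (abs_le.1 hAs).1 (abs_le.1 hAs).2
    have hDsq : (D - 1) ^ 2 ≤ s ^ 2 := sq_le_sq' (abs_le.1 hDs).1 (abs_le.1 hDs).2
    nlinarith [rpow_le_quadratic hp (hpr.trans hr) hA, rpow_le_quadratic hp (hpr.trans hr) hD]

variable {B : Type*} [NormedAddCommGroup B] [NormedSpace ℝ B]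

/-- `ν` is an equivalent norm which is smooth of power type `p` with constant `C`, in the form of
a two-point inequality for its `p`-th power. -/
structure IsPowerSmooth (p : ℝ) (C : ℝ≥0) (ν : Seminorm ℝ B) : Prop where
  equiv : ∃ a b : ℝ, 0 < a ∧ 0 < b ∧ ∀ x : B, a * ‖x‖ ≤ ν x ∧ ν x ≤ b * ‖x‖
  two_point : ∀ x y : B, ν (x + y) ^ p + ν (x - y) ^ p ≤ 2 * ν x ^ p + C * ν y ^ p

lemma two_point_of_map_eq_one {p C : ℝ} (hp : p ≠ 0) (hC : 2 ≤ C) {ν : Seminorm ℝ B}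
    (hν : ∀ x, ν x = 0 → x = 0)
    (h : ∀ x y, ν x = 1 → ν (x + y) ^ p + ν (x - y) ^ p ≤ 2 + C * ν y ^ p) (x y : B) :
    ν (x + y) ^ p + ν (x - y) ^ p ≤ 2 * ν x ^ p + C * ν y ^ p := by
  rcases (apply_nonneg ν x).eq_or_lt with hx | hx
  · rw [hν x hx.symm]
    simp only [zero_add, zero_sub, map_neg_eq_map, map_zero, Real.zero_rpow hp]
    nlinarith [Real.rpow_nonneg (apply_nonneg ν y) p]
  · have hscale : ∀ z, ν ((ν x)⁻¹ • z) ^ p = ν z ^ p / ν x ^ p := fun z => by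
      rw [map_smul_eq_mul, Real.norm_of_nonneg (inv_nonneg.2 hx.le), inv_mul_eq_div,
        Real.div_rpow (apply_nonneg _ _) hx.le]
    have hunit := h ((ν x)⁻¹ • x) ((ν x)⁻¹ • y) (by
      rw [map_smul_eq_mul, Real.norm_of_nonneg (by positivity), inv_mul_cancel₀ hx.ne'])
    rw [← smul_add, ← smul_sub, hscale, hscale, hscale, ← add_div,
      div_le_iff₀ (Real.rpow_pos_of_pos hx p)] at hunit
    calc ν (x + y) ^ p + ν (x - y) ^ p ≤ (2 + C * (ν y ^ p / ν x ^ p)) * ν x ^ p := hunit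
      _ = 2 * ν x ^ p + C * ν y ^ p := by
        have := (Real.rpow_pos_of_pos hx p).ne'
        field_simp

lemma IsRSmooth.exists_isPowerSmooth {p r : ℝ} (hp : 1 < p) (hpr : p ≤ r) (hr : r ≤ 2)
    (h : IsRSmooth r B) : ∃ (ν : Seminorm ℝ B) (C : ℝ≥0), IsPowerSmooth p C ν := by
  obtain ⟨ν, ⟨a, b, ha, hb, hab⟩, C, hC⟩ := h
  have hp0 : p ≠ 0 := by linarith
  have hzero : ∀ x, ν x = 0 → x = 0 := fun x hx => by
    have hle : a * ‖x‖ ≤ 0 := hx ▸ (hab x).1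
    exact norm_le_zero_iff.1 (nonpos_of_mul_nonpos_right hle ha)
  refine ⟨ν, 10 + 2 * C.toNNReal, ⟨a, b, ha, hb, hab⟩,
    two_point_of_map_eq_one hp0 ?_ hzero fun x y hx => ?_⟩
  · push_cast
    linarith [C.toNNReal.coe_nonneg]
  push_cast
  rw [Real.coe_toNNReal']
  rcases (apply_nonneg ν y).eq_or_lt with hy | hy
  · rw [hzero y hy.symm]
    norm_num [hx, hp0]
  · have hclose : ∀ z, |ν (x + z) - 1| ≤ ν z := fun z => by
      simpa only [hx, add_sub_cancel_left] using abs_sub_map_le_sub ν (x + z) x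
    have hquot := hC (ν y) hy x ((ν y)⁻¹ • y) hx (by
      rw [map_smul_eq_mul, Real.norm_of_nonneg (by positivity), inv_mul_cancel₀ hy.ne'])
    rw [smul_inv_smul₀ hy.ne', div_le_iff₀ (by positivity)] at hquot
    refine rpow_add_rpow_le_of_add_le hp hpr hr (le_max_right _ _) hy (apply_nonneg _ _)
      (apply_nonneg _ _) (hclose y) ?_ ?_
    · simpa only [sub_eq_add_neg, map_neg_eq_map] using hclose (-y)
    · have : C * ν y ^ r ≤ max C 0 * ν y ^ r := by gcongr; exact le_max_left _ _
      linarith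

/-- The `p`-th power of a seminorm, with values in `[0, ∞]`. -/
noncomputable def seminormPow (ν : Seminorm ℝ B) (p : ℝ) (x : B) : ℝ≥0∞ :=
  ENNReal.ofReal (ν x ^ p)

lemma convexOn_seminorm_rpow {p : ℝ} (hp : 1 ≤ p) (ν : Seminorm ℝ B) :
    ConvexOn ℝ Set.univ fun x => ν x ^ p := by
  refine ⟨convex_univ, fun x _ y _ s t hs ht hst => ?_⟩
  have hν := ν.convexOn.2 (Set.mem_univ x) (Set.mem_univ y) hs ht hst
  exact (Real.rpow_le_rpow (apply_nonneg _ _) hν (by linarith)).trans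
    ((convexOn_rpow hp).2 (apply_nonneg ν x) (apply_nonneg ν y) hs ht hst)

namespace IsPowerSmooth

variable {p : ℝ} {C : ℝ≥0} {ν : Seminorm ℝ B}

lemma continuous (hν : IsPowerSmooth p C ν) : Continuous ν := by
  obtain ⟨a, b, -, -, hab⟩ := hν.equiv
  refine Seminorm.continuous_of_continuousAt_zero ?_
  rw [ContinuousAt, map_zero]
  refine squeeze_zero (fun x => apply_nonneg _ _) (fun x => (hab x).2) ?_
  simpa using (by fun_prop : Continuous fun x : B => b * ‖x‖).tendsto 0

lemma continuous_rpow (hν : IsPowerSmooth p C ν) (hp : 0 ≤ p) : Continuous fun x => ν x ^ p :=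
  hν.continuous.rpow_const fun _ => Or.inr hp

lemma continuous_seminormPow (hν : IsPowerSmooth p C ν) (hp : 0 ≤ p) :
    Continuous (seminormPow ν p) :=
  ENNReal.continuous_ofReal.comp (hν.continuous_rpow hp)

lemma seminormPow_add_add_seminormPow_sub_le (hν : IsPowerSmooth p C ν) (x y : B) :
    seminormPow ν p (x + y) + seminormPow ν p (x - y)
      ≤ 2 * seminormPow ν p x + C * seminormPow ν p y := by
  have hnn : ∀ z, 0 ≤ ν z ^ p := fun z => Real.rpow_nonneg (apply_nonneg _ _) _
  simp only [seminormPow]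
  rw [← ENNReal.ofReal_coe_nnreal (p := C), ← ENNReal.ofReal_ofNat 2,
    ← ENNReal.ofReal_mul C.coe_nonneg, ← ENNReal.ofReal_mul two_pos.le,
    ← ENNReal.ofReal_add (hnn _) (hnn _),
    ← ENNReal.ofReal_add (mul_nonneg two_pos.le (hnn _)) (mul_nonneg C.coe_nonneg (hnn _))]
  exact ENNReal.ofReal_le_ofReal (hν.two_point x y)

lemma exists_enorm_rpow_le_mul (hν : IsPowerSmooth p C ν) (hp : 0 ≤ p) :
    ∃ c : ℝ≥0∞, c ≠ ∞ ∧ ∀ x : B, ‖x‖ₑ ^ p ≤ c * seminormPow ν p x := by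
  obtain ⟨a, b, ha, -, hab⟩ := hν.equiv
  refine ⟨ENNReal.ofReal (a⁻¹ ^ p), ENNReal.ofReal_ne_top, fun x => ?_⟩
  rw [seminormPow, ← ENNReal.ofReal_mul (by positivity),
    ← Real.mul_rpow (by positivity) (apply_nonneg _ _), ← ofReal_norm,
    ENNReal.ofReal_rpow_of_nonneg (norm_nonneg _) hp]
  gcongr
  rw [inv_mul_eq_div, le_div_iff₀ ha, mul_comm]
  exact (hab x).1

lemma exists_seminormPow_le_mul (hν : IsPowerSmooth p C ν) (hp : 0 ≤ p) :
    ∃ c : ℝ≥0∞, c ≠ ∞ ∧ ∀ x : B, seminormPow ν p x ≤ c * ‖x‖ₑ ^ p := by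
  obtain ⟨a, b, -, hb, hab⟩ := hν.equiv
  refine ⟨ENNReal.ofReal (b ^ p), ENNReal.ofReal_ne_top, fun x => ?_⟩
  rw [seminormPow, ← ofReal_norm, ENNReal.ofReal_rpow_of_nonneg (norm_nonneg _) hp,
    ← ENNReal.ofReal_mul (by positivity), ← Real.mul_rpow hb.le (norm_nonneg _)]
  gcongr
  exact (hab x).2

variable [CompleteSpace B] {S : Type*} [MeasurableSpace S]
  {P : Measure S} [IsProbabilityMeasure P]

lemma seminormPow_integral_le (hν : IsPowerSmooth p C ν) (hp : 1 ≤ p) {Z : S → B}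
    (hZ : Integrable Z P) : seminormPow ν p (∫ s, Z s ∂P) ≤ ∫⁻ s, seminormPow ν p (Z s) ∂P := by
  by_cases hfin : ∫⁻ s, seminormPow ν p (Z s) ∂P = ∞
  · exact hfin ▸ le_top
  have hcont := hν.continuous_rpow (by linarith)
  have hnn : ∀ᵐ s ∂P, 0 ≤ ν (Z s) ^ p := .of_forall fun s => Real.rpow_nonneg (apply_nonneg _ _) _
  have hint : Integrable (fun s => ν (Z s) ^ p) P := by
    refine ⟨hcont.comp_aestronglyMeasurable hZ.1, ?_⟩
    rw [hasFiniteIntegral_iff_ofReal hnn]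
    exact lt_top_iff_ne_top.2 hfin
  simp only [seminormPow]
  rw [← ofReal_integral_eq_lintegral_ofReal hint hnn]
  exact ENNReal.ofReal_le_ofReal <| (convexOn_seminorm_rpow hp ν).map_integral_le
    hcont.continuousOn isClosed_univ (.of_forall fun _ => Set.mem_univ _) hZ hint

lemma lintegral_seminormPow_add_le (hν : IsPowerSmooth p C ν) (hp : 1 ≤ p) (x : B) {Z : S → B}
    (hZ : Integrable Z P) (hcentred : ∫ s, Z s ∂P = 0) :
    ∫⁻ s, seminormPow ν p (x + Z s) ∂P
      ≤ seminormPow ν p x + C * ∫⁻ s, seminormPow ν p (Z s) ∂P := by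
  have hjensen : seminormPow ν p x ≤ ∫⁻ s, seminormPow ν p (x - Z s) ∂P := by
    simpa [integral_sub (integrable_const x) hZ, hcentred] using
      hν.seminormPow_integral_le hp ((integrable_const x).sub hZ)
  have hmeas : AEMeasurable (fun s => seminormPow ν p (x + Z s)) P :=
    ((hν.continuous_seminormPow (by linarith)).comp_aestronglyMeasurable
      (aestronglyMeasurable_const.add hZ.1)).aemeasurable
  refine (ENNReal.add_le_add_iff_right (a := seminormPow ν p x) ENNReal.ofReal_ne_top).1 ?_
  calc ∫⁻ s, seminormPow ν p (x + Z s) ∂P + seminormPow ν p x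
      ≤ ∫⁻ s, seminormPow ν p (x + Z s) ∂P + ∫⁻ s, seminormPow ν p (x - Z s) ∂P := by gcongr
    _ = ∫⁻ s, (seminormPow ν p (x + Z s) + seminormPow ν p (x - Z s)) ∂P :=
        (lintegral_add_left' hmeas _).symm
    _ ≤ ∫⁻ s, (2 * seminormPow ν p x + C * seminormPow ν p (Z s)) ∂P :=
        lintegral_mono fun s => hν.seminormPow_add_add_seminormPow_sub_le x (Z s)
    _ = 2 * seminormPow ν p x + C * ∫⁻ s, seminormPow ν p (Z s) ∂P := by
        rw [lintegral_add_left measurable_const, lintegral_const_mul' _ _ ENNReal.coe_ne_top]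
        simp
    _ = seminormPow ν p x + C * ∫⁻ s, seminormPow ν p (Z s) ∂P + seminormPow ν p x := by ring

end IsPowerSmooth

end Smoothness

section IidLaw

variable {S ι κ ι' : Type*} [MeasurableSpace S] (P : Measure S) [IsProbabilityMeasure P]

/-- The law of an i.i.d. family indexed by `ι` with common law `P`. -/
noncomputable abbrev iidLaw (ι : Type*) (P : Measure S) : Measure (ι → S) :=
  Measure.infinitePi fun _ : ι => P

lemma measurePreserving_sumElim :
    MeasurePreserving (fun z : (ι → S) × (κ → S) => (Sum.elim z.1 z.2 : ι ⊕ κ → S))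
      ((iidLaw ι P).prod (iidLaw κ P)) (iidLaw (ι ⊕ κ) P) := by
  have hmeas : Measurable fun z : (ι → S) × (κ → S) => (Sum.elim z.1 z.2 : ι ⊕ κ → S) :=
    measurable_pi_iff.2 fun i => i.casesOn
      (fun i => (measurable_pi_apply i).comp measurable_fst)
      (fun i => (measurable_pi_apply i).comp measurable_snd)
  refine ⟨hmeas, Measure.eq_infinitePi _ fun s t ht => ?_⟩
  have hpre : (fun z : (ι → S) × (κ → S) => (Sum.elim z.1 z.2 : ι ⊕ κ → S)) ⁻¹' Set.pi s t
      = (Set.pi s.toLeft fun i => t (Sum.inl i)) ×ˢ (Set.pi s.toRight fun i => t (Sum.inr i)) := by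
    ext z
    simp [Set.mem_pi, Sum.forall]
  rw [Measure.map_apply hmeas (.pi s.countable_toSet fun i _ => ht i), hpre,
    Measure.prod_prod, Measure.infinitePi_pi _ fun i _ => ht _,
    Measure.infinitePi_pi _ fun i _ => ht _]
  conv_rhs => rw [← Finset.toLeft_disjSum_toRight (u := s), Finset.prod_disjSum]

lemma measurePreserving_comp_injective {f : ι' → ι} (hf : f.Injective) :
    MeasurePreserving (fun (x : ι → S) i => x (f i)) (iidLaw ι P) (iidLaw ι' P) :=
  ⟨by fun_prop, Measure.map_infinitePi_infinitePi_of_inj hf⟩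

lemma measurePreserving_sumElim_comp {f : ι' → ι ⊕ κ} (hf : f.Injective) :
    MeasurePreserving (fun (z : (ι → S) × (κ → S)) i => Sum.elim z.1 z.2 (f i))
      ((iidLaw ι P).prod (iidLaw κ P)) (iidLaw ι' P) :=
  (measurePreserving_comp_injective P hf).comp (measurePreserving_sumElim P)

lemma measurePreserving_const_unit :
    MeasurePreserving (fun (s : S) (_ : Unit) => s) P (iidLaw Unit P) := by
  have heval : MeasurePreserving (MeasurableEquiv.funUnique Unit S) (iidLaw Unit P) P :=
    measurePreserving_eval_infinitePi (fun _ : Unit => P) ()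
  exact heval.symm

lemma measurePreserving_sumElim_const_comp {f : ι' → ι ⊕ Unit} (hf : f.Injective) :
    MeasurePreserving (fun (z : (ι → S) × S) i => Sum.elim z.1 (fun _ => z.2) (f i))
      ((iidLaw ι P).prod P) (iidLaw ι' P) :=
  (measurePreserving_sumElim_comp P hf).comp
    ((MeasurePreserving.id _).prod (measurePreserving_const_unit P))

lemma measurePreserving_update [DecidableEq ι] (k : ι) :
    MeasurePreserving (fun z : (ι → S) × S => Function.update z.1 k z.2)
      ((iidLaw ι P).prod P) (iidLaw ι P) := by
  have hf : Function.Injective fun i => if i = k then (Sum.inr () : ι ⊕ Unit) else Sum.inl i := by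
    intro i j h
    by_cases hi : i = k <;> by_cases hj : j = k <;> simp_all
  convert measurePreserving_sumElim_const_comp P hf using 2 with z
  ext i
  by_cases hi : i = k
  · subst hi
    simp
  · simp [hi]

lemma measurePreserving_piecewise [DecidableEq ι] (J : Finset ι) :
    MeasurePreserving (fun z : (ι → S) × (ι → S) => J.piecewise z.1 z.2)
      ((iidLaw ι P).prod (iidLaw ι P)) (iidLaw ι P) := by
  have hf : Function.Injective fun i => if i ∈ J then (Sum.inl i : ι ⊕ ι) else Sum.inr i := by
    intro i j h
    by_cases hi : i ∈ J <;> by_cases hj : j ∈ J <;> simp_all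
  convert measurePreserving_sumElim_comp P hf using 2 with z
  ext i
  by_cases hi : i ∈ J <;> simp [hi]

/-- `Fin.snoc` for tuples with entries in a fixed type: `s` is appended to `x` as last entry. -/
def snocArg {m : ℕ} (x : Fin m → S) (s : S) : Fin (m + 1) → S := Fin.snoc (α := fun _ => S) x s

lemma measurePreserving_snocArg (m : ℕ) :
    MeasurePreserving (fun z : (Fin m → S) × S => snocArg z.1 z.2)
      ((iidLaw (Fin m) P).prod P) (iidLaw (Fin (m + 1)) P) := by
  have hf : Function.Injective
      (Fin.lastCases (Sum.inr ()) (fun i => Sum.inl i) : Fin (m + 1) → Fin m ⊕ Unit) := by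
    intro i j
    refine Fin.lastCases ?_ (fun i => ?_) i <;> refine Fin.lastCases ?_ (fun j => ?_) j <;> simp
  convert measurePreserving_sumElim_const_comp P hf using 2 with z
  ext i
  refine Fin.lastCases ?_ (fun i => ?_) i <;> simp [snocArg]

variable {T : Type*} [MeasurableSpace T] (τ : Measure T) [SFinite τ]

lemma lintegral_lintegral_update [DecidableEq ι] (k : ι) {f : (ι → S) × T → ℝ≥0∞}
    (hf : Measurable f) :
    ∫⁻ z, ∫⁻ y, f (Function.update z.1 k y, z.2) ∂P ∂((iidLaw ι P).prod τ)
      = ∫⁻ z, f z ∂((iidLaw ι P).prod τ) := by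
  have hup := measurePreserving_update P k
  have hjoint : Measurable fun w : ((ι → S) × T) × S => f (Function.update w.1.1 k w.2, w.1.2) :=
    hf.comp <| Measurable.prodMk
      (hup.measurable.comp (by fun_prop : Measurable fun w : ((ι → S) × T) × S => (w.1.1, w.2)))
      (by fun_prop)
  have hmarginal : Measurable fun x : ι → S => ∫⁻ t, f (x, t) ∂τ := hf.lintegral_prod_right'
  calc ∫⁻ z, ∫⁻ y, f (Function.update z.1 k y, z.2) ∂P ∂((iidLaw ι P).prod τ)
      = ∫⁻ x, ∫⁻ t, ∫⁻ y, f (Function.update x k y, t) ∂P ∂τ ∂(iidLaw ι P) :=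
        lintegral_prod _ hjoint.lintegral_prod_right'.aemeasurable
    _ = ∫⁻ x, ∫⁻ y, ∫⁻ t, f (Function.update x k y, t) ∂τ ∂P ∂(iidLaw ι P) := by
        refine lintegral_congr fun x => lintegral_lintegral_swap
          (f := fun t y => f (Function.update x k y, t)) (Measurable.aemeasurable ?_)
        exact hjoint.comp (by fun_prop : Measurable fun w : T × S => ((x, w.1), w.2))
    _ = ∫⁻ z, ∫⁻ t, f (Function.update z.1 k z.2, t) ∂τ ∂((iidLaw ι P).prod P) :=
        (lintegral_prod _ (hmarginal.comp hup.measurable).aemeasurable).symm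
    _ = ∫⁻ x, ∫⁻ t, f (x, t) ∂τ ∂(iidLaw ι P) := hup.lintegral_comp hmarginal
    _ = ∫⁻ z, f z ∂((iidLaw ι P).prod τ) := (lintegral_prod _ hf.aemeasurable).symm

end IidLaw

section MartingaleType

/-- `E` is a martingale difference sequence with respect to an i.i.d. sequence of law `P`: `E k` is
a function of the first `k + 1` terms of the sequence, centred in the term of index `k`. It may
depend on a further parameter of law `τ`. -/
structure IsMartingaleDiff {B S T : Type*} [NormedAddCommGroup B] [NormedSpace ℝ B]
    [MeasurableSpace S] [MeasurableSpace T] (P : Measure S) (τ : Measure T)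
    (E : ℕ → (ℕ → S) × T → B) : Prop where
  stronglyMeasurable : ∀ k, StronglyMeasurable (E k)
  adapted : ∀ k l, k < l → ∀ x y t, E k (Function.update x l y, t) = E k (x, t)
  integrable : ∀ k, ∀ᵐ z ∂((iidLaw ℕ P).prod τ),
    Integrable (fun y => E k (Function.update z.1 k y, z.2)) P
  integral_eq_zero : ∀ k, ∀ᵐ z ∂((iidLaw ℕ P).prod τ),
    ∫ y, E k (Function.update z.1 k y, z.2) ∂P = 0

lemma IsPowerSmooth.lintegral_seminormPow_sum_le {B S T : Type*} [NormedAddCommGroup B]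
    [NormedSpace ℝ B] [CompleteSpace B] {p : ℝ} {C : ℝ≥0} {ν : Seminorm ℝ B}
    [MeasurableSpace S] {P : Measure S} [IsProbabilityMeasure P] [MeasurableSpace T]
    {τ : Measure T} [SFinite τ] (hν : IsPowerSmooth p C ν) (hp : 1 ≤ p)
    {E : ℕ → (ℕ → S) × T → B} (hE : IsMartingaleDiff P τ E) (n : ℕ) :
    ∫⁻ z, seminormPow ν p (∑ k ∈ Finset.range n, E k z) ∂((iidLaw ℕ P).prod τ)
      ≤ C * ∑ k ∈ Finset.range n, ∫⁻ z, seminormPow ν p (E k z) ∂((iidLaw ℕ P).prod τ) := by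
  have hcont := hν.continuous_seminormPow (by linarith)
  have hsum : ∀ n, StronglyMeasurable fun z => ∑ k ∈ Finset.range n, E k z := fun n =>
    Finset.stronglyMeasurable_fun_sum _ fun k _ => hE.stronglyMeasurable k
  induction n with
  | zero => simp [seminormPow, (by linarith : p ≠ 0)]
  | succ n ih =>
    have hcond : ∀ᵐ z ∂((iidLaw ℕ P).prod τ),
        ∫⁻ y, seminormPow ν p (∑ k ∈ Finset.range (n + 1), E k (Function.update z.1 n y, z.2)) ∂P
          ≤ seminormPow ν p (∑ k ∈ Finset.range n, E k z)
            + C * ∫⁻ y, seminormPow ν p (E n (Function.update z.1 n y, z.2)) ∂P := by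
      filter_upwards [hE.integrable n, hE.integral_eq_zero n] with z hint hzero
      refine le_trans (le_of_eq (lintegral_congr fun y => ?_))
        (hν.lintegral_seminormPow_add_le hp _ hint hzero)
      rw [Finset.sum_range_succ]
      congr 2
      exact Finset.sum_congr rfl fun k hk => hE.adapted k n (Finset.mem_range.1 hk) _ _ _
    rw [← lintegral_lintegral_update P τ n
        (hcont.comp_stronglyMeasurable (hsum (n + 1))).measurable]
    refine (lintegral_mono_ae hcond).trans ?_
    rw [lintegral_add_left (hcont.comp_stronglyMeasurable (hsum n)).measurable,
      lintegral_const_mul' _ _ ENNReal.coe_ne_top,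
      lintegral_lintegral_update P τ n
        (hcont.comp_stronglyMeasurable (hE.stronglyMeasurable n)).measurable,
      Finset.sum_range_succ, mul_add]
    gcongr

/-- The space `B` has martingale type `p` with constant `C`, for the martingale difference
sequences of `IsMartingaleDiff` over spaces `S`, `T` in the universe `u`. -/
def HasMartingaleType.{u, v} (p : ℝ) (C : ℝ≥0∞) (B : Type v) [NormedAddCommGroup B]
    [NormedSpace ℝ B] : Prop :=
  ∀ (S T : Type u) [MeasurableSpace S] [MeasurableSpace T] (P : Measure S) [IsProbabilityMeasure P]
    (τ : Measure T) [IsProbabilityMeasure τ] (E : ℕ → (ℕ → S) × T → B),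
    IsMartingaleDiff P τ E →
    ∀ n, ∫⁻ z, ‖∑ k ∈ Finset.range n, E k z‖ₑ ^ p ∂((iidLaw ℕ P).prod τ)
      ≤ C * ∑ k ∈ Finset.range n, ∫⁻ z, ‖E k z‖ₑ ^ p ∂((iidLaw ℕ P).prod τ)

lemma IsPowerSmooth.exists_hasMartingaleType.{u, v} {B : Type v} [NormedAddCommGroup B]
    [NormedSpace ℝ B] [CompleteSpace B] {p : ℝ} {C : ℝ≥0} {ν : Seminorm ℝ B}
    (hν : IsPowerSmooth p C ν) (hp : 1 ≤ p) :
    ∃ C' : ℝ≥0∞, C' ≠ ∞ ∧ HasMartingaleType.{u, v} p C' B := by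
  obtain ⟨a, ha, hnorm⟩ := hν.exists_enorm_rpow_le_mul (by linarith)
  obtain ⟨b, hb, hsemi⟩ := hν.exists_seminormPow_le_mul (by linarith)
  refine ⟨a * (C * b), by finiteness, fun S T _ _ P _ τ _ E hE n => ?_⟩
  calc ∫⁻ z, ‖∑ k ∈ Finset.range n, E k z‖ₑ ^ p ∂((iidLaw ℕ P).prod τ)
      ≤ a * ∫⁻ z, seminormPow ν p (∑ k ∈ Finset.range n, E k z) ∂((iidLaw ℕ P).prod τ) := by
        rw [← lintegral_const_mul' _ _ ha]
        exact lintegral_mono fun z => hnorm _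
    _ ≤ a * (C * ∑ k ∈ Finset.range n,
          ∫⁻ z, seminormPow ν p (E k z) ∂((iidLaw ℕ P).prod τ)) := by
        gcongr
        exact hν.lintegral_seminormPow_sum_le hp hE n
    _ ≤ a * (C * ∑ k ∈ Finset.range n,
          (b * ∫⁻ z, ‖E k z‖ₑ ^ p ∂((iidLaw ℕ P).prod τ))) := by
        gcongr with k
        rw [← lintegral_const_mul' _ _ hb]
        exact lintegral_mono fun z => hsemi _
    _ = a * (C * b) * ∑ k ∈ Finset.range n, ∫⁻ z, ‖E k z‖ₑ ^ p ∂((iidLaw ℕ P).prod τ) := by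
        rw [← Finset.mul_sum]
        ring

end MartingaleType

section LpPow

variable {T B : Type*} [MeasurableSpace T] [NormedAddCommGroup B]

/-- The `p`-th power of the norm of `L^p(τ; B)`. -/
noncomputable def lpPow (p : ℝ) (τ : Measure T) (f : T → B) : ℝ≥0∞ := ∫⁻ t, ‖f t‖ₑ ^ p ∂τ

variable {p : ℝ} {τ : Measure T}

lemma add_rpow_le_two_mul (hp : 1 ≤ p) (hp2 : p ≤ 2) (a b : ℝ≥0∞) :
    (a + b) ^ p ≤ 2 * (a ^ p + b ^ p) := by
  refine (ENNReal.rpow_add_le_mul_rpow_add_rpow a b hp).trans ?_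
  gcongr
  calc (2 : ℝ≥0∞) ^ (p - 1) ≤ 2 ^ (1 : ℝ) :=
        ENNReal.rpow_le_rpow_of_exponent_le (by norm_num) (by linarith)
    _ = 2 := ENNReal.rpow_one 2

lemma lpPow_le_of_enorm_le (hp : 1 ≤ p) (hp2 : p ≤ 2) {f g h : T → B}
    (hf : AEStronglyMeasurable f τ) (hle : ∀ t, ‖h t‖ₑ ≤ ‖f t‖ₑ + ‖g t‖ₑ) :
    lpPow p τ h ≤ 2 * (lpPow p τ f + lpPow p τ g) := by
  unfold lpPow
  rw [← lintegral_add_left' (by fun_prop), ← lintegral_const_mul' _ _ ENNReal.ofNat_ne_top]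
  refine lintegral_mono fun t => ?_
  exact (ENNReal.rpow_le_rpow (hle t) (by linarith)).trans (add_rpow_le_two_mul hp hp2 _ _)

variable {X : Type*} [MeasurableSpace X] [SFinite τ] {f : X × T → B}

lemma measurable_lpPow (hf : StronglyMeasurable f) :
    Measurable fun x => lpPow p τ fun t => f (x, t) :=
  (hf.enorm.pow_const p).lintegral_prod_right'

lemma lintegral_lpPow {μ : Measure X} (hf : StronglyMeasurable f) :
    ∫⁻ x, lpPow p τ (fun t => f (x, t)) ∂μ = ∫⁻ z, ‖f z‖ₑ ^ p ∂(μ.prod τ) :=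
  (lintegral_prod _ (hf.enorm.pow_const p).aemeasurable).symm

end LpPow

section Stopping

lemma measurable_finset_sup {X ι : Type*} [MeasurableSpace X] (F : Finset ι) {f : ι → X → ℝ≥0∞}
    (hf : ∀ i, Measurable (f i)) : Measurable fun x => F.sup fun i => f i x := by
  simp_rw [Finset.sup_eq_iSup]
  exact .biSup _ F.countable_toSet fun i _ => hf i

variable {B S T : Type*} [NormedAddCommGroup B] [MeasurableSpace S] [MeasurableSpace T]

/-- The `p`-th power of the norm, in `L^p(τ; B)`, of the partial sum of the first `j` terms. -/
noncomputable def sumPow (p : ℝ) (τ : Measure T) (E : ℕ → (ℕ → S) × T → B) (j : ℕ) (x : ℕ → S) :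
    ℝ≥0∞ := lpPow p τ fun t => ∑ k ∈ Finset.range j, E k (x, t)

/-- The `p`-th power of the norm of the increment of index `k` in `L^p(τ; B)`. -/
noncomputable def incPow (p : ℝ) (τ : Measure T) (E : ℕ → (ℕ → S) × T → B) (k : ℕ) (x : ℕ → S) :
    ℝ≥0∞ := lpPow p τ fun t => E k (x, t)

/-- The conditional expectation of `incPow p τ E k` given the past, that is, integrated over the
term of index `k`. -/
noncomputable def condIncPow (p : ℝ) (P : Measure S) (τ : Measure T) (E : ℕ → (ℕ → S) × T → B)
    (k : ℕ) (x : ℕ → S) : ℝ≥0∞ := ∫⁻ y, incPow p τ E k (Function.update x k y) ∂P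

/-- The event that step `k` is taken between the passage times of the levels `L` and `10 L`, the
past increments and conditional moments being bounded by `D`. It depends on the past only. -/
def window (p : ℝ) (P : Measure S) (τ : Measure T) (E : ℕ → (ℕ → S) × T → B) (L D : ℝ≥0∞)
    (k : ℕ) : Set (ℕ → S) :=
  {x | (∃ j ∈ Finset.range (k + 1), L < sumPow p τ E j x) ∧
    (∀ j ∈ Finset.range (k + 1), sumPow p τ E j x ≤ 10 * L) ∧
    (∀ j ∈ Finset.range k, incPow p τ E j x ≤ D) ∧
    ∑ j ∈ Finset.range (k + 1), condIncPow p P τ E j x ≤ D}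

/-- The martingale transform keeping only the increments taken in their window. -/
noncomputable def stoppedDiff (p : ℝ) (P : Measure S) (τ : Measure T) (E : ℕ → (ℕ → S) × T → B)
    (L D : ℝ≥0∞) (k : ℕ) (z : (ℕ → S) × T) : B :=
  (window p P τ E L D k).indicator (fun x => E k (x, z.2)) z.1

variable {P : Measure S} {τ : Measure T} {E : ℕ → (ℕ → S) × T → B} {p : ℝ} {L D : ℝ≥0∞}

lemma mem_window_iff {N j₁ j₂ : ℕ} {x : ℕ → S} (h₁ : IsLeast {j | L < sumPow p τ E j x} j₁)
    (h₂ : IsLeast {j | 10 * L < sumPow p τ E j x} j₂) (hinc : ∀ k < N, incPow p τ E k x ≤ D)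
    (hcond : ∑ k ∈ Finset.range N, condIncPow p P τ E k x ≤ D) {k : ℕ} (hk : k < N) :
    x ∈ window p P τ E L D k ↔ j₁ ≤ k ∧ k < j₂ := by
  constructor
  · rintro ⟨⟨j, hj, hjL⟩, hle, -, -⟩
    refine ⟨(h₁.2 hjL).trans (Finset.mem_range_succ_iff.1 hj), lt_of_not_ge fun hcon => ?_⟩
    exact h₂.1.not_ge (hle j₂ (Finset.mem_range_succ_iff.2 hcon))
  · rintro ⟨hjk, hkj⟩
    refine ⟨⟨j₁, Finset.mem_range_succ_iff.2 hjk, h₁.1⟩, fun j hj => not_lt.1 fun hcon => ?_,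
      fun j hj => hinc j ((Finset.mem_range.1 hj).trans hk),
      (Finset.sum_le_sum_of_subset (Finset.range_subset_range.2 hk)).trans hcond⟩
    exact ((h₂.2 hcon).trans (Finset.mem_range_succ_iff.1 hj)).not_gt hkj

lemma sum_stoppedDiff_eq_sub {N j₁ j₂ : ℕ} {x : ℕ → S} (h : j₁ ≤ j₂) (hN : j₂ ≤ N)
    (hmem : ∀ k < N, x ∈ window p P τ E L D k ↔ j₁ ≤ k ∧ k < j₂) (t : T) :
    ∑ k ∈ Finset.range N, stoppedDiff p P τ E L D k (x, t)
      = ∑ k ∈ Finset.range j₂, E k (x, t) - ∑ k ∈ Finset.range j₁, E k (x, t) := by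
  classical
  have hterm : ∀ k ∈ Finset.range N, stoppedDiff p P τ E L D k (x, t)
      = if k ∈ Finset.Ico j₁ j₂ then E k (x, t) else 0 := fun k hk => by
    simp only [stoppedDiff, Set.indicator_apply, hmem k (Finset.mem_range.1 hk), Finset.mem_Ico]
  rw [← Finset.sum_Ico_eq_sub _ h, Finset.sum_congr rfl hterm, ← Finset.sum_filter]
  congr 1
  ext k
  simp only [Finset.mem_filter, Finset.mem_range, Finset.mem_Ico]
  omega

lemma sum_indicator_window_le (N : ℕ) (x : ℕ → S) :
    ∑ k ∈ Finset.range N, (window p P τ E L D k).indicator (condIncPow p P τ E k) x ≤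
      {x | L < (Finset.range (N + 1)).sup fun j => sumPow p τ E j x}.indicator (fun _ => D) x := by
  classical
  have hle : ∀ n, ∑ k ∈ Finset.range n,
      (window p P τ E L D k).indicator (condIncPow p P τ E k) x ≤ D := by
    intro n
    induction n with
    | zero => simp
    | succ n ih =>
      by_cases hx : x ∈ window p P τ E L D n
      · exact (Finset.sum_le_sum fun k _ => Set.indicator_le_self' (fun _ _ => zero_le) x).trans
          hx.2.2.2
      · rwa [Finset.sum_range_succ, Set.indicator_of_notMem hx, add_zero]
  by_cases hx : x ∈ {x | L < (Finset.range (N + 1)).sup fun j => sumPow p τ E j x}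
  · rw [Set.indicator_of_mem hx]
    exact hle N
  · rw [Finset.sum_eq_zero]
    · exact zero_le
    intro k hk
    refine Set.indicator_of_notMem (fun hxk => hx ?_) _
    obtain ⟨j, hj, hjL⟩ := hxk.1
    have := Finset.mem_range.1 hj
    have := Finset.mem_range.1 hk
    exact hjL.trans_le (Finset.le_sup (f := fun j => sumPow p τ E j x)
      (Finset.mem_range.2 (by omega)))

variable [NormedSpace ℝ B]

namespace IsMartingaleDiff

lemma sumPow_update (hE : IsMartingaleDiff P τ E) {j l : ℕ} (h : j ≤ l) (x : ℕ → S) (y : S) :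
    sumPow p τ E j (Function.update x l y) = sumPow p τ E j x := by
  unfold sumPow
  congr 1
  ext t
  exact Finset.sum_congr rfl fun k hk =>
    hE.adapted k l ((Finset.mem_range.1 hk).trans_le h) _ _ _

lemma incPow_update (hE : IsMartingaleDiff P τ E) {j l : ℕ} (h : j < l) (x : ℕ → S) (y : S) :
    incPow p τ E j (Function.update x l y) = incPow p τ E j x := by
  unfold incPow
  congr 1
  ext t
  exact hE.adapted j l h _ _ _

lemma condIncPow_update (hE : IsMartingaleDiff P τ E) {j l : ℕ} (h : j ≤ l) (x : ℕ → S) (y : S) :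
    condIncPow p P τ E j (Function.update x l y) = condIncPow p P τ E j x := by
  refine lintegral_congr fun y' => ?_
  rcases h.eq_or_lt with rfl | h
  · rw [Function.update_idem]
  · rw [Function.update_comm h.ne', hE.incPow_update h]

lemma update_mem_window (hE : IsMartingaleDiff P τ E) {k l : ℕ} (h : k ≤ l) (x : ℕ → S) (y : S) :
    Function.update x l y ∈ window p P τ E L D k ↔ x ∈ window p P τ E L D k := by
  have hsum : ∀ j ∈ Finset.range (k + 1),
      sumPow p τ E j (Function.update x l y) = sumPow p τ E j x :=
    fun j hj => hE.sumPow_update ((Finset.mem_range_succ_iff.1 hj).trans h) _ _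
  have hinc : ∀ j ∈ Finset.range k, incPow p τ E j (Function.update x l y) = incPow p τ E j x :=
    fun j hj => hE.incPow_update ((Finset.mem_range.1 hj).trans_le h) _ _
  have hcond : ∑ j ∈ Finset.range (k + 1), condIncPow p P τ E j (Function.update x l y)
      = ∑ j ∈ Finset.range (k + 1), condIncPow p P τ E j x :=
    Finset.sum_congr rfl fun j hj =>
      hE.condIncPow_update ((Finset.mem_range_succ_iff.1 hj).trans h) _ _
  simp only [window, Set.mem_ofPred_eq, hcond]
  refine and_congr ?_ (and_congr ?_ (and_congr ?_ Iff.rfl))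
  · exact exists_congr fun j => and_congr_right fun hj => by rw [hsum j hj]
  · exact forall₂_congr fun j hj => by rw [hsum j hj]
  · exact forall₂_congr fun j hj => by rw [hinc j hj]

variable {x : ℕ → S}

lemma sumPow_le_four_mul_of_isLeast (hE : IsMartingaleDiff P τ E) (hp : 1 ≤ p) (hp2 : p ≤ 2)
    {N j : ℕ} (hj : IsLeast {j | L < sumPow p τ E j x} j) (hN : j ≤ N)
    (hinc : ∀ k < N, incPow p τ E k x ≤ L) : sumPow p τ E j x ≤ 4 * L := by
  cases j with
  | zero =>
    have hp0 : 0 < p := by linarith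
    simp [sumPow, lpPow, hp0]
  | succ i =>
    have hbefore : sumPow p τ E i x ≤ L := not_lt.1 fun hcon => absurd (hj.2 hcon) (by simp)
    calc sumPow p τ E (i + 1) x ≤ 2 * (sumPow p τ E i x + incPow p τ E i x) :=
          lpPow_le_of_enorm_le hp hp2 (Finset.stronglyMeasurable_fun_sum _ fun k _ =>
            (hE.stronglyMeasurable k).comp_measurable measurable_prodMk_left).aestronglyMeasurable
            fun t => by rw [Finset.sum_range_succ]; exact enorm_add_le _ _
      _ ≤ 2 * (L + L) := by
        gcongr
        exact hinc i hN
      _ = 4 * L := by ring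

lemma le_sumPow_stopped (hE : IsMartingaleDiff P τ E) (hp : 1 ≤ p) (hp2 : p ≤ 2) (hL : L ≠ ∞)
    (hDL : D ≤ L) {N : ℕ} (hmax : ∃ j ≤ N, 10 * L < sumPow p τ E j x)
    (hinc : ∀ k < N, incPow p τ E k x ≤ D)
    (hcond : ∑ k ∈ Finset.range N, condIncPow p P τ E k x ≤ D) :
    L ≤ sumPow p τ (stoppedDiff p P τ E L D) N x := by
  obtain ⟨j, hjN, hj⟩ := hmax
  have hL10 : L ≤ 10 * L := le_mul_of_one_le_left' (by norm_num)
  obtain ⟨j₁, h₁⟩ : ∃ j₁, IsLeast {j | L < sumPow p τ E j x} j₁ :=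
    ⟨_, Nat.sInf_mem ⟨j, hL10.trans_lt hj⟩, fun _ => Nat.sInf_le⟩
  obtain ⟨j₂, h₂⟩ : ∃ j₂, IsLeast {j | 10 * L < sumPow p τ E j x} j₂ :=
    ⟨_, Nat.sInf_mem ⟨j, hj⟩, fun _ => Nat.sInf_le⟩
  have hj₂N : j₂ ≤ N := (h₂.2 hj).trans hjN
  have hj₁₂ : j₁ ≤ j₂ := h₁.2 (hL10.trans_lt h₂.1)
  have hsum := sum_stoppedDiff_eq_sub hj₁₂ hj₂N fun k hk => mem_window_iff h₁ h₂ hinc hcond hk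
  have hsplit : sumPow p τ E j₂ x ≤ 2 * (sumPow p τ E j₁ x
      + sumPow p τ (stoppedDiff p P τ E L D) N x) := by
    refine lpPow_le_of_enorm_le hp hp2 (Finset.stronglyMeasurable_fun_sum _ fun k _ =>
      (hE.stronglyMeasurable k).comp_measurable measurable_prodMk_left).aestronglyMeasurable
      fun t => ?_
    refine le_trans (le_of_eq ?_) (enorm_add_le _ _)
    rw [hsum, add_sub_cancel]
  have hten : 2 * (4 * L) + 2 * L
      ≤ 2 * (4 * L) + 2 * sumPow p τ (stoppedDiff p P τ E L D) N x := by
    calc 2 * (4 * L) + 2 * L = 10 * L := by ring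
      _ ≤ sumPow p τ E j₂ x := h₂.1.le
      _ ≤ 2 * (sumPow p τ E j₁ x + sumPow p τ (stoppedDiff p P τ E L D) N x) := hsplit
      _ ≤ 2 * (4 * L + sumPow p τ (stoppedDiff p P τ E L D) N x) := by
        gcongr
        exact hE.sumPow_le_four_mul_of_isLeast hp hp2 h₁ (hj₁₂.trans hj₂N)
          fun k hk => (hinc k hk).trans hDL
      _ = 2 * (4 * L) + 2 * sumPow p τ (stoppedDiff p P τ E L D) N x := mul_add _ _ _
  rw [ENNReal.add_le_add_iff_left (by finiteness)] at hten
  exact (ENNReal.mul_le_mul_iff_right two_ne_zero ENNReal.ofNat_ne_top).1 hten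

lemma setOf_lt_sup_sumPow_subset (hE : IsMartingaleDiff P τ E) (hp : 1 ≤ p) (hp2 : p ≤ 2)
    (hL : L ≠ ∞) (hDL : D ≤ L) (N : ℕ) :
    {x | 10 * L < (Finset.range (N + 1)).sup fun j => sumPow p τ E j x} ⊆
      {x | L ≤ sumPow p τ (stoppedDiff p P τ E L D) N x}
        ∪ ({x | D < (Finset.range N).sup fun k => incPow p τ E k x}
          ∪ {x | D < ∑ k ∈ Finset.range N, condIncPow p P τ E k x}) := by
  intro x hx
  by_contra hcon
  simp only [Set.mem_union, Set.mem_ofPred_eq, not_or, not_lt] at hcon hx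
  obtain ⟨j, hj, hjL⟩ := Finset.lt_sup_iff.1 hx
  exact hcon.1 (hE.le_sumPow_stopped hp hp2 hL hDL ⟨j, Finset.mem_range_succ_iff.1 hj, hjL⟩
    (fun k hk => Finset.sup_le_iff.1 hcon.2.1 k (Finset.mem_range.2 hk)) hcon.2.2)

variable [SFinite τ]

lemma measurable_sumPow (hE : IsMartingaleDiff P τ E) (j : ℕ) : Measurable (sumPow p τ E j) :=
  measurable_lpPow (f := fun z => ∑ k ∈ Finset.range j, E k z)
    (Finset.stronglyMeasurable_fun_sum _ fun k _ => hE.stronglyMeasurable k)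

lemma measurable_sup_sumPow (hE : IsMartingaleDiff P τ E) (N : ℕ) :
    Measurable fun x => (Finset.range (N + 1)).sup fun j => sumPow p τ E j x :=
  measurable_finset_sup _ hE.measurable_sumPow

lemma measurable_incPow (hE : IsMartingaleDiff P τ E) (k : ℕ) : Measurable (incPow p τ E k) :=
  measurable_lpPow (hE.stronglyMeasurable k)

variable [IsProbabilityMeasure P]

lemma measurable_condIncPow (hE : IsMartingaleDiff P τ E) (k : ℕ) :
    Measurable (condIncPow p P τ E k) :=
  ((hE.measurable_incPow k).comp (measurePreserving_update P k).measurable).lintegral_prod_right'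

lemma measurableSet_window (hE : IsMartingaleDiff P τ E) (k : ℕ) :
    MeasurableSet (window p P τ E L D k) := by
  have hsum := fun j => hE.measurable_sumPow (p := p) j
  have hinc := fun j => hE.measurable_incPow (p := p) j
  have hcond := fun j => hE.measurable_condIncPow (p := p) j
  have hwindow : window p P τ E L D k =
      (⋃ j ∈ Finset.range (k + 1), {x | L < sumPow p τ E j x}) ∩
      ((⋂ j ∈ Finset.range (k + 1), {x | sumPow p τ E j x ≤ 10 * L}) ∩
      ((⋂ j ∈ Finset.range k, {x | incPow p τ E j x ≤ D}) ∩
      {x | ∑ j ∈ Finset.range (k + 1), condIncPow p P τ E j x ≤ D})) := by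
    ext x
    simp only [window, Set.mem_ofPred_eq, Set.mem_inter_iff, Set.mem_iUnion, Set.mem_iInter,
      exists_prop]
  rw [hwindow]
  exact (Finset.measurableSet_biUnion _ fun j _ => measurableSet_lt measurable_const (hsum j)).inter
    ((Finset.measurableSet_biInter _ fun j _ => measurableSet_le (hsum j) measurable_const).inter
    ((Finset.measurableSet_biInter _ fun j _ => measurableSet_le (hinc j) measurable_const).inter
    (measurableSet_le (Finset.measurable_fun_sum _ fun j _ => hcond j) measurable_const)))

lemma stopped (hE : IsMartingaleDiff P τ E) : IsMartingaleDiff P τ (stoppedDiff p P τ E L D) where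
  stronglyMeasurable k :=
    (hE.stronglyMeasurable k).indicator (measurable_fst (hE.measurableSet_window k))
  adapted k l h x y t := by
    classical
    simp only [stoppedDiff, Set.indicator_apply, hE.update_mem_window h.le, hE.adapted k l h]
  integrable k := by
    classical
    filter_upwards [hE.integrable k] with z hz
    by_cases h : z.1 ∈ window p P τ E L D k
    · simpa [stoppedDiff, Set.indicator_apply, hE.update_mem_window le_rfl, h] using hz
    · simp [stoppedDiff, hE.update_mem_window le_rfl, h]
  integral_eq_zero k := by
    classical
    filter_upwards [hE.integral_eq_zero k] with z hz
    by_cases h : z.1 ∈ window p P τ E L D k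
    · simpa [stoppedDiff, Set.indicator_apply, hE.update_mem_window le_rfl, h] using hz
    · simp [stoppedDiff, hE.update_mem_window le_rfl, h]

lemma lintegral_enorm_stopped_rpow (hE : IsMartingaleDiff P τ E) (hp : 0 < p) (k : ℕ) :
    ∫⁻ z, ‖stoppedDiff p P τ E L D k z‖ₑ ^ p ∂((iidLaw ℕ P).prod τ)
      = ∫⁻ x, (window p P τ E L D k).indicator (condIncPow p P τ E k) x ∂(iidLaw ℕ P) := by
  classical
  have hinc : ∀ x, lpPow p τ (fun t => stoppedDiff p P τ E L D k (x, t))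
      = (window p P τ E L D k).indicator (incPow p τ E k) x := by
    intro x
    by_cases h : x ∈ window p P τ E L D k <;> simp [stoppedDiff, h, incPow, lpPow, hp]
  have hmeas : Measurable ((window p P τ E L D k).indicator (incPow p τ E k)) :=
    (hE.measurable_incPow k).indicator (hE.measurableSet_window k)
  rw [← lintegral_lpPow (hE.stopped.stronglyMeasurable k)]
  simp_rw [hinc]
  rw [← (measurePreserving_update P k).lintegral_comp hmeas,
    lintegral_prod (fun z => (window p P τ E L D k).indicator (incPow p τ E k) _)
      (hmeas.comp (measurePreserving_update P k).measurable).aemeasurable]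
  refine lintegral_congr fun x => ?_
  by_cases h : x ∈ window p P τ E L D k
  · simp [hE.update_mem_window le_rfl, h, condIncPow]
  · simp [hE.update_mem_window le_rfl, h]

end IsMartingaleDiff

end Stopping

section GoodLambda

variable {p : ℝ} {C : ℝ≥0∞}

lemma HasMartingaleType.lintegral_sumPow_stopped_le.{u, v} {B : Type v} [NormedAddCommGroup B]
    [NormedSpace ℝ B] {S T : Type u} [MeasurableSpace S] [MeasurableSpace T] {P : Measure S}
    [IsProbabilityMeasure P] {τ : Measure T} [IsProbabilityMeasure τ] {E : ℕ → (ℕ → S) × T → B}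
    (hB : HasMartingaleType.{u, v} p C B) (hE : IsMartingaleDiff P τ E) (hp : 0 < p)
    (L D : ℝ≥0∞) (N : ℕ) :
    ∫⁻ x, sumPow p τ (stoppedDiff p P τ E L D) N x ∂(iidLaw ℕ P) ≤ C * (D *
      iidLaw ℕ P {x | L < (Finset.range (N + 1)).sup fun j => sumPow p τ E j x}) := by
  have hst : IsMartingaleDiff P τ (stoppedDiff p P τ E L D) := hE.stopped
  calc ∫⁻ x, sumPow p τ (stoppedDiff p P τ E L D) N x ∂(iidLaw ℕ P)
      = ∫⁻ z, ‖∑ k ∈ Finset.range N, stoppedDiff p P τ E L D k z‖ₑ ^ p ∂((iidLaw ℕ P).prod τ) :=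
        lintegral_lpPow (f := fun z => ∑ k ∈ Finset.range N, stoppedDiff p P τ E L D k z)
          (Finset.stronglyMeasurable_fun_sum _ fun k _ => hst.stronglyMeasurable k)
    _ ≤ C * ∑ k ∈ Finset.range N,
          ∫⁻ z, ‖stoppedDiff p P τ E L D k z‖ₑ ^ p ∂((iidLaw ℕ P).prod τ) := hB S T P τ _ hst N
    _ = C * ∫⁻ x, ∑ k ∈ Finset.range N,
          (window p P τ E L D k).indicator (condIncPow p P τ E k) x ∂(iidLaw ℕ P) := by
        rw [lintegral_finsetSum _ fun k _ =>
          (hE.measurable_condIncPow k).indicator (hE.measurableSet_window k)]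
        simp_rw [hE.lintegral_enorm_stopped_rpow hp]
    _ ≤ C * ∫⁻ x, {x | L < (Finset.range (N + 1)).sup fun j => sumPow p τ E j x}.indicator
          (fun _ => D) x ∂(iidLaw ℕ P) := by
        gcongr with x
        exact sum_indicator_window_le N x
    _ = C * (D * iidLaw ℕ P {x | L < (Finset.range (N + 1)).sup fun j => sumPow p τ E j x}) := by
        rw [lintegral_indicator_const
          (measurableSet_lt measurable_const (hE.measurable_sup_sumPow N))]

lemma HasMartingaleType.measure_goodLambda_le.{u, v} {B : Type v} [NormedAddCommGroup B]
    [NormedSpace ℝ B] {S T : Type u} [MeasurableSpace S] [MeasurableSpace T] {P : Measure S}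
    [IsProbabilityMeasure P] {τ : Measure T} [IsProbabilityMeasure τ] {E : ℕ → (ℕ → S) × T → B}
    (hB : HasMartingaleType.{u, v} p C B) (hE : IsMartingaleDiff P τ E) (hp : 1 ≤ p) (hp2 : p ≤ 2)
    {L δ : ℝ≥0∞} (hL0 : L ≠ 0) (hL : L ≠ ∞) (hδ : δ ≤ 1) (N : ℕ) :
    iidLaw ℕ P {x | 10 * L < (Finset.range (N + 1)).sup fun j => sumPow p τ E j x}
      ≤ C * δ * iidLaw ℕ P {x | L < (Finset.range (N + 1)).sup fun j => sumPow p τ E j x}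
        + (iidLaw ℕ P {x | δ * L < (Finset.range N).sup fun k => incPow p τ E k x}
          + iidLaw ℕ P {x | δ * L < ∑ k ∈ Finset.range N, condIncPow p P τ E k x}) := by
  set G := {x | L < (Finset.range (N + 1)).sup fun j => sumPow p τ E j x}
  have hst : IsMartingaleDiff P τ (stoppedDiff p P τ E L (δ * L)) := hE.stopped
  have hmarkov : iidLaw ℕ P {x | L ≤ sumPow p τ (stoppedDiff p P τ E L (δ * L)) N x}
      ≤ C * δ * iidLaw ℕ P G := by
    refine (meas_ge_le_lintegral_div (hst.measurable_sumPow N).aemeasurable hL0 hL).trans ?_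
    rw [ENNReal.div_le_iff hL0 hL]
    calc ∫⁻ x, sumPow p τ (stoppedDiff p P τ E L (δ * L)) N x ∂(iidLaw ℕ P)
        ≤ C * (δ * L * iidLaw ℕ P G) :=
          hB.lintegral_sumPow_stopped_le hE (by linarith) L (δ * L) N
      _ = C * δ * iidLaw ℕ P G * L := by ring
  refine (measure_mono (hE.setOf_lt_sup_sumPow_subset hp hp2 hL
    (mul_le_of_le_one_left' hδ) N)).trans ((measure_union_le _ _).trans ?_)
  exact add_le_add hmarkov (measure_union_le _ _)

lemma exists_tailIntegral_sup_sumPow_le.{u, v} {q : ℝ} (hp : 1 ≤ p) (hp2 : p ≤ 2) (hq : 0 < q)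
    (hC : C ≠ ∞) :
    ∃ K : ℝ≥0∞, K ≠ ∞ ∧ ∀ (B : Type v) [NormedAddCommGroup B] [NormedSpace ℝ B],
      HasMartingaleType.{u, v} p C B → ∀ (S T : Type u) [MeasurableSpace S] [MeasurableSpace T]
      (P : Measure S) [IsProbabilityMeasure P] (τ : Measure T) [IsProbabilityMeasure τ]
      (E : ℕ → (ℕ → S) × T → B), IsMartingaleDiff P τ E → ∀ (N : ℕ) (s : ℝ), 0 < s →
      tailIntegral p q (iidLaw ℕ P)
          (fun x => (Finset.range (N + 1)).sup fun j => sumPow p τ E j x) s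
        ≤ K * (tailIntegral p q (iidLaw ℕ P)
            (fun x => (Finset.range N).sup fun k => incPow p τ E k x) s
          + tailIntegral p q (iidLaw ℕ P)
            (fun x => ∑ k ∈ Finset.range N, condIncPow p P τ E k x) s) := by
  have hp0 : 0 < p := by linarith
  obtain ⟨b, hb1, hbp⟩ : ∃ b : ℝ, 1 < b ∧ b ^ p = 10 :=
    ⟨10 ^ (1 / p), Real.one_lt_rpow (by norm_num) (by positivity), by
      rw [← Real.rpow_mul (by norm_num), one_div_mul_cancel hp0.ne', Real.rpow_one]⟩
  obtain ⟨δ, hδ0, hδ1, hδ⟩ : ∃ δ : ℝ, 0 < δ ∧ δ ≤ 1 ∧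
      ENNReal.ofReal (b ^ q) * (C * ENNReal.ofReal δ) ≤ 1 / 2 := by
    obtain ⟨c, hc0, hc⟩ := ENNReal.exists_nnreal_pos_mul_lt
      (a := ENNReal.ofReal (b ^ q) * C) (b := 1 / 2) (by finiteness) (by simp)
    refine ⟨min 1 c, by positivity, min_le_left _ _, le_trans ?_ hc.le⟩
    rw [← mul_assoc, mul_comm, ← ENNReal.ofReal_coe_nnreal]
    gcongr
    exact min_le_right _ _
  refine ⟨2 * ENNReal.ofReal (b ^ q) * ENNReal.ofReal (δ ^ (-(q / p))), by finiteness, ?_⟩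
  intro B _ _ hB S T _ _ P _ τ _ E hE N s hs
  set X := fun x => (Finset.range (N + 1)).sup fun j => sumPow p τ E j x
  set Y := fun x => (Finset.range N).sup fun k => incPow p τ E k x
  set Z := fun x => ∑ k ∈ Finset.range N, condIncPow p P τ E k x
  have hgood : ∀ u : ℝ, 0 < u → iidLaw ℕ P {x | ENNReal.ofReal (s * (b * u) ^ p) < X x}
      ≤ C * ENNReal.ofReal δ * iidLaw ℕ P {x | ENNReal.ofReal (s * u ^ p) < X x}
        + (iidLaw ℕ P {x | ENNReal.ofReal (δ * s * u ^ p) < Y x}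
          + iidLaw ℕ P {x | ENNReal.ofReal (δ * s * u ^ p) < Z x}) := fun u hu => by
    have h := hB.measure_goodLambda_le hE hp hp2 (L := ENNReal.ofReal (s * u ^ p))
      (δ := ENNReal.ofReal δ) (by simpa using mul_pos hs (by positivity)) ENNReal.ofReal_ne_top
      (by simpa using hδ1) N
    rwa [← ENNReal.ofReal_mul hδ0.le, ← ENNReal.ofReal_ofNat 10, ← ENNReal.ofReal_mul (by simp),
      ← hbp, mul_left_comm, ← Real.mul_rpow (by linarith) hu.le, ← mul_assoc δ] at h
  calc tailIntegral p q (iidLaw ℕ P) X s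
      ≤ 2 * ENNReal.ofReal (b ^ q) * (tailIntegral p q (iidLaw ℕ P) Y (δ * s)
          + tailIntegral p q (iidLaw ℕ P) Z (δ * s)) := by
        unfold tailIntegral
        rw [← lintegral_add_left (measurable_measure_lt _ _ _ _)]
        exact lintegral_powWeight_le_of_goodLambda hb1 hδ (measurable_measure_lt _ _ _ _)
          (tailIntegral_ne_top hq X) hgood
    _ ≤ 2 * ENNReal.ofReal (b ^ q) * (ENNReal.ofReal (δ ^ (-(q / p)))
          * tailIntegral p q (iidLaw ℕ P) Y s + ENNReal.ofReal (δ ^ (-(q / p)))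
          * tailIntegral p q (iidLaw ℕ P) Z s) := by
        gcongr <;> exact tailIntegral_mul_le hp0 hδ0 hδ1 _
    _ = 2 * ENNReal.ofReal (b ^ q) * ENNReal.ofReal (δ ^ (-(q / p)))
          * (tailIntegral p q (iidLaw ℕ P) Y s + tailIntegral p q (iidLaw ℕ P) Z s) := by
        ring

end GoodLambda

section USum

variable {B S T : Type*} {m : ℕ}

@[simp] lemma snocArg_castSucc (x : Fin m → S) (s : S) (l : Fin m) :
    snocArg x s l.castSucc = x l := Fin.snoc_castSucc _ _ _

@[simp] lemma snocArg_last (x : Fin m → S) (s : S) : snocArg x s (Fin.last m) = s :=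
  Fin.snoc_last _ _

/-- `Fin.init` for tuples with entries in a fixed type: the last entry is removed. -/
def initArg (x : Fin (m + 1) → S) : Fin m → S := fun l => x l.castSucc

@[simp] lemma initArg_snocArg (x : Fin m → S) (s : S) : initArg (snocArg x s) = x :=
  Fin.init_snoc _ _

lemma snocArg_initArg (x : Fin (m + 1) → S) : snocArg (initArg x) (x (Fin.last m)) = x :=
  Fin.snoc_init_self x

lemma comp_snocArg (f : S → T) (x : Fin m → S) (s : S) :
    (fun l => f (snocArg x s l)) = snocArg (fun l => f (x l)) (f s) :=
  Fin.comp_snoc f x s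

lemma strictMono_snocArg_iff {i : Fin m → ℕ} {n : ℕ} :
    StrictMono (snocArg i n) ↔ (∀ l, i l < n) ∧ StrictMono i := by
  refine ⟨fun h => ⟨fun l => by simpa using h (Fin.castSucc_lt_last l), fun a b hab => by
    simpa using h (Fin.castSucc_lt_castSucc_iff.2 hab)⟩, fun ⟨hlt, hmono⟩ a b => ?_⟩
  refine Fin.lastCases ?_ (fun a => ?_) a <;> refine Fin.lastCases ?_ (fun b => ?_) b <;> intro h
  · exact absurd h (lt_irrefl _)
  · exact absurd h (Fin.le_last _).not_gt
  · simpa using hlt a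
  · simpa using hmono (Fin.castSucc_lt_castSucc_iff.1 h)

/-- The strictly increasing `m`-tuples of indices below `n`. -/
def incTuples (m n : ℕ) : Finset (Fin m → ℕ) :=
  (Fintype.piFinset fun _ : Fin m => Finset.range n).filter StrictMono

lemma mem_incTuples {n : ℕ} {i : Fin m → ℕ} :
    i ∈ incTuples m n ↔ (∀ l, i l < n) ∧ StrictMono i := by
  simp [incTuples]

lemma incTuples_zero_left (n : ℕ) : incTuples 0 n = {Fin.elim0} := by
  ext i
  rw [mem_incTuples, Finset.mem_singleton]
  exact ⟨fun _ => Subsingleton.elim _ _, fun _ => ⟨fun l => l.elim0, fun l => l.elim0⟩⟩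

lemma incTuples_succ_zero : incTuples (m + 1) 0 = ∅ :=
  Finset.eq_empty_of_forall_notMem fun _ hi =>
    absurd ((mem_incTuples.1 hi).1 0) (Nat.not_lt_zero _)

lemma incTuples_succ_succ (m n : ℕ) : incTuples (m + 1) (n + 1)
    = incTuples (m + 1) n ∪ (incTuples m n).image fun i => snocArg i n := by
  ext i
  simp only [Finset.mem_union, Finset.mem_image, mem_incTuples]
  constructor
  · rintro ⟨hlt, hmono⟩
    rcases (Nat.lt_succ_iff.1 (hlt (Fin.last m))).lt_or_eq with hlast | hlast
    · exact .inl ⟨fun l => (hmono.monotone (Fin.le_last l)).trans_lt hlast, hmono⟩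
    · rw [← snocArg_initArg i, hlast] at hmono ⊢
      exact .inr ⟨_, strictMono_snocArg_iff.1 hmono, rfl⟩
  · rintro (⟨hlt, hmono⟩ | ⟨i, hi, rfl⟩)
    · exact ⟨fun l => (hlt l).trans n.lt_succ_self, hmono⟩
    · refine ⟨fun l => ?_, strictMono_snocArg_iff.2 hi⟩
      refine Fin.lastCases ?_ (fun l => ?_) l
      · simp
      · simpa using (hi.1 l).trans n.lt_succ_self

/-- The kernel obtained by turning the last argument into a parameter. -/
def addParam (h : (Fin (m + 1) → S) × T → B) (w : (Fin m → S) × (S × T)) : B :=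
  h (snocArg w.1 w.2.1, w.2.2)

section Sum

variable [AddCommMonoid B]

/-- The `U`-statistic of order `m` over the first `n` indices, with a kernel depending on a
parameter. -/
def uSum (h : (Fin m → S) × T → B) (n : ℕ) (z : (ℕ → S) × T) : B :=
  ∑ i ∈ incTuples m n, h (fun l => z.1 (i l), z.2)

lemma uSum_update {h : (Fin m → S) × T → B} {n l : ℕ} (hl : n ≤ l) (x : ℕ → S) (y : S) (t : T) :
    uSum h n (Function.update x l y, t) = uSum h n (x, t) := by
  refine Finset.sum_congr rfl fun i hi => ?_
  congr 2
  ext k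
  exact Function.update_of_ne (((mem_incTuples.1 hi).1 k).trans_le hl).ne _ _

lemma uSum_zero_left (h : (Fin 0 → S) × T → B) (n : ℕ) (z : (ℕ → S) × T) :
    uSum h n z = h (Fin.elim0, z.2) := by
  rw [uSum, incTuples_zero_left, Finset.sum_singleton]
  congr 2
  exact Subsingleton.elim _ _

lemma uSum_succ (h : (Fin (m + 1) → S) × T → B) (n : ℕ) (z : (ℕ → S) × T) :
    uSum h (n + 1) z = uSum h n z + uSum (addParam h) n (z.1, (z.1 n, z.2)) := by
  have hdisj : Disjoint (incTuples (m + 1) n) ((incTuples m n).image fun i => snocArg i n) := by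
    refine Finset.disjoint_left.2 fun i hi hi' => ?_
    obtain ⟨i, -, rfl⟩ := Finset.mem_image.1 hi'
    simpa using (mem_incTuples.1 hi).1 (Fin.last m)
  unfold uSum
  rw [incTuples_succ_succ, Finset.sum_union hdisj,
    Finset.sum_image fun i _ j _ (hij : snocArg i n = snocArg j n) =>
      Fin.snoc_left_injective (α := fun _ => ℕ) n hij]
  simp only [addParam, comp_snocArg]

lemma uSum_eq_sum_range (h : (Fin (m + 1) → S) × T → B) (n : ℕ) (z : (ℕ → S) × T) :
    uSum h n z = ∑ k ∈ Finset.range n, uSum (addParam h) k (z.1, (z.1 k, z.2)) := by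
  induction n with
  | zero => rw [uSum, incTuples_succ_zero, Finset.sum_empty, Finset.sum_range_zero]
  | succ n ih => rw [uSum_succ, ih, Finset.sum_range_succ]

end Sum

variable [MeasurableSpace S] [MeasurableSpace T]

lemma measurable_snocArg : Measurable fun z : (Fin m → S) × S => snocArg z.1 z.2 := by
  refine measurable_pi_iff.2 fun l => ?_
  refine Fin.lastCases ?_ (fun l => ?_) l
  · simpa using measurable_snd
  · simp only [snocArg_castSucc]
    fun_prop

lemma measurable_snocArg_prod :
    Measurable fun w : (Fin m → S) × (S × T) => (snocArg w.1 w.2.1, w.2.2) :=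
  (measurable_snocArg.comp (f := fun w : (Fin m → S) × (S × T) => (w.1, w.2.1))
    (by fun_prop)).prodMk (by fun_prop)

section StronglyMeasurable

variable [TopologicalSpace B]

lemma stronglyMeasurable_addParam {h : (Fin (m + 1) → S) × T → B} (hh : StronglyMeasurable h) :
    StronglyMeasurable (addParam h) := hh.comp_measurable measurable_snocArg_prod

lemma stronglyMeasurable_uSum [AddCommMonoid B] [ContinuousAdd B] {h : (Fin m → S) × T → B}
    (hh : StronglyMeasurable h) (n : ℕ) : StronglyMeasurable (uSum h n) :=
  Finset.stronglyMeasurable_fun_sum _ fun i _ => hh.comp_measurable (by fun_prop)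

end StronglyMeasurable

variable {P : Measure S} [IsProbabilityMeasure P] {τ : Measure T} [SFinite τ]

lemma measurePreserving_snocArg_prod :
    MeasurePreserving (fun w : (Fin m → S) × (S × T) => (snocArg w.1 w.2.1, w.2.2))
      ((iidLaw (Fin m) P).prod (P.prod τ)) ((iidLaw (Fin (m + 1)) P).prod τ) :=
  ((measurePreserving_snocArg P m).prod (MeasurePreserving.id τ)).comp
    (measurePreserving_prodAssoc _ _ _).symm

lemma measurePreserving_incTuple {n : ℕ} {i : Fin m → ℕ} (hi : i ∈ incTuples m n) :
    MeasurePreserving (fun z : (ℕ → S) × T => ((fun l => z.1 (i l), z.2) : (Fin m → S) × T))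
      ((iidLaw ℕ P).prod τ) ((iidLaw (Fin m) P).prod τ) :=
  (measurePreserving_comp_injective P (mem_incTuples.1 hi).2.injective).prod
    (MeasurePreserving.id τ)

lemma measurePreserving_prod_left_comm {α β γ : Type*} [MeasurableSpace α] [MeasurableSpace β]
    [MeasurableSpace γ] (μ₁ : Measure α) (μ₂ : Measure β) (μ₃ : Measure γ) [SFinite μ₁]
    [SFinite μ₂] [SFinite μ₃] :
    MeasurePreserving (fun z : β × (α × γ) => (z.2.1, (z.1, z.2.2)))
      (μ₂.prod (μ₁.prod μ₃)) (μ₁.prod (μ₂.prod μ₃)) :=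
  ((measurePreserving_prodAssoc μ₁ μ₂ μ₃).comp
    ((Measure.measurePreserving_swap (μ := μ₂) (ν := μ₁)).prod (MeasurePreserving.id μ₃))).comp
      (measurePreserving_prodAssoc μ₂ μ₁ μ₃).symm

end USum

section Kernels

variable {B S T : Type*} {m : ℕ}

/-- The kernel with its last argument fixed. -/
def fixLast (h : (Fin (m + 1) → S) × T → B) (s : S) (w : (Fin m → S) × T) : B :=
  h (snocArg w.1 s, w.2)

/-- A kernel of order `m` regarded as a kernel of order `m + 1`. -/
def forgetLast (f : (Fin m → S) × T → B) (w : (Fin (m + 1) → S) × T) : B := f (initArg w.1, w.2)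

lemma piecewise_map_castSucc (J : Finset (Fin m)) (z : Fin (m + 1) → S) (y : Fin m → S) (s : S) :
    (J.map Fin.castSuccEmb).piecewise z (snocArg y s) = snocArg (J.piecewise (initArg z) y) s := by
  ext l
  refine Fin.lastCases ?_ (fun l => ?_) l
  · simp [Finset.piecewise, Fin.castSucc_ne_last]
  · by_cases hl : l ∈ J <;> simp [Finset.piecewise, hl, initArg]

lemma piecewise_insert_last (J : Finset (Fin m)) (z : Fin (m + 1) → S) (y : Fin m → S) (s : S) :
    (insert (Fin.last m) (J.map Fin.castSuccEmb)).piecewise z (snocArg y s)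
      = snocArg (J.piecewise (initArg z) y) (z (Fin.last m)) := by
  ext l
  refine Fin.lastCases ?_ (fun l => ?_) l
  · simp [Finset.piecewise]
  · by_cases hl : l ∈ J <;> simp [Finset.piecewise, hl, initArg, Fin.castSucc_ne_last]

lemma sum_finset_le_of_forall_le {f : Finset (Fin m) → ℝ≥0∞} {c : ℝ≥0∞} (h : ∀ J, f J ≤ c) :
    ∑ J, f J ≤ 2 ^ m * c :=
  (Finset.sum_le_card_nsmul _ _ c fun J _ => h J).trans (by simp)

variable [MeasurableSpace S] [MeasurableSpace T]

lemma stronglyMeasurable_fixLast [TopologicalSpace B] {h : (Fin (m + 1) → S) × T → B}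
    (hh : StronglyMeasurable h) (s : S) : StronglyMeasurable (fixLast h s) :=
  hh.comp_measurable <| Measurable.prodMk
    (measurable_snocArg.comp (f := fun w : (Fin m → S) × T => (w.1, s)) (by fun_prop)) (by fun_prop)

lemma stronglyMeasurable_forgetLast [TopologicalSpace B] {f : (Fin m → S) × T → B}
    (hf : StronglyMeasurable f) : StronglyMeasurable (forgetLast f) :=
  hf.comp_measurable <| Measurable.prodMk (by unfold initArg; fun_prop) (by fun_prop)

lemma measurable_piecewise (J : Finset (Fin m)) :
    Measurable fun w : (Fin m → S) × (Fin m → S) => J.piecewise w.1 w.2 := by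
  refine measurable_pi_iff.2 fun i => ?_
  by_cases hi : i ∈ J <;> simp only [hi, Finset.piecewise, if_true, if_false] <;> fun_prop

section Mean

variable [NormedAddCommGroup B] [NormedSpace ℝ B] {P : Measure S}

/-- The kernel with its last argument integrated out. -/
noncomputable def meanLast (P : Measure S) (h : (Fin (m + 1) → S) × T → B) (w : (Fin m → S) × T) :
    B := ∫ s, h (snocArg w.1 s, w.2) ∂P

/-- The kernel centred in its last argument. -/
noncomputable def centreLast (P : Measure S) (h : (Fin (m + 1) → S) × T → B)
    (w : (Fin (m + 1) → S) × T) : B := h w - forgetLast (meanLast P h) w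

lemma stronglyMeasurable_meanLast [SFinite P] {h : (Fin (m + 1) → S) × T → B}
    (hh : StronglyMeasurable h) : StronglyMeasurable (meanLast P h) := by
  have hmeas : StronglyMeasurable fun w : ((Fin m → S) × T) × S => h (snocArg w.1.1 w.2, w.1.2) :=
    hh.comp_measurable <| Measurable.prodMk (measurable_snocArg.comp
      (f := fun w : ((Fin m → S) × T) × S => (w.1.1, w.2)) (by fun_prop)) (by fun_prop)
  exact hmeas.integral_prod_right'

lemma stronglyMeasurable_centreLast [SFinite P] {h : (Fin (m + 1) → S) × T → B}
    (hh : StronglyMeasurable h) : StronglyMeasurable (centreLast P h) :=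
  hh.sub (stronglyMeasurable_forgetLast (stronglyMeasurable_meanLast hh))

lemma enorm_integral_rpow_le [IsProbabilityMeasure P] {p : ℝ} (hp : 1 ≤ p) {f : S → B}
    (hf : AEStronglyMeasurable f P) : ‖∫ a, f a ∂P‖ₑ ^ p ≤ ∫⁻ a, ‖f a‖ₑ ^ p ∂P := by
  have hp0 : 0 < p := by linarith
  have hjensen : ∫⁻ a, ‖f a‖ₑ ∂P ≤ (∫⁻ a, ‖f a‖ₑ ^ p ∂P) ^ (1 / p) := by
    simpa only [eLpNorm', ENNReal.rpow_one, div_one] using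
      eLpNorm'_le_eLpNorm'_of_exponent_le one_pos hp P hf
  calc ‖∫ a, f a ∂P‖ₑ ^ p ≤ ((∫⁻ a, ‖f a‖ₑ ^ p ∂P) ^ (1 / p)) ^ p :=
        ENNReal.rpow_le_rpow ((enorm_integral_le_lintegral_enorm f).trans hjensen) hp0.le
    _ = ∫⁻ a, ‖f a‖ₑ ^ p ∂P := by
        rw [← ENNReal.rpow_mul, one_div_mul_cancel hp0.ne', ENNReal.rpow_one]

end Mean

section Moments

variable [NormedAddCommGroup B] {P : Measure S} {τ : Measure T} {p q s : ℝ}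

/-- The conditional `p`-th moment of the kernel given the arguments of index in `J`, the other
arguments and the parameter being integrated out. -/
noncomputable def condMoment (p : ℝ) (P : Measure S) (τ : Measure T)
    (h : (Fin m → S) × T → B) (J : Finset (Fin m)) (x : Fin m → S) : ℝ≥0∞ :=
  ∫⁻ y, lpPow p τ (fun t => h (J.piecewise x y, t)) ∂(iidLaw (Fin m) P)

/-- The sum of the weighted tails of all the conditional `p`-th moments of the kernel. -/
noncomputable def momentTail (p q : ℝ) (P : Measure S) (τ : Measure T)
    (h : (Fin m → S) × T → B) (s : ℝ) : ℝ≥0∞ :=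
  ∑ J : Finset (Fin m), tailIntegral p q (iidLaw (Fin m) P) (condMoment p P τ h J) s

lemma tailIntegral_le_momentTail (h : (Fin m → S) × T → B) (J : Finset (Fin m)) :
    tailIntegral p q (iidLaw (Fin m) P) (condMoment p P τ h J) s ≤ momentTail p q P τ h s :=
  Finset.single_le_sum
    (f := fun J => tailIntegral p q (iidLaw (Fin m) P) (condMoment p P τ h J) s)
    (fun _ _ => zero_le) (Finset.mem_univ J)

lemma momentTail_antitone (h : (Fin m → S) × T → B) : Antitone (momentTail p q P τ h) :=
  fun _ _ hs => Finset.sum_le_sum fun _ _ => tailIntegral_antitone _ hs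

variable [IsProbabilityMeasure P]

lemma measurePreserving_initArg :
    MeasurePreserving (initArg (S := S) (m := m)) (iidLaw (Fin (m + 1)) P) (iidLaw (Fin m) P) :=
  measurePreserving_comp_injective P (Fin.castSucc_injective m)

lemma lintegral_snocArg {F : (Fin (m + 1) → S) → ℝ≥0∞} (hF : Measurable F) :
    ∫⁻ z, F z ∂(iidLaw (Fin (m + 1)) P)
      = ∫⁻ y, ∫⁻ s, F (snocArg y s) ∂P ∂(iidLaw (Fin m) P) := by
  rw [← (measurePreserving_snocArg P m).lintegral_comp hF]
  exact lintegral_prod (fun z : (Fin m → S) × S => F (snocArg z.1 z.2))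
    (hF.comp (measurePreserving_snocArg P m).measurable).aemeasurable

variable [SFinite τ]

lemma measurable_lpPow_piecewise {h : (Fin m → S) × T → B} (hh : StronglyMeasurable h)
    (J : Finset (Fin m)) : Measurable fun w : (Fin m → S) × (Fin m → S) =>
      lpPow p τ fun t => h (J.piecewise w.1 w.2, t) :=
  measurable_lpPow (f := fun w : ((Fin m → S) × (Fin m → S)) × T =>
    h (J.piecewise w.1.1 w.1.2, w.2)) <|
    hh.comp_measurable (((measurable_piecewise J).comp measurable_fst).prodMk measurable_snd)

lemma measurable_lpPow_piecewise_right {h : (Fin m → S) × T → B} (hh : StronglyMeasurable h)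
    (J : Finset (Fin m)) (x : Fin m → S) :
    Measurable fun y => lpPow p τ fun t => h (J.piecewise x y, t) :=
  (measurable_lpPow_piecewise hh J).comp (measurable_prodMk_left (x := x))

lemma measurable_condMoment {h : (Fin m → S) × T → B} (hh : StronglyMeasurable h)
    (J : Finset (Fin m)) : Measurable (condMoment p P τ h J) :=
  (measurable_lpPow_piecewise hh J).lintegral_prod_right'

lemma condMoment_map_castSucc {h : (Fin (m + 1) → S) × T → B} (hh : StronglyMeasurable h)
    (J : Finset (Fin m)) (z : Fin (m + 1) → S) :
    condMoment p P τ h (J.map Fin.castSuccEmb) z = ∫⁻ y, ∫⁻ s,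
      lpPow p τ (fun t => h (snocArg (J.piecewise (initArg z) y) s, t)) ∂P ∂(iidLaw (Fin m) P) := by
  rw [condMoment, lintegral_snocArg (measurable_lpPow_piecewise_right hh _ z)]
  simp_rw [piecewise_map_castSucc]

lemma condMoment_fixLast {h : (Fin (m + 1) → S) × T → B} (hh : StronglyMeasurable h)
    (J : Finset (Fin m)) (x : Fin m → S) (s : S) :
    condMoment p P τ (fixLast h s) J x
      = condMoment p P τ h (insert (Fin.last m) (J.map Fin.castSuccEmb)) (snocArg x s) := by
  conv_rhs =>
    rw [condMoment, lintegral_snocArg (measurable_lpPow_piecewise_right hh _ (snocArg x s))]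
  simp_rw [piecewise_insert_last]
  simp [condMoment, fixLast]

lemma condMoment_addParam {h : (Fin (m + 1) → S) × T → B} (hh : StronglyMeasurable h)
    (J : Finset (Fin m)) (z : Fin (m + 1) → S) :
    condMoment p P (P.prod τ) (addParam h) J (initArg z)
      = condMoment p P τ h (J.map Fin.castSuccEmb) z := by
  rw [condMoment_map_castSucc hh, condMoment]
  refine lintegral_congr fun y => ?_
  have hmeas : StronglyMeasurable fun u : S × T => addParam h (J.piecewise (initArg z) y, u) :=
    (stronglyMeasurable_addParam hh).comp_measurable measurable_prodMk_left
  exact (lintegral_lpPow hmeas).symm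

lemma condMoment_forgetLast {f : (Fin m → S) × T → B} (hf : StronglyMeasurable f)
    (J : Finset (Fin (m + 1))) (z : Fin (m + 1) → S) :
    condMoment p P τ (forgetLast f) J z
      = condMoment p P τ f (Finset.univ.filter fun l => l.castSucc ∈ J) (initArg z) := by
  rw [condMoment, condMoment, ← (measurePreserving_initArg (P := P)).lintegral_comp
    (measurable_lpPow_piecewise_right hf _ (initArg z))]
  refine lintegral_congr fun y => ?_
  have hpiece : initArg (J.piecewise z y)
      = (Finset.univ.filter fun l => l.castSucc ∈ J).piecewise (initArg z) (initArg y) := by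
    ext l
    simp [initArg, Finset.piecewise]
  simp_rw [forgetLast, hpiece]

lemma momentTail_addParam_le {h : (Fin (m + 1) → S) × T → B} (hh : StronglyMeasurable h) :
    momentTail p q P (P.prod τ) (addParam h) s ≤ 2 ^ m * momentTail p q P τ h s :=
  sum_finset_le_of_forall_le fun J => by
    rw [← tailIntegral_comp measurePreserving_initArg
      (measurable_condMoment (stronglyMeasurable_addParam hh) J)]
    simp_rw [condMoment_addParam hh]
    exact tailIntegral_le_momentTail _ _

lemma measurable_condMoment_fixLast {h : (Fin (m + 1) → S) × T → B} (hh : StronglyMeasurable h)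
    (J : Finset (Fin m)) :
    Measurable fun w : (Fin m → S) × S => condMoment p P τ (fixLast h w.2) J w.1 := by
  simp_rw [condMoment_fixLast hh]
  exact (measurable_condMoment hh _).comp measurable_snocArg

lemma measurable_momentTail_fixLast {h : (Fin (m + 1) → S) × T → B} (hh : StronglyMeasurable h) :
    Measurable fun y => momentTail p q P τ (fixLast h y) s :=
  Finset.measurable_fun_sum _ fun J _ =>
    measurable_tailIntegral_right (measurable_condMoment_fixLast hh J)

lemma lintegral_momentTail_fixLast_le {h : (Fin (m + 1) → S) × T → B} (hh : StronglyMeasurable h) :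
    ∫⁻ y, momentTail p q P τ (fixLast h y) s ∂P ≤ 2 ^ m * momentTail p q P τ h s := by
  unfold momentTail
  rw [lintegral_finsetSum _ fun J _ =>
    measurable_tailIntegral_right (measurable_condMoment_fixLast hh J)]
  refine sum_finset_le_of_forall_le fun J => ?_
  calc ∫⁻ y, tailIntegral p q (iidLaw (Fin m) P) (condMoment p P τ (fixLast h y) J) s ∂P
      = tailIntegral p q ((iidLaw (Fin m) P).prod P) (fun w => condMoment p P τ h
          (insert (Fin.last m) (J.map Fin.castSuccEmb)) (snocArg w.1 w.2)) s := by
        simp_rw [← condMoment_fixLast hh]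
        exact (tailIntegral_prod (measurable_condMoment_fixLast hh J)).symm
    _ = tailIntegral p q (iidLaw (Fin (m + 1)) P)
          (condMoment p P τ h (insert (Fin.last m) (J.map Fin.castSuccEmb))) s :=
        tailIntegral_comp (measurePreserving_snocArg P m) (measurable_condMoment hh _)
    _ ≤ momentTail p q P τ h s := tailIntegral_le_momentTail _ _

variable [NormedSpace ℝ B]

lemma condMoment_meanLast_le (hp : 1 ≤ p) {h : (Fin (m + 1) → S) × T → B}
    (hh : StronglyMeasurable h) (J : Finset (Fin m)) (z : Fin (m + 1) → S) :
    condMoment p P τ (meanLast P h) J (initArg z)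
      ≤ condMoment p P τ h (J.map Fin.castSuccEmb) z := by
  rw [condMoment_map_castSucc hh, condMoment]
  refine lintegral_mono fun y => ?_
  set x := J.piecewise (initArg z) y
  have hmeas : StronglyMeasurable fun u : S × T => h (snocArg x u.1, u.2) :=
    (stronglyMeasurable_addParam hh).comp_measurable measurable_prodMk_left
  calc lpPow p τ (fun t => meanLast P h (x, t))
      ≤ ∫⁻ t, ∫⁻ s, ‖h (snocArg x s, t)‖ₑ ^ p ∂P ∂τ := lintegral_mono fun t =>
        enorm_integral_rpow_le hp
          (hmeas.comp_measurable measurable_prodMk_right).aestronglyMeasurable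
    _ = ∫⁻ s, lpPow p τ (fun t => h (snocArg x s, t)) ∂P :=
        (lintegral_lintegral_swap (hmeas.enorm.pow_const p).aemeasurable).symm

lemma condMoment_centreLast_le (hp : 1 ≤ p) (hp2 : p ≤ 2) {h : (Fin (m + 1) → S) × T → B}
    (hh : StronglyMeasurable h) (J : Finset (Fin (m + 1))) (z : Fin (m + 1) → S) :
    condMoment p P τ (centreLast P h) J z ≤ 2 * (condMoment p P τ h J z + condMoment p P τ h
      ((Finset.univ.filter fun l : Fin m => l.castSucc ∈ J).map Fin.castSuccEmb) z) := by
  calc condMoment p P τ (centreLast P h) J z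
      ≤ 2 * (condMoment p P τ h J z + condMoment p P τ (forgetLast (meanLast P h)) J z) := by
        unfold condMoment
        rw [← lintegral_add_left (measurable_lpPow_piecewise_right hh J z),
          ← lintegral_const_mul' _ _ ENNReal.ofNat_ne_top]
        exact lintegral_mono fun y => lpPow_le_of_enorm_le hp hp2
          (hh.comp_measurable measurable_prodMk_left).aestronglyMeasurable fun t => enorm_sub_le
    _ ≤ 2 * (condMoment p P τ h J z + condMoment p P τ h
          ((Finset.univ.filter fun l : Fin m => l.castSucc ∈ J).map Fin.castSuccEmb) z) := by
        gcongr
        rw [condMoment_forgetLast (stronglyMeasurable_meanLast hh)]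
        exact condMoment_meanLast_le hp hh _ z

lemma momentTail_meanLast_le (hp : 1 ≤ p) {h : (Fin (m + 1) → S) × T → B}
    (hh : StronglyMeasurable h) :
    momentTail p q P τ (meanLast P h) s ≤ 2 ^ m * momentTail p q P τ h s :=
  sum_finset_le_of_forall_le fun J => by
    rw [← tailIntegral_comp measurePreserving_initArg
      (measurable_condMoment (stronglyMeasurable_meanLast hh) J)]
    exact (tailIntegral_mono fun z => condMoment_meanLast_le hp hh J z).trans
      (tailIntegral_le_momentTail _ _)

lemma momentTail_centreLast_le (hp : 1 ≤ p) (hp2 : p ≤ 2) {h : (Fin (m + 1) → S) × T → B}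
    (hh : StronglyMeasurable h) : momentTail p q P τ (centreLast P h) s
      ≤ 2 ^ (m + 1) * (ENNReal.ofReal ((1 / 4 : ℝ) ^ (-(q / p))) * 2) * momentTail p q P τ h s := by
  have hp0 : 0 < p := by linarith
  have hhalf : ∀ J : Finset (Fin (m + 1)),
      tailIntegral p q (iidLaw (Fin (m + 1)) P) (fun z => 2 * condMoment p P τ h J z) (s / 2)
        ≤ ENNReal.ofReal ((1 / 4 : ℝ) ^ (-(q / p))) * momentTail p q P τ h s := by
    intro J
    rw [show s / 2 = 2 * (1 / 4 * s) by ring, ← ENNReal.ofReal_ofNat 2,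
      tailIntegral_const_mul _ (by norm_num)]
    refine (tailIntegral_mul_le hp0 (by norm_num) (by norm_num) _).trans ?_
    gcongr
    exact tailIntegral_le_momentTail _ _
  rw [mul_assoc]
  refine sum_finset_le_of_forall_le fun J => ?_
  set J' := (Finset.univ.filter fun l : Fin m => l.castSucc ∈ J).map Fin.castSuccEmb
  calc tailIntegral p q (iidLaw (Fin (m + 1)) P) (condMoment p P τ (centreLast P h) J) s
      ≤ tailIntegral p q (iidLaw (Fin (m + 1)) P)
          (fun z => 2 * condMoment p P τ h J z + 2 * condMoment p P τ h J' z) s :=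
        tailIntegral_mono fun z => (condMoment_centreLast_le hp hp2 hh J z).trans
          (mul_add _ _ _).le
    _ ≤ tailIntegral p q (iidLaw (Fin (m + 1)) P) (fun z => 2 * condMoment p P τ h J z) (s / 2)
        + tailIntegral p q (iidLaw (Fin (m + 1)) P)
          (fun z => 2 * condMoment p P τ h J' z) (s / 2) := tailIntegral_add_le
    _ ≤ ENNReal.ofReal ((1 / 4 : ℝ) ^ (-(q / p))) * momentTail p q P τ h s
        + ENNReal.ofReal ((1 / 4 : ℝ) ^ (-(q / p))) * momentTail p q P τ h s :=
        add_le_add (hhalf J) (hhalf J')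
    _ = ENNReal.ofReal ((1 / 4 : ℝ) ^ (-(q / p))) * 2 * momentTail p q P τ h s := by ring

end Moments

end Kernels

section Degenerate

lemma integral_comp_of_measurePreserving {α β B : Type*} [NormedAddCommGroup B] [NormedSpace ℝ B]
    [MeasurableSpace α] [MeasurableSpace β] {μ : Measure α} {ν : Measure β} {f : α → β} {g : β → B}
    (hf : MeasurePreserving f μ ν) (hg : AEStronglyMeasurable g ν) :
    ∫ x, g (f x) ∂μ = ∫ y, g y ∂ν := by
  rw [← hf.map_eq] at hg ⊢
  exact (integral_map hf.aemeasurable hg).symm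

lemma measurePreserving_prod_right_comm {α β γ δ : Type*} [MeasurableSpace α] [MeasurableSpace β]
    [MeasurableSpace γ] [MeasurableSpace δ] {μ : Measure α} {ν : Measure β} {ρ : Measure γ}
    {τ : Measure δ} [SFinite μ] [SFinite ν] [SFinite ρ] [SFinite τ] {g : α × β → γ}
    (hg : MeasurePreserving g (μ.prod ν) ρ) :
    MeasurePreserving (fun w : (α × δ) × β => (g (w.1.1, w.2), w.1.2))
      ((μ.prod τ).prod ν) (ρ.prod τ) :=
  (hg.prod (MeasurePreserving.id τ)).comp <| (measurePreserving_prodAssoc μ ν τ).symm.comp <|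
    ((MeasurePreserving.id μ).prod (Measure.measurePreserving_swap (μ := τ) (ν := ν))).comp <|
      measurePreserving_prodAssoc μ τ ν

variable {B S T : Type*} [NormedAddCommGroup B] {m d : ℕ} [MeasurableSpace S]

section Algebra

variable [NormedSpace ℝ B] {P : Measure S}

lemma centreLast_snocArg (h : (Fin (m + 1) → S) × T → B) (x : Fin m → S) (s : S) (t : T) :
    centreLast P h (snocArg x s, t) = h (snocArg x s, t) - meanLast P h (x, t) := by
  simp [centreLast, forgetLast]

/-- The increments of the `U`-statistic, centred given the past. -/
noncomputable def uIncrement (P : Measure S) (h : (Fin (m + 1) → S) × T → B) (k : ℕ)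
    (z : (ℕ → S) × T) : B := uSum (addParam (centreLast P h)) k (z.1, (z.1 k, z.2))

lemma uSum_addParam_eq_uIncrement_add (h : (Fin (m + 1) → S) × T → B) (k : ℕ)
    (z : (ℕ → S) × T) : uSum (addParam h) k (z.1, (z.1 k, z.2))
      = uIncrement P h k z + uSum (meanLast P h) k z := by
  unfold uIncrement uSum
  rw [← Finset.sum_add_distrib]
  refine Finset.sum_congr rfl fun i _ => ?_
  simp [addParam, centreLast_snocArg]

lemma uIncrement_update (h : (Fin (m + 1) → S) × T → B) (k : ℕ) (x : ℕ → S) (y : S) (t : T) :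
    uIncrement P h k (Function.update x k y, t)
      = uSum (addParam (centreLast P h)) k (x, (y, t)) := by
  simp [uIncrement, uSum_update le_rfl]

end Algebra

variable [MeasurableSpace T]

lemma stronglyMeasurable_uIncrement [NormedSpace ℝ B] {P : Measure S} [SFinite P]
    {h : (Fin (m + 1) → S) × T → B} (hh : StronglyMeasurable h) (k : ℕ) :
    StronglyMeasurable (uIncrement P h k) :=
  (stronglyMeasurable_uSum (stronglyMeasurable_addParam (stronglyMeasurable_centreLast hh))
    k).comp_measurable (by fun_prop)

/-- The conditional expectations of the kernel given fewer than `d` arguments vanish. -/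
def IsDegenerateKernel [NormedSpace ℝ B] (P : Measure S) (τ : Measure T)
    (h : (Fin m → S) × T → B) (d : ℕ) : Prop :=
  ∀ I : Finset (Fin m), I.card < d → ∀ᵐ z ∂((iidLaw (Fin m) P).prod τ),
    ∫ y, h (I.piecewise z.1 y, z.2) ∂(iidLaw (Fin m) P) = 0

lemma IsDegenerateKernel.zero [NormedSpace ℝ B] {P : Measure S} {τ : Measure T}
    (h : (Fin m → S) × T → B) : IsDegenerateKernel P τ h 0 :=
  fun _ hI => absurd hI (Nat.not_lt_zero _)

variable {P : Measure S} [IsProbabilityMeasure P] {τ : Measure T} [SFinite τ]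

lemma measurePreserving_snocArg_prod_comm :
    MeasurePreserving (fun w : ((Fin m → S) × T) × S => (snocArg w.1.1 w.2, w.1.2))
      (((iidLaw (Fin m) P).prod τ).prod P) ((iidLaw (Fin (m + 1)) P).prod τ) :=
  measurePreserving_prod_right_comm (measurePreserving_snocArg P m)

lemma ae_integrable_piecewise {h : (Fin m → S) × T → B}
    (hi : Integrable h ((iidLaw (Fin m) P).prod τ)) (J : Finset (Fin m)) :
    ∀ᵐ z ∂((iidLaw (Fin m) P).prod τ),
      Integrable (fun y => h (J.piecewise z.1 y, z.2)) (iidLaw (Fin m) P) := by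
  have hmp := measurePreserving_prod_right_comm (τ := τ) (measurePreserving_piecewise P J)
  exact ((hmp.integrable_comp hi.1).2 hi).prod_right_ae

lemma ae_integrable_snocArg {h : (Fin (m + 1) → S) × T → B}
    (hi : Integrable h ((iidLaw (Fin (m + 1)) P).prod τ)) :
    ∀ᵐ z ∂((iidLaw (Fin m) P).prod τ), Integrable (fun s => h (snocArg z.1 s, z.2)) P :=
  ((measurePreserving_snocArg_prod_comm.integrable_comp hi.1).2 hi).prod_right_ae

lemma integrable_addParam {h : (Fin (m + 1) → S) × T → B}
    (hi : Integrable h ((iidLaw (Fin (m + 1)) P).prod τ)) :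
    Integrable (addParam h) ((iidLaw (Fin m) P).prod (P.prod τ)) :=
  (measurePreserving_snocArg_prod.integrable_comp hi.1).2 hi

lemma ae_integrable_fixLast {h : (Fin (m + 1) → S) × T → B}
    (hi : Integrable h ((iidLaw (Fin (m + 1)) P).prod τ)) :
    ∀ᵐ s ∂P, Integrable (fixLast h s) ((iidLaw (Fin m) P).prod τ) := by
  have hmp := measurePreserving_prod_left_comm (iidLaw (Fin m) P) P τ
  exact ((hmp.integrable_comp (integrable_addParam hi).1).2 (integrable_addParam hi)).prod_right_ae

variable [NormedSpace ℝ B]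

lemma integrable_meanLast {h : (Fin (m + 1) → S) × T → B}
    (hi : Integrable h ((iidLaw (Fin (m + 1)) P).prod τ)) :
    Integrable (meanLast P h) ((iidLaw (Fin m) P).prod τ) :=
  ((measurePreserving_snocArg_prod_comm.integrable_comp hi.1).2 hi).integral_prod_left

lemma integrable_centreLast {h : (Fin (m + 1) → S) × T → B}
    (hi : Integrable h ((iidLaw (Fin (m + 1)) P).prod τ)) :
    Integrable (centreLast P h) ((iidLaw (Fin (m + 1)) P).prod τ) :=
  hi.sub <| ((measurePreserving_initArg.prod (MeasurePreserving.id τ)).integrable_comp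
    (integrable_meanLast hi).1).2 (integrable_meanLast hi)

lemma integral_centreLast_snocArg [CompleteSpace B] {h : (Fin (m + 1) → S) × T → B}
    (hi : Integrable h ((iidLaw (Fin (m + 1)) P).prod τ)) :
    ∀ᵐ z ∂((iidLaw (Fin m) P).prod τ), ∫ s, centreLast P h (snocArg z.1 s, z.2) ∂P = 0 := by
  filter_upwards [ae_integrable_snocArg hi] with z hz
  simp_rw [centreLast_snocArg]
  rw [integral_sub hz (integrable_const _)]
  simp [meanLast]

lemma integral_snocArg {F : (Fin (m + 1) → S) → B} (hF : Integrable F (iidLaw (Fin (m + 1)) P)) :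
    ∫ z, F z ∂(iidLaw (Fin (m + 1)) P)
      = ∫ y, ∫ s, F (snocArg y s) ∂P ∂(iidLaw (Fin m) P) := by
  have hmp := measurePreserving_snocArg P m
  rw [← integral_comp_of_measurePreserving hmp hF.1]
  exact integral_prod (fun z : (Fin m → S) × S => F (snocArg z.1 z.2))
    ((hmp.integrable_comp hF.1).2 hF)

lemma IsDegenerateKernel.meanLast {h : (Fin (m + 1) → S) × T → B}
    (hi : Integrable h ((iidLaw (Fin (m + 1)) P).prod τ)) (hd : IsDegenerateKernel P τ h d) :
    IsDegenerateKernel P τ (meanLast P h) d := by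
  intro I hI
  have hJ := measurePreserving_snocArg_prod_comm.quasiMeasurePreserving.ae
    ((hd (I.map Fin.castSuccEmb) (by simpa using hI)).and
      (ae_integrable_piecewise hi (I.map Fin.castSuccEmb)))
  filter_upwards [Measure.ae_ae_of_ae_prod hJ] with z hz
  obtain ⟨s, hs0, hsi⟩ := hz.exists
  rw [integral_snocArg hsi] at hs0
  simp_rw [piecewise_map_castSucc, initArg_snocArg] at hs0
  exact hs0

lemma IsDegenerateKernel.addParam_centreLast {h : (Fin (m + 1) → S) × T → B}
    (hh : StronglyMeasurable h) (hi : Integrable h ((iidLaw (Fin (m + 1)) P).prod τ))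
    (hd : IsDegenerateKernel P τ h (d + 1)) :
    IsDegenerateKernel P (P.prod τ) (addParam (centreLast P h)) d := by
  intro I hI
  set J := insert (Fin.last m) (I.map Fin.castSuccEmb) with hJ
  have hcard : J.card < d + 1 := (Finset.card_insert_le _ _).trans_lt (by simpa using hI)
  have hkernel := measurePreserving_snocArg_prod.quasiMeasurePreserving.ae
    ((hd J hcard).and (ae_integrable_piecewise hi J))
  have hmean := ((MeasurePreserving.id (iidLaw (Fin m) P)).prod
    (measurePreserving_snd (μ := P) (ν := τ))).quasiMeasurePreserving.ae
    ((hd.meanLast hi I (hI.trans d.lt_succ_self)).and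
      (ae_integrable_piecewise (integrable_meanLast hi) I))
  filter_upwards [hkernel, hmean] with w hw hw'
  set f : (Fin m → S) → B := fun y => h (snocArg (I.piecewise w.1 y) w.2.1, w.2.2)
  have hf_init : ∀ y, h (J.piecewise (snocArg w.1 w.2.1) y, w.2.2) = f (initArg y) := fun y => by
    conv_lhs => rw [← snocArg_initArg y]
    rw [hJ, piecewise_insert_last, initArg_snocArg, snocArg_last]
  simp_rw [hf_init] at hw
  simp only [Prod.map_fst, Prod.map_snd, id] at hw'
  have hmp := measurePreserving_initArg (P := P) (m := m)
  have hf : StronglyMeasurable f := (stronglyMeasurable_addParam hh).comp_measurable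
    (((measurable_piecewise I).comp (measurable_prodMk_left (x := w.1))).prodMk
      (measurable_const (a := w.2)))
  have hfi : Integrable f (iidLaw (Fin m) P) :=
    (hmp.integrable_comp hf.aestronglyMeasurable).1 hw.2
  have hf0 : ∫ y, f y ∂(iidLaw (Fin m) P) = 0 :=
    (integral_comp_of_measurePreserving hmp hf.aestronglyMeasurable).symm.trans hw.1
  simp only [addParam, centreLast_snocArg]
  rw [integral_sub hfi hw'.2, hf0, hw'.1, sub_zero]

lemma IsDegenerateKernel.ae_fixLast {h : (Fin (m + 1) → S) × T → B}
    (hd : IsDegenerateKernel P (P.prod τ) (addParam h) d) :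
    ∀ᵐ s ∂P, IsDegenerateKernel P τ (fixLast h s) d := by
  refine ae_all_iff.2 fun I => Filter.eventually_imp_distrib_left.2 fun hI => ?_
  exact Measure.ae_ae_of_ae_prod <|
    (measurePreserving_prod_left_comm (iidLaw (Fin m) P) P τ).quasiMeasurePreserving.ae (hd I hI)

lemma ae_integrable_centreLast_incTuple {h : (Fin (m + 1) → S) × T → B}
    (hi : Integrable h ((iidLaw (Fin (m + 1)) P).prod τ)) (k : ℕ) :
    ∀ᵐ z ∂((iidLaw ℕ P).prod τ), ∀ i ∈ incTuples m k,
      Integrable (fun s => centreLast P h (snocArg (fun l => z.1 (i l)) s, z.2)) P :=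
  (Filter.eventually_all_finset _).2 fun _ hik =>
    (measurePreserving_incTuple hik).quasiMeasurePreserving.ae
      (ae_integrable_snocArg (integrable_centreLast hi))

lemma isMartingaleDiff_uIncrement [CompleteSpace B] {h : (Fin (m + 1) → S) × T → B}
    (hh : StronglyMeasurable h) (hi : Integrable h ((iidLaw (Fin (m + 1)) P).prod τ)) :
    IsMartingaleDiff P τ (uIncrement P h) where
  stronglyMeasurable := stronglyMeasurable_uIncrement hh
  adapted k l hkl x y t := by
    simp only [uIncrement, uSum_update hkl.le, Function.update_of_ne hkl.ne]
  integrable k := by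
    filter_upwards [ae_integrable_centreLast_incTuple hi k] with z hz
    simp_rw [uIncrement_update]
    exact integrable_finsetSum _ hz
  integral_eq_zero k := by
    have hzero : ∀ᵐ z ∂((iidLaw ℕ P).prod τ), ∀ i ∈ incTuples m k,
        ∫ s, centreLast P h (snocArg (fun l => z.1 (i l)) s, z.2) ∂P = 0 :=
      (Filter.eventually_all_finset _).2 fun _ hik =>
        (measurePreserving_incTuple hik).quasiMeasurePreserving.ae (integral_centreLast_snocArg hi)
    filter_upwards [ae_integrable_centreLast_incTuple hi k, hzero] with z hz hz0
    simp_rw [uIncrement_update]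
    unfold uSum addParam
    rw [integral_finsetSum _ hz]
    exact Finset.sum_eq_zero hz0

end Degenerate

section TailBound

/-- The power of the sample size in the threshold of the `j`-th term of `uTailBound`, for the
`p`-th power of the norm. -/
noncomputable def tailExponent (p : ℝ) (d j : ℕ) : ℝ := ((max d j : ℕ) - (d : ℝ)) * (p - 1) + j

/-- The power of the sample size in the growth of the `p`-th power of the norm of a `U`-statistic of
order `m` whose kernel is degenerate of order `d`. -/
noncomputable def growthExponent (p : ℝ) (m d : ℕ) : ℝ := p * (m - d) + d

lemma tailExponent_antitone {p : ℝ} (hp : 1 ≤ p) (j : ℕ) :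
    Antitone fun d => tailExponent p d j := by
  intro d' d hd
  have hmax : ((max d j : ℕ) : ℝ) - d ≤ (max d' j : ℕ) - d' := by
    rw [sub_le_sub_iff]
    exact_mod_cast (by omega : max d j + d' ≤ max d' j + d)
  have hmul := mul_le_mul_of_nonneg_right hmax (sub_nonneg.2 hp)
  simp only [tailExponent]
  linarith

lemma growthExponent_succ (p : ℝ) (m d : ℕ) :
    growthExponent p (m + 1) d = p + growthExponent p m d := by
  simp only [growthExponent]
  push_cast
  ring

lemma exists_exponent_shift {p : ℝ} (hp : 1 ≤ p) (m d : ℕ) :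
    ∃ κ : ℝ, 1 ≤ κ ∧ growthExponent p (m + 1) d = κ + growthExponent p m (d - 1) ∧
      ∀ j, tailExponent p d (j + 1) = κ + tailExponent p (d - 1) j := by
  rcases d with _ | d
  · refine ⟨p, hp, growthExponent_succ p m 0, fun j => ?_⟩
    simp only [tailExponent, Nat.zero_max, zero_tsub]
    push_cast
    ring
  · refine ⟨1, le_rfl, ?_, fun j => ?_⟩
    · simp only [growthExponent, Nat.add_sub_cancel]
      push_cast
      ring
    · simp only [tailExponent, Nat.add_max_add_right, Nat.add_sub_cancel]
      push_cast
      ring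

variable {B S T : Type*} [NormedAddCommGroup B] {m d N : ℕ} [MeasurableSpace T] {τ : Measure T}
  {p q t : ℝ}

/-- The `p`-th power of the norm of the `U`-statistic of the first `n` terms in `L^p(τ; B)`. -/
noncomputable def uPow (p : ℝ) (τ : Measure T) (h : (Fin m → S) × T → B) (n : ℕ) (x : ℕ → S) :
    ℝ≥0∞ := lpPow p τ fun t => uSum h n (x, t)

/-- The maximum of `uPow p τ h n` over the sample sizes `n ≤ N`. -/
noncomputable def maxUPow (p : ℝ) (τ : Measure T) (h : (Fin m → S) × T → B) (N : ℕ) (x : ℕ → S) :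
    ℝ≥0∞ := (Finset.range (N + 1)).sup fun n => uPow p τ h n x

lemma uPow_le_maxUPow {n : ℕ} (hn : n ≤ N) (h : (Fin m → S) × T → B) (x : ℕ → S) :
    uPow p τ h n x ≤ maxUPow p τ h N x :=
  Finset.le_sup (f := fun n => uPow p τ h n x) (Finset.mem_range.2 (by omega))

lemma maxUPow_zero_left (h : (Fin 0 → S) × T → B) (N : ℕ) :
    maxUPow p τ h N = fun _ => lpPow p τ fun t => h (Fin.elim0, t) := by
  ext x
  simp only [maxUPow, uPow, uSum_zero_left]
  exact Finset.sup_const ⟨0, by simp⟩ _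

variable [MeasurableSpace S] {P : Measure S}

/-- The bound for the tail of the maximal `U`-statistic over sample sizes up to `N`. -/
noncomputable def uTailBound (p q : ℝ) (P : Measure S) (τ : Measure T)
    (h : (Fin m → S) × T → B) (d N : ℕ) (t : ℝ) : ℝ≥0∞ :=
  ∑ j ∈ Finset.range (m + 1), (N : ℝ≥0∞) ^ j * momentTail p q P τ h (t * N ^ tailExponent p d j)

lemma uTailBound_le_of_momentTail_le {S' T' B' : Type*} [NormedAddCommGroup B']
    [MeasurableSpace S'] [MeasurableSpace T'] {m' : ℕ} {P' : Measure S'} {τ' : Measure T'}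
    {h' : (Fin m' → S') × T' → B'} {h : (Fin m → S) × T → B} {c : ℝ≥0∞} (hm : m' ≤ m)
    (hle : ∀ s, momentTail p q P' τ' h' s ≤ c * momentTail p q P τ h s) :
    uTailBound p q P' τ' h' d N t ≤ c * uTailBound p q P τ h d N t := by
  rw [uTailBound, uTailBound, Finset.mul_sum]
  calc ∑ j ∈ Finset.range (m' + 1),
        (N : ℝ≥0∞) ^ j * momentTail p q P' τ' h' (t * N ^ tailExponent p d j)
      ≤ ∑ j ∈ Finset.range (m' + 1),
        c * ((N : ℝ≥0∞) ^ j * momentTail p q P τ h (t * N ^ tailExponent p d j)) := by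
        refine Finset.sum_le_sum fun j _ => ?_
        rw [mul_left_comm]
        gcongr
        exact hle _
    _ ≤ _ := Finset.sum_le_sum_of_subset (Finset.range_subset_range.2 (by omega))

lemma uTailBound_monotone (hp : 1 ≤ p) (hN : 1 ≤ N) (ht : 0 ≤ t) (h : (Fin m → S) × T → B) :
    Monotone fun d => uTailBound p q P τ h d N t := by
  intro d' d hd
  have hN1 : (1 : ℝ) ≤ N := by exact_mod_cast hN
  refine Finset.sum_le_sum fun j _ => ?_
  gcongr
  refine momentTail_antitone h ?_
  gcongr
  exact tailExponent_antitone hp j hd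

section FixLast

variable [IsProbabilityMeasure P] [SFinite τ]

lemma measurable_uTailBound_fixLast {h : (Fin (m + 1) → S) × T → B} (hh : StronglyMeasurable h) :
    Measurable fun y => uTailBound p q P τ (fixLast h y) d N t :=
  Finset.measurable_fun_sum _ fun _ _ => (measurable_momentTail_fixLast hh).const_mul _

lemma mul_lintegral_uTailBound_fixLast_le {h : (Fin (m + 1) → S) × T → B}
    (hh : StronglyMeasurable h) (hN : 1 ≤ N) {d' : ℕ} {κ : ℝ}
    (hκ : ∀ j, tailExponent p d (j + 1) = κ + tailExponent p d' j) :
    N * ∫⁻ y, uTailBound p q P τ (fixLast h y) d' N (t * N ^ κ) ∂P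
      ≤ 2 ^ m * uTailBound p q P τ h d N t := by
  have hN0 : (0 : ℝ) < N := by exact_mod_cast hN
  calc N * ∫⁻ y, uTailBound p q P τ (fixLast h y) d' N (t * N ^ κ) ∂P
      = ∑ j ∈ Finset.range (m + 1), (N : ℝ≥0∞) ^ (j + 1) *
          ∫⁻ y, momentTail p q P τ (fixLast h y) (t * N ^ tailExponent p d (j + 1)) ∂P := by
        unfold uTailBound
        rw [lintegral_finsetSum _ fun _ _ => (measurable_momentTail_fixLast hh).const_mul _,
          Finset.mul_sum]
        refine Finset.sum_congr rfl fun j _ => ?_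
        rw [lintegral_const_mul _ (measurable_momentTail_fixLast hh), ← mul_assoc, ← pow_succ',
          mul_assoc t, ← Real.rpow_add hN0, ← hκ]
    _ ≤ ∑ j ∈ Finset.range (m + 1), (N : ℝ≥0∞) ^ (j + 1) *
          (2 ^ m * momentTail p q P τ h (t * N ^ tailExponent p d (j + 1))) := by
        gcongr
        exact lintegral_momentTail_fixLast_le hh
    _ = 2 ^ m * ∑ j ∈ Finset.range (m + 1),
          (N : ℝ≥0∞) ^ (j + 1) * momentTail p q P τ h (t * N ^ tailExponent p d (j + 1)) := by
        rw [Finset.mul_sum]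
        exact Finset.sum_congr rfl fun j _ => mul_left_comm _ _ _
    _ ≤ 2 ^ m * uTailBound p q P τ h d N t := by
        gcongr
        rw [uTailBound, Finset.sum_range_succ' _ (m + 1)]
        exact le_self_add

end FixLast

/-- The tail bound with constant `K` for all `B`-valued `U`-statistics of order `m`. -/
def HasUTailBound.{u, v} (p q : ℝ) (B : Type v) [NormedAddCommGroup B] [NormedSpace ℝ B] (m : ℕ)
    (K : ℝ≥0∞) : Prop :=
  ∀ (S T : Type u) [MeasurableSpace S] [MeasurableSpace T] (P : Measure S) [IsProbabilityMeasure P]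
    (τ : Measure T) [IsProbabilityMeasure τ] (h : (Fin m → S) × T → B), StronglyMeasurable h →
    Integrable h ((iidLaw (Fin m) P).prod τ) → ∀ d : ℕ, IsDegenerateKernel P τ h d →
    ∀ N : ℕ, 1 ≤ N → ∀ t : ℝ, 0 < t →
    tailIntegral p q (iidLaw ℕ P) (maxUPow p τ h N) (t * N ^ growthExponent p m d)
      ≤ K * uTailBound p q P τ h d N t

lemma condMoment_zero_left [IsProbabilityMeasure P] (h : (Fin 0 → S) × T → B) (x : Fin 0 → S) :
    condMoment p P τ h ∅ x = lpPow p τ fun t => h (Fin.elim0, t) := by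
  simp [condMoment, Subsingleton.elim _ (Fin.elim0 : Fin 0 → S)]

lemma IsDegenerateKernel.lpPow_eq_zero [NormedSpace ℝ B] [CompleteSpace B] [IsProbabilityMeasure P]
    [SFinite τ] (hp : 0 < p) {h : (Fin 0 → S) × T → B} (hd : IsDegenerateKernel P τ h d)
    (hd0 : 0 < d) : lpPow p τ (fun t => h (Fin.elim0, t)) = 0 := by
  have hzero := Measure.ae_ae_of_ae_prod (hd ∅ (by simpa using hd0))
  obtain ⟨x, hx⟩ := hzero.exists
  refine lintegral_eq_zero_of_ae_eq_zero ?_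
  filter_upwards [hx] with t ht
  rw [Subsingleton.elim x Fin.elim0] at ht
  simp_rw [Subsingleton.elim (Finset.piecewise _ _ _) (Fin.elim0 : Fin 0 → S)] at ht
  simpa [hp] using ht

lemma hasUTailBound_zero.{u, v} {B : Type v} [NormedAddCommGroup B] [NormedSpace ℝ B]
    [CompleteSpace B] (hp : 0 < p) : HasUTailBound.{u, v} p q B 0 1 := by
  intro S T _ _ P _ τ _ h hh _ d hd N _ t _
  rw [maxUPow_zero_left]
  rcases Nat.eq_zero_or_pos d with rfl | hd0
  · calc tailIntegral p q (iidLaw ℕ P) (fun _ => lpPow p τ fun t => h (Fin.elim0, t))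
          (t * N ^ growthExponent p 0 0)
        = tailIntegral p q (iidLaw (Fin 0) P) (condMoment p P τ h ∅)
          (t * N ^ tailExponent p 0 0) := by
          rw [← tailIntegral_comp (measurePreserving_comp_injective P Fin.val_injective)
            (measurable_condMoment hh ∅)]
          simp [condMoment_zero_left, growthExponent, tailExponent]
      _ ≤ momentTail p q P τ h (t * N ^ tailExponent p 0 0) := tailIntegral_le_momentTail h ∅
      _ = 1 * uTailBound p q P τ h 0 N t := by simp [uTailBound]
  · rw [hd.lpPow_eq_zero hp hd0, tailIntegral_zero]
    exact zero_le

end TailBound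

section InductionStep

section Decomposition

variable {B S T : Type*} [NormedAddCommGroup B] {m N : ℕ} {p q : ℝ} [MeasurableSpace T]
  {τ : Measure T}

lemma lpPow_sum_range_le (hp : 1 ≤ p) {f : ℕ → T → B} (hf : ∀ k, AEStronglyMeasurable (f k) τ)
    {n : ℕ} {M : ℝ≥0∞} (hM : ∀ k < n, lpPow p τ (f k) ≤ M) :
    lpPow p τ (fun t => ∑ k ∈ Finset.range n, f k t) ≤ (n : ℝ≥0∞) ^ p * M := by
  have hp0 : 0 < p := by linarith
  calc lpPow p τ (fun t => ∑ k ∈ Finset.range n, f k t)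
      ≤ ∫⁻ t, (n : ℝ≥0∞) ^ (p - 1) * ∑ k ∈ Finset.range n, ‖f k t‖ₑ ^ p ∂τ := by
        refine lintegral_mono fun t => ?_
        refine (ENNReal.rpow_le_rpow (enorm_sum_le _ _) hp0.le).trans ?_
        simpa only [Finset.card_range] using
          ENNReal.rpow_sum_le_const_mul_sum_rpow (Finset.range n) (fun k => ‖f k t‖ₑ) hp
    _ = (n : ℝ≥0∞) ^ (p - 1) * ∑ k ∈ Finset.range n, lpPow p τ (f k) := by
        rw [lintegral_const_mul' _ _ (by finiteness),
          lintegral_finsetSum' _ fun k _ => (hf k).enorm.pow_const p]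
        rfl
    _ ≤ (n : ℝ≥0∞) ^ (p - 1) * ((n : ℝ≥0∞) * M) := by
        gcongr
        simpa using Finset.sum_le_card_nsmul _ _ M fun k hk => hM k (Finset.mem_range.1 hk)
    _ = (n : ℝ≥0∞) ^ p * M := by
        conv_lhs => rw [← mul_assoc, ← ENNReal.rpow_one (n : ℝ≥0∞), ← ENNReal.rpow_mul, one_mul]
        rw [← ENNReal.rpow_add_of_nonneg _ _ (by linarith) zero_le_one, sub_add_cancel]

variable [MeasurableSpace S] {P : Measure S} [NormedSpace ℝ B]

lemma incPow_uIncrement_update (h : (Fin (m + 1) → S) × T → B) (k : ℕ) (x : ℕ → S) (y : S) :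
    incPow p τ (uIncrement P h) k (Function.update x k y)
      = uPow p τ (fixLast (centreLast P h) y) k x := by
  simp only [incPow, uIncrement_update]
  rfl

variable [SFinite P] {h : (Fin (m + 1) → S) × T → B}

lemma condIncPow_uIncrement [SFinite τ] (hh : StronglyMeasurable h) (k : ℕ) (x : ℕ → S) :
    condIncPow p P τ (uIncrement P h) k x
      = uPow p (P.prod τ) (addParam (centreLast P h)) k x := by
  have hsum := stronglyMeasurable_uSum (stronglyMeasurable_addParam
    (stronglyMeasurable_centreLast (P := P) hh)) k
  simp only [condIncPow, incPow, uIncrement_update]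
  exact lintegral_lpPow (f := fun u : S × T => uSum (addParam (centreLast P h)) k (x, u))
    (hsum.comp_measurable measurable_prodMk_left)

lemma maxUPow_le (hp : 1 ≤ p) (hp2 : p ≤ 2) (hh : StronglyMeasurable h) (x : ℕ → S) :
    maxUPow p τ h N x
      ≤ 2 * (Finset.range (N + 1)).sup (fun n => sumPow p τ (uIncrement P h) n x)
        + 2 * (N : ℝ≥0∞) ^ p * maxUPow p τ (meanLast P h) N x := by
  have hmean := stronglyMeasurable_uSum (stronglyMeasurable_meanLast (P := P) hh)
  refine Finset.sup_le fun n hn => ?_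
  have hnN : n ≤ N := Nat.lt_succ_iff.1 (Finset.mem_range.1 hn)
  calc uPow p τ h n x
      ≤ 2 * (sumPow p τ (uIncrement P h) n x
        + lpPow p τ fun t => ∑ k ∈ Finset.range n, uSum (meanLast P h) k (x, t)) := by
        refine lpPow_le_of_enorm_le hp hp2 (Finset.stronglyMeasurable_fun_sum _ fun k _ =>
          (stronglyMeasurable_uIncrement hh k).comp_measurable
            measurable_prodMk_left).aestronglyMeasurable fun t => ?_
        rw [uSum_eq_sum_range]
        simp_rw [uSum_addParam_eq_uIncrement_add (P := P) h _ (x, t)]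
        rw [Finset.sum_add_distrib]
        exact enorm_add_le _ _
    _ ≤ 2 * ((Finset.range (N + 1)).sup (fun n => sumPow p τ (uIncrement P h) n x)
        + (N : ℝ≥0∞) ^ p * maxUPow p τ (meanLast P h) N x) := by
        gcongr
        · exact Finset.le_sup (f := fun n => sumPow p τ (uIncrement P h) n x) hn
        · calc lpPow p τ (fun t => ∑ k ∈ Finset.range n, uSum (meanLast P h) k (x, t))
              ≤ (n : ℝ≥0∞) ^ p * maxUPow p τ (meanLast P h) N x := lpPow_sum_range_le hp
                (fun k => ((hmean k).comp_measurable measurable_prodMk_left).aestronglyMeasurable)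
                fun k hk => uPow_le_maxUPow (hk.le.trans hnN) _ x
            _ ≤ (N : ℝ≥0∞) ^ p * maxUPow p τ (meanLast P h) N x := by gcongr
    _ = _ := by rw [mul_add, mul_assoc]

lemma tailIntegral_maxUPow_le (hp : 1 ≤ p) (hp2 : p ≤ 2) (hh : StronglyMeasurable h) (hN : 1 ≤ N)
    (s : ℝ) :
    tailIntegral p q (iidLaw ℕ P) (maxUPow p τ h N) (N ^ p * s)
      ≤ ENNReal.ofReal ((1 / 4 : ℝ) ^ (-(q / p))) *
        (tailIntegral p q (iidLaw ℕ P)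
            (fun x => (Finset.range (N + 1)).sup fun n => sumPow p τ (uIncrement P h) n x)
            (N ^ p * s)
          + tailIntegral p q (iidLaw ℕ P) (maxUPow p τ (meanLast P h) N) s) := by
  have hp0 : 0 < p := by linarith
  have hN0 : (0 : ℝ) < N := by exact_mod_cast hN
  set X := fun x => (Finset.range (N + 1)).sup fun n => sumPow p τ (uIncrement P h) n x
  set Y := maxUPow p τ (meanLast P h) N
  calc tailIntegral p q (iidLaw ℕ P) (maxUPow p τ h N) (N ^ p * s)
      ≤ tailIntegral p q (iidLaw ℕ P) (fun x => ENNReal.ofReal 2 * X x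
          + ENNReal.ofReal (2 * (N : ℝ) ^ p) * Y x) (N ^ p * s) := by
        refine tailIntegral_mono fun x => (maxUPow_le (P := P) hp hp2 hh x).trans_eq ?_
        rw [ENNReal.ofReal_mul two_pos.le, ← ENNReal.ofReal_rpow_of_pos hN0,
          ENNReal.ofReal_natCast, ENNReal.ofReal_ofNat]
    _ ≤ tailIntegral p q (iidLaw ℕ P) (fun x => ENNReal.ofReal 2 * X x) (N ^ p * s / 2)
        + tailIntegral p q (iidLaw ℕ P) (fun x => ENNReal.ofReal (2 * (N : ℝ) ^ p) * Y x)
          (N ^ p * s / 2) := tailIntegral_add_le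
    _ = tailIntegral p q (iidLaw ℕ P) X (1 / 4 * (N ^ p * s))
        + tailIntegral p q (iidLaw ℕ P) Y (1 / 4 * s) := by
        rw [← tailIntegral_const_mul X (two_pos : (0 : ℝ) < 2),
          ← tailIntegral_const_mul Y (by positivity : 0 < 2 * (N : ℝ) ^ p)]
        ring_nf
    _ ≤ _ := by
        rw [mul_add]
        gcongr <;> exact tailIntegral_mul_le hp0 (by norm_num) (by norm_num) _

end Decomposition

lemma IsDegenerateKernel.addParam_centreLast_pred {B S T : Type*} [NormedAddCommGroup B]
    [NormedSpace ℝ B] [MeasurableSpace S] [MeasurableSpace T] {P : Measure S}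
    [IsProbabilityMeasure P] {τ : Measure T} [SFinite τ] {m d : ℕ} {h : (Fin (m + 1) → S) × T → B}
    (hd : IsDegenerateKernel P τ h d) (hh : StronglyMeasurable h)
    (hi : Integrable h ((iidLaw (Fin (m + 1)) P).prod τ)) :
    IsDegenerateKernel P (P.prod τ) (addParam (centreLast P h)) (d - 1) := by
  rcases d with _ | d
  · exact .zero _
  · exact hd.addParam_centreLast hh hi

universe u v

variable {B : Type v} [NormedAddCommGroup B] [NormedSpace ℝ B] {m d N : ℕ} {p q t : ℝ} {K : ℝ≥0∞}

section Terms

variable {S T : Type u} [MeasurableSpace S] [MeasurableSpace T] {P : Measure S}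
  [IsProbabilityMeasure P] {τ : Measure T} [IsProbabilityMeasure τ]
  {h : (Fin (m + 1) → S) × T → B}

lemma HasUTailBound.tailIntegral_meanLast_le (hK : HasUTailBound.{u, v} p q B m K) (hp : 1 ≤ p)
    (hh : StronglyMeasurable h) (hi : Integrable h ((iidLaw (Fin (m + 1)) P).prod τ))
    (hd : IsDegenerateKernel P τ h d) (hN : 1 ≤ N) (ht : 0 < t) :
    tailIntegral p q (iidLaw ℕ P) (maxUPow p τ (meanLast P h) N) (t * N ^ growthExponent p m d)
      ≤ K * (2 ^ m * uTailBound p q P τ h d N t) := by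
  refine (hK S T P τ _ (stronglyMeasurable_meanLast hh) (integrable_meanLast hi) d
    (hd.meanLast hi) N hN t ht).trans ?_
  gcongr
  exact uTailBound_le_of_momentTail_le (Nat.le_succ m) fun s => momentTail_meanLast_le hp hh

lemma HasUTailBound.tailIntegral_sum_condIncPow_le (hK : HasUTailBound.{u, v} p q B m K)
    (hp : 1 ≤ p) (hh : StronglyMeasurable h)
    (hi : Integrable h ((iidLaw (Fin (m + 1)) P).prod τ)) (hd : IsDegenerateKernel P τ h d)
    (hN : 1 ≤ N) (ht : 0 < t) :
    tailIntegral p q (iidLaw ℕ P)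
        (fun x => ∑ k ∈ Finset.range N, condIncPow p P τ (uIncrement P h) k x)
        (t * N ^ growthExponent p (m + 1) d)
      ≤ K * (2 ^ m * uTailBound p q P τ (centreLast P h) d N t) := by
  have hN1 : (1 : ℝ) ≤ N := by exact_mod_cast hN
  have hN0 : (0 : ℝ) < N := by linarith
  obtain ⟨κ, hκ, hgrowth, -⟩ := exists_exponent_shift hp m d
  have hc := stronglyMeasurable_centreLast (P := P) hh
  set g := addParam (centreLast P h)
  calc tailIntegral p q (iidLaw ℕ P)
        (fun x => ∑ k ∈ Finset.range N, condIncPow p P τ (uIncrement P h) k x)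
        (t * N ^ growthExponent p (m + 1) d)
      ≤ tailIntegral p q (iidLaw ℕ P) (fun x => ENNReal.ofReal N * maxUPow p (P.prod τ) g N x)
          (t * N ^ growthExponent p (m + 1) d) := by
        refine tailIntegral_mono fun x => ?_
        have hterm : ∀ k ∈ Finset.range N, condIncPow p P τ (uIncrement P h) k x
            ≤ maxUPow p (P.prod τ) g N x := fun k hk => by
          rw [condIncPow_uIncrement hh]
          exact uPow_le_maxUPow (Finset.mem_range.1 hk).le g x
        simpa using Finset.sum_le_card_nsmul _ _ _ hterm
    _ ≤ tailIntegral p q (iidLaw ℕ P) (fun x => ENNReal.ofReal N * maxUPow p (P.prod τ) g N x)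
          (N * (t * N ^ growthExponent p m (d - 1))) := by
        refine tailIntegral_antitone _ ?_
        calc N * (t * (N : ℝ) ^ growthExponent p m (d - 1))
            = t * (N : ℝ) ^ (1 + growthExponent p m (d - 1)) := by
              rw [Real.rpow_add hN0, Real.rpow_one]; ring
          _ ≤ t * (N : ℝ) ^ growthExponent p (m + 1) d := by rw [hgrowth]; gcongr
    _ = tailIntegral p q (iidLaw ℕ P) (maxUPow p (P.prod τ) g N)
          (t * N ^ growthExponent p m (d - 1)) := tailIntegral_const_mul _ hN0
    _ ≤ K * uTailBound p q P (P.prod τ) g (d - 1) N t :=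
        hK S (S × T) P (P.prod τ) g (stronglyMeasurable_addParam hc)
          (integrable_addParam (integrable_centreLast hi)) (d - 1)
          (hd.addParam_centreLast_pred hh hi) N hN t ht
    _ ≤ K * uTailBound p q P (P.prod τ) g d N t := by
        gcongr
        exact uTailBound_monotone hp hN ht.le g (Nat.sub_le d 1)
    _ ≤ K * (2 ^ m * uTailBound p q P τ (centreLast P h) d N t) := by
        gcongr
        exact uTailBound_le_of_momentTail_le (Nat.le_succ m) fun s => momentTail_addParam_le hc

lemma tailIntegral_incPow_uIncrement (hh : StronglyMeasurable h) (k : ℕ) (s : ℝ) :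
    tailIntegral p q (iidLaw ℕ P) (incPow p τ (uIncrement P h) k) s
      = ∫⁻ y, tailIntegral p q (iidLaw ℕ P) (uPow p τ (fixLast (centreLast P h) y) k) s ∂P := by
  have hmeas : Measurable fun w : (ℕ → S) × S => uPow p τ (fixLast (centreLast P h) w.2) k w.1 :=
    measurable_lpPow (f := fun w : ((ℕ → S) × S) × T =>
      uSum (addParam (centreLast P h)) k (w.1.1, (w.1.2, w.2))) <|
      (stronglyMeasurable_uSum (stronglyMeasurable_addParam (stronglyMeasurable_centreLast hh))
        k).comp_measurable (by fun_prop)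
  have hinc : Measurable (incPow p τ (uIncrement P h) k) :=
    hmeas.comp (f := fun x : ℕ → S => (x, x k)) (by fun_prop)
  rw [← tailIntegral_comp (measurePreserving_update P k) hinc]
  simp_rw [incPow_uIncrement_update]
  exact tailIntegral_prod hmeas

lemma HasUTailBound.tailIntegral_sup_incPow_le (hK : HasUTailBound.{u, v} p q B m K)
    (hp : 1 ≤ p) (hh : StronglyMeasurable h)
    (hi : Integrable h ((iidLaw (Fin (m + 1)) P).prod τ)) (hd : IsDegenerateKernel P τ h d)
    (hN : 1 ≤ N) (ht : 0 < t) :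
    tailIntegral p q (iidLaw ℕ P)
        (fun x => (Finset.range N).sup fun k => incPow p τ (uIncrement P h) k x)
        (t * N ^ growthExponent p (m + 1) d)
      ≤ K * (2 ^ m * uTailBound p q P τ (centreLast P h) d N t) := by
  have hN0 : (0 : ℝ) < N := by exact_mod_cast hN
  obtain ⟨κ, -, hgrowth, htail⟩ := exists_exponent_shift hp m d
  have hc := stronglyMeasurable_centreLast (P := P) hh
  have hterm : ∀ k ∈ Finset.range N, tailIntegral p q (iidLaw ℕ P)
      (incPow p τ (uIncrement P h) k) (t * N ^ growthExponent p (m + 1) d)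
      ≤ K * ∫⁻ y, uTailBound p q P τ (fixLast (centreLast P h) y) (d - 1) N (t * N ^ κ) ∂P := by
    intro k hk
    rw [tailIntegral_incPow_uIncrement hh, hgrowth, Real.rpow_add hN0, ← mul_assoc t,
      ← lintegral_const_mul _ (measurable_uTailBound_fixLast hc)]
    refine lintegral_mono_ae ?_
    filter_upwards [(hd.addParam_centreLast_pred hh hi).ae_fixLast,
      ae_integrable_fixLast (integrable_centreLast hi)] with y hy_deg hy_int
    exact (tailIntegral_mono fun x => uPow_le_maxUPow (Finset.mem_range.1 hk).le _ x).trans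
      (hK S T P τ _ (stronglyMeasurable_fixLast hc y) hy_int (d - 1) hy_deg N hN _ (by positivity))
  calc tailIntegral p q (iidLaw ℕ P)
        (fun x => (Finset.range N).sup fun k => incPow p τ (uIncrement P h) k x)
        (t * N ^ growthExponent p (m + 1) d)
      ≤ ∑ k ∈ Finset.range N, tailIntegral p q (iidLaw ℕ P) (incPow p τ (uIncrement P h) k)
          (t * N ^ growthExponent p (m + 1) d) := tailIntegral_sup_le _ _
    _ ≤ N * (K * ∫⁻ y,
          uTailBound p q P τ (fixLast (centreLast P h) y) (d - 1) N (t * N ^ κ) ∂P) := by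
        simpa using Finset.sum_le_card_nsmul _ _ _ hterm
    _ ≤ K * (2 ^ m * uTailBound p q P τ (centreLast P h) d N t) := by
        rw [mul_left_comm]
        gcongr K * ?_
        exact mul_lintegral_uTailBound_fixLast_le hc hN htail

end Terms

lemma exists_hasUTailBound_succ [CompleteSpace B] {C : ℝ≥0∞} (hC : C ≠ ∞)
    (hB : HasMartingaleType.{u, v} p C B) (hp : 1 ≤ p) (hp2 : p ≤ 2) (hq : 0 < q) (hKtop : K ≠ ∞)
    (hK : HasUTailBound.{u, v} p q B m K) :
    ∃ K' : ℝ≥0∞, K' ≠ ∞ ∧ HasUTailBound.{u, v} p q B (m + 1) K' := by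
  obtain ⟨K₀, hK₀, hmartingale⟩ := exists_tailIntegral_sup_sumPow_le.{u, v} hp hp2 hq hC
  set c := ENNReal.ofReal ((1 / 4 : ℝ) ^ (-(q / p)))
  set D : ℝ≥0∞ := 2 ^ (m + 1) * (c * 2)
  refine ⟨c * (K₀ * (K * (2 ^ m * D) + K * (2 ^ m * D)) + K * 2 ^ m), by finiteness, ?_⟩
  intro S T _ _ P _ τ _ h hh hi d hd N hN t ht
  have hN0 : (0 : ℝ) < N := by exact_mod_cast hN
  have hcentre : uTailBound p q P τ (centreLast P h) d N t ≤ D * uTailBound p q P τ h d N t :=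
    uTailBound_le_of_momentTail_le le_rfl fun s => momentTail_centreLast_le hp hp2 hh
  have hincrements : tailIntegral p q (iidLaw ℕ P)
      (fun x => (Finset.range (N + 1)).sup fun n => sumPow p τ (uIncrement P h) n x)
      (t * N ^ growthExponent p (m + 1) d)
      ≤ K₀ * (K * (2 ^ m * (D * uTailBound p q P τ h d N t))
        + K * (2 ^ m * (D * uTailBound p q P τ h d N t))) := by
    refine (hmartingale B hB S T P τ _ (isMartingaleDiff_uIncrement hh hi) N _
      (by positivity)).trans ?_
    gcongr
    · exact (hK.tailIntegral_sup_incPow_le hp hh hi hd hN ht).trans (by gcongr)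
    · exact (hK.tailIntegral_sum_condIncPow_le hp hh hi hd hN ht).trans (by gcongr)
  have hthreshold : t * (N : ℝ) ^ growthExponent p (m + 1) d
      = N ^ p * (t * N ^ growthExponent p m d) := by
    rw [growthExponent_succ, Real.rpow_add hN0, mul_left_comm]
  have hdecomposed := tailIntegral_maxUPow_le (q := q) (P := P) (τ := τ) hp hp2 hh hN
    (t * N ^ growthExponent p m d)
  rw [← hthreshold] at hdecomposed
  calc tailIntegral p q (iidLaw ℕ P) (maxUPow p τ h N) (t * N ^ growthExponent p (m + 1) d)
      ≤ _ := hdecomposed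
    _ ≤ c * (K₀ * (K * (2 ^ m * (D * uTailBound p q P τ h d N t))
          + K * (2 ^ m * (D * uTailBound p q P τ h d N t)))
        + K * (2 ^ m * uTailBound p q P τ h d N t)) := by
        gcongr
        exact hK.tailIntegral_meanLast_le hp hh hi hd hN ht
    _ = _ := by ring

lemma exists_hasUTailBound [CompleteSpace B] {C : ℝ≥0∞} (hC : C ≠ ∞)
    (hB : HasMartingaleType.{u, v} p C B) (hp : 1 ≤ p) (hp2 : p ≤ 2) (hq : 0 < q) (m : ℕ) :
    ∃ K : ℝ≥0∞, K ≠ ∞ ∧ HasUTailBound.{u, v} p q B m K := by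
  induction m with
  | zero => exact ⟨1, ENNReal.one_ne_top, hasUTailBound_zero (by linarith)⟩
  | succ m ih =>
    obtain ⟨K, hKtop, hK⟩ := ih
    exact exists_hasUTailBound_succ hC hB hp hp2 hq hKtop hK

end InductionStep

section Conditional

variable {S : Type*} {m k : ℕ}

/-- The tuple whose first `k` arguments are those of `x` and whose other ones are those of `y`. -/
def glueFirst (x : Fin k → S) (y : Fin m → S) : Fin m → S :=
  fun i => if h : (i : ℕ) < k then x ⟨i, h⟩ else y i

lemma take_glueFirst (hk : k ≤ m) (x : Fin k → S) (y : Fin m → S) :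
    Fin.take k hk (glueFirst x y) = x := by
  ext i
  simp [glueFirst]

lemma IsSymmetricKernel.comp {B B' : Type*} {h : (Fin m → S) → B} (hsym : IsSymmetricKernel h)
    (g : B → B') : IsSymmetricKernel fun x => g (h x) :=
  fun σ x => congrArg g (hsym σ x)

lemma exists_perm_mem_iff_lt_card (I : Finset (Fin m)) :
    ∃ σ : Equiv.Perm (Fin m), ∀ i, σ i ∈ I ↔ (i : ℕ) < I.card := by
  classical
  have hI : I.card ≤ m := by simpa using I.card_le_univ
  have hcard : Fintype.card {i : Fin m // (i : ℕ) < I.card} = Fintype.card {i // i ∈ I} := by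
    rw [Fintype.card_coe, Fintype.card_subtype, Fin.card_filter_val_lt, min_eq_right hI]
  refine ⟨(Fintype.equivOfCardEq hcard).extendSubtype, fun i => ⟨fun h => ?_, fun h => ?_⟩⟩
  · by_contra hi
    exact Equiv.extendSubtype_not_mem _ i hi h
  · exact Equiv.extendSubtype_mem _ i h

lemma IsSymmetricKernel.exists_piecewise_eq_glueFirst {B : Type*} {h : (Fin m → S) → B}
    (hsym : IsSymmetricKernel h) (I : Finset (Fin m)) :
    ∃ (σ : Equiv.Perm (Fin m)) (hI : I.card ≤ m), ∀ x y : Fin m → S,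
      h (I.piecewise x y)
        = h (glueFirst (Fin.take I.card hI fun i => x (σ i)) fun i => y (σ i)) := by
  obtain ⟨σ, hσ⟩ := exists_perm_mem_iff_lt_card I
  refine ⟨σ, by simpa using I.card_le_univ, fun x y => ?_⟩
  rw [← hsym σ]
  congr 1
  ext i
  by_cases hi : (i : ℕ) < I.card <;> simp [glueFirst, Finset.piecewise, hσ, hi]

variable [MeasurableSpace S] {P : Measure S} [IsProbabilityMeasure P]

lemma measurePreserving_take (hk : k ≤ m) :
    MeasurePreserving (fun x : Fin m → S => Fin.take k hk x) (iidLaw (Fin m) P)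
      (iidLaw (Fin k) P) :=
  measurePreserving_comp_injective P (Fin.castLE_injective hk)

lemma measurePreserving_take_perm (hk : k ≤ m) (σ : Equiv.Perm (Fin m)) :
    MeasurePreserving (fun x : Fin m → S => Fin.take k hk fun i => x (σ i)) (iidLaw (Fin m) P)
      (iidLaw (Fin k) P) :=
  (measurePreserving_take hk).comp (measurePreserving_comp_injective P σ.injective)

lemma measurePreserving_glueFirst (P : Measure S) [IsProbabilityMeasure P] (k m : ℕ) :
    MeasurePreserving (fun z : (Fin k → S) × (Fin m → S) => glueFirst z.1 z.2)
      ((iidLaw (Fin k) P).prod (iidLaw (Fin m) P)) (iidLaw (Fin m) P) := by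
  have hf : Function.Injective fun i : Fin m =>
      if h : (i : ℕ) < k then (Sum.inl ⟨i, h⟩ : Fin k ⊕ Fin m) else Sum.inr i := by
    intro i j h
    by_cases hi : (i : ℕ) < k <;> by_cases hj : (j : ℕ) < k <;> simp_all [Fin.ext_iff]
  convert measurePreserving_sumElim_comp P hf using 2 with z
  ext i
  by_cases hi : (i : ℕ) < k <;> simp [glueFirst, hi]

lemma measurePreserving_glueFirst_restrict (hk : k ≤ m) {A : Set (Fin k → S)}
    (hA : MeasurableSet A) :
    MeasurePreserving (fun z : (Fin k → S) × (Fin m → S) => glueFirst z.1 z.2)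
      (((iidLaw (Fin k) P).restrict A).prod (iidLaw (Fin m) P))
      ((iidLaw (Fin m) P).restrict ((fun x => Fin.take k hk x) ⁻¹' A)) := by
  have hpre : (fun z : (Fin k → S) × (Fin m → S) => glueFirst z.1 z.2) ⁻¹'
      ((fun x => Fin.take k hk x) ⁻¹' A) = A ×ˢ Set.univ := by
    ext z
    simp [take_glueFirst]
  have hrestrict := (measurePreserving_glueFirst P k m).restrict_preimage
    ((measurePreserving_take (P := P) hk).measurable hA)
  rwa [hpre, ← Measure.prod_restrict, Measure.restrict_univ] at hrestrict

lemma setLIntegral_preimage_take (hk : k ≤ m) {f : (Fin m → S) → ℝ≥0∞} (hf : Measurable f)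
    {A : Set (Fin k → S)} (hA : MeasurableSet A) :
    ∫⁻ x in (fun x => Fin.take k hk x) ⁻¹' A, f x ∂(iidLaw (Fin m) P)
      = ∫⁻ x in A, ∫⁻ y, f (glueFirst x y) ∂(iidLaw (Fin m) P) ∂(iidLaw (Fin k) P) := by
  have hmp := measurePreserving_glueFirst_restrict (P := P) hk hA
  rw [← hmp.lintegral_comp hf]
  exact lintegral_prod (fun z : (Fin k → S) × (Fin m → S) => f (glueFirst z.1 z.2))
    (hf.comp hmp.measurable).aemeasurable

variable {B : Type*} [NormedAddCommGroup B]

section SetIntegral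

variable [NormedSpace ℝ B] {f : (Fin m → S) → B}

lemma setIntegral_preimage_take (hk : k ≤ m) (hfi : Integrable f (iidLaw (Fin m) P))
    {A : Set (Fin k → S)} (hA : MeasurableSet A) :
    ∫ x in (fun x => Fin.take k hk x) ⁻¹' A, f x ∂(iidLaw (Fin m) P)
      = ∫ x in A, ∫ y, f (glueFirst x y) ∂(iidLaw (Fin m) P) ∂(iidLaw (Fin k) P) := by
  have hmp := measurePreserving_glueFirst_restrict (P := P) hk hA
  rw [← integral_comp_of_measurePreserving hmp hfi.restrict.aestronglyMeasurable]
  exact integral_prod (fun z : (Fin k → S) × (Fin m → S) => f (glueFirst z.1 z.2))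
    ((hmp.integrable_comp hfi.restrict.aestronglyMeasurable).2 hfi.restrict)

lemma stronglyMeasurable_integral_glueFirst (hf : StronglyMeasurable f) :
    StronglyMeasurable fun x : Fin k → S => ∫ y, f (glueFirst x y) ∂(iidLaw (Fin m) P) :=
  (hf.comp_measurable (measurePreserving_glueFirst P k m).measurable).integral_prod_right'

end SetIntegral

lemma measurable_lintegral_glueFirst {f : (Fin m → S) → ℝ≥0∞} (hf : Measurable f) :
    Measurable fun x : Fin k → S => ∫⁻ y, f (glueFirst x y) ∂(iidLaw (Fin m) P) :=
  (hf.comp (measurePreserving_glueFirst P k m).measurable).lintegral_prod_right'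

variable {Ω : Type*} {ξ : ℕ → Ω → S}

lemma firstSigma_mono (ξ : ℕ → Ω → S) : Monotone (firstSigma ξ) := fun k l hkl =>
  ((measurable_pi_iff.2 fun i : Fin k => measurable_pi_apply (Fin.castLE hkl i)).comp
    (comap_measurable fun ω => fun i : Fin l => ξ i ω)).comap_le

variable [MeasurableSpace Ω] {μ : Measure Ω}

lemma IsIID.measurePreserving (hξ : IsIID μ ξ) :
    MeasurePreserving (fun ω i => ξ i ω) μ (iidLaw ℕ (μ.map (ξ 0))) := by
  refine ⟨measurable_pi_iff.2 hξ.measurable, ?_⟩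
  rw [hξ.indep.map_fun_eq_infinitePi_map hξ.measurable]
  simp_rw [(hξ.identDistrib _).map_eq]

variable [IsProbabilityMeasure μ]

lemma IsIID.isProbabilityMeasure_map (hξ : IsIID μ ξ) : IsProbabilityMeasure (μ.map (ξ 0)) :=
  Measure.isProbabilityMeasure_map (hξ.measurable 0).aemeasurable

lemma IsIID.measurePreserving_fin (hξ : IsIID μ ξ) (k : ℕ) :
    MeasurePreserving (fun ω (i : Fin k) => ξ i ω) μ (iidLaw (Fin k) (μ.map (ξ 0))) :=
  haveI := hξ.isProbabilityMeasure_map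
  (measurePreserving_comp_injective (μ.map (ξ 0)) Fin.val_injective).comp hξ.measurePreserving

lemma IsIID.firstSigma_le (hξ : IsIID μ ξ) (k : ℕ) : firstSigma ξ k ≤ ‹MeasurableSpace Ω› :=
  (hξ.measurePreserving_fin k).measurable.comap_le

lemma IsIID.lintegral_glueFirst_ae_eq_condLExp (hξ : IsIID μ ξ) (hk : k ≤ m)
    {f : (Fin m → S) → ℝ≥0∞} (hf : Measurable f) :
    (fun ω => ∫⁻ y, f (glueFirst (fun i : Fin k => ξ i ω) y) ∂(iidLaw (Fin m) (μ.map (ξ 0))))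
      =ᵐ[μ] condLExp (firstSigma ξ k) μ fun ω => f fun i => ξ i ω := by
  have := hξ.isProbabilityMeasure_map
  have hG := measurable_lintegral_glueFirst (P := μ.map (ξ 0)) (k := k) hf
  refine ae_eq_condLExp (hm := hξ.firstSigma_le k) μ _ (hG.comp (comap_measurable _)) ?_
  rintro _ ⟨A, hA, rfl⟩
  rw [(hξ.measurePreserving_fin k).setLIntegral_comp_preimage hA hG,
    ← setLIntegral_preimage_take hk hf hA,
    ← (hξ.measurePreserving_fin m).setLIntegral_comp_preimage
      ((measurePreserving_take (P := μ.map (ξ 0)) hk).measurable hA) hf]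
  rfl

variable [NormedSpace ℝ B]

lemma IsIID.integral_glueFirst_ae_eq_condExp [CompleteSpace B] (hξ : IsIID μ ξ) (hk : k ≤ m)
    {f : (Fin m → S) → B} (hf : StronglyMeasurable f)
    (hfi : Integrable f (iidLaw (Fin m) (μ.map (ξ 0)))) :
    (fun ω => ∫ y, f (glueFirst (fun i : Fin k => ξ i ω) y) ∂(iidLaw (Fin m) (μ.map (ξ 0))))
      =ᵐ[μ] μ[fun ω => f fun i => ξ i ω | firstSigma ξ k] := by
  have := hξ.isProbabilityMeasure_map
  have hmk := hξ.measurePreserving_fin k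
  have hmm := hξ.measurePreserving_fin m
  have hG := stronglyMeasurable_integral_glueFirst (P := μ.map (ξ 0)) (k := k) hf
  have hGi := (((measurePreserving_glueFirst (μ.map (ξ 0)) k m).integrable_comp
    hf.aestronglyMeasurable).2 hfi).integral_prod_left
  refine ae_eq_condExp_of_forall_setIntegral_eq (hξ.firstSigma_le k)
    ((hmm.integrable_comp hf.aestronglyMeasurable).2 hfi)
    (fun _ _ _ => ((hmk.integrable_comp hG.aestronglyMeasurable).2 hGi).integrableOn) ?_
    (hG.comp_measurable (comap_measurable _)).aestronglyMeasurable
  rintro _ ⟨A, hA, rfl⟩ -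
  calc _ = _ := integral_comp_of_measurePreserving (hmk.restrict_preimage hA)
        hG.aestronglyMeasurable
    _ = _ := (setIntegral_preimage_take hk hfi hA).symm
    _ = _ := (integral_comp_of_measurePreserving (hmm.restrict_preimage
        ((measurePreserving_take (P := μ.map (ξ 0)) hk).measurable hA))
        hf.aestronglyMeasurable).symm

lemma IsIID.condExp_firstSigma_eq_zero_of_le [CompleteSpace B] (hξ : IsIID μ ξ) {X : Ω → B}
    {l : ℕ} (hkl : k ≤ l) (hX : μ[X | firstSigma ξ l] =ᵐ[μ] 0) :
    μ[X | firstSigma ξ k] =ᵐ[μ] 0 :=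
  calc μ[X | firstSigma ξ k] =ᵐ[μ] μ[μ[X | firstSigma ξ l] | firstSigma ξ k] :=
        (condExp_condExp_of_le (firstSigma_mono ξ hkl) (hξ.firstSigma_le l)).symm
    _ =ᵐ[μ] μ[(0 : Ω → B) | firstSigma ξ k] := condExp_congr_ae hX
    _ = 0 := condExp_zero

end Conditional

section Transfer

/-- The kernel `h` without a parameter, as a kernel with a parameter in a one-point space. -/
def trivialParam.{w} {S B : Type*} {m : ℕ} (h : (Fin m → S) → B)
    (w : (Fin m → S) × PUnit.{w + 1}) : B := h w.1

variable {B S Ω : Type*} {m : ℕ}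

lemma uStat_eq_uSum_trivialParam.{w} [AddCommMonoid B] (h : (Fin m → S) → B) (ξ : ℕ → Ω → S) (n : ℕ)
    (ω : Ω) (t : PUnit.{w + 1}) :
    uStat h ξ n ω = uSum (trivialParam h) n (fun i => ξ i ω, t) := by
  refine Finset.sum_bij' (fun i _ l => (i l : ℕ))
    (fun i hi => OrderEmbedding.ofStrictMono (fun l => ⟨i l, (mem_incTuples.1 hi).1 l⟩)
      fun _ _ hab => (mem_incTuples.1 hi).2 hab) ?_ ?_ ?_ ?_ ?_
  · exact fun i _ => mem_incTuples.2 ⟨fun l => (i l).2, fun _ _ hab => i.strictMono hab⟩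
  · exact fun _ _ => Finset.mem_univ _
  · exact fun _ _ => rfl
  · exact fun _ _ => rfl
  · exact fun _ _ => rfl

variable [NormedAddCommGroup B] {h : (Fin m → S) → B} {p q : ℝ}

lemma uPow_trivialParam.{w} (h : (Fin m → S) → B) (ξ : ℕ → Ω → S) (n : ℕ) (ω : Ω) :
    uPow p (Measure.dirac PUnit.unit.{w + 1}) (trivialParam h) n (fun i => ξ i ω)
      = ‖uStat h ξ n ω‖ₑ ^ p := by
  simp [uPow, lpPow, uStat_eq_uSum_trivialParam h ξ n ω PUnit.unit.{w + 1}]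

lemma maxUStat_zero_right (hm : 1 ≤ m) (h : (Fin m → S) → B) (ξ : ℕ → Ω → S) (ω : Ω) :
    maxUStat h ξ 0 ω = 0 := by
  simp [maxUStat, Finset.Icc_eq_empty_of_lt (Nat.lt_of_succ_le hm)]

lemma enorm_rpow_lt_maxUPow_of_lt_maxUStat.{w} (hp : 0 < p) {N : ℕ} {s : ℝ} (hs : 0 ≤ s)
    (h : (Fin m → S) → B) (ξ : ℕ → Ω → S) {ω : Ω} (hω : s < (maxUStat h ξ N ω : ℝ)) :
    ENNReal.ofReal (s ^ p)
      < maxUPow p (Measure.dirac PUnit.unit.{w + 1}) (trivialParam h) N (fun i => ξ i ω) := by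
  obtain ⟨n, hn, hlt⟩ : ∃ n ∈ Finset.Icc m N, s.toNNReal < ‖uStat h ξ n ω‖₊ :=
    Finset.lt_sup_iff.1 ((Real.toNNReal_lt_iff_lt_coe hs).2 hω)
  calc ENNReal.ofReal (s ^ p) = ENNReal.ofReal s ^ p :=
        (ENNReal.ofReal_rpow_of_nonneg hs hp.le).symm
    _ < ‖uStat h ξ n ω‖ₑ ^ p := ENNReal.rpow_lt_rpow (ENNReal.coe_lt_coe.2 hlt) hp
    _ = uPow p (Measure.dirac PUnit.unit.{w + 1}) (trivialParam h) n (fun i => ξ i ω) :=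
        (uPow_trivialParam h ξ n ω).symm
    _ ≤ _ := uPow_le_maxUPow (Finset.mem_Icc.1 hn).2 _ _

variable [MeasurableSpace S]

lemma measurable_maxUPow {T : Type*} [MeasurableSpace T] {τ : Measure T} [SFinite τ]
    {h : (Fin m → S) × T → B} (hh : StronglyMeasurable h) (N : ℕ) :
    Measurable (maxUPow p τ h N) :=
  measurable_finset_sup _ fun n => measurable_lpPow (stronglyMeasurable_uSum hh n)

lemma stronglyMeasurable_trivialParam.{w} (hh : StronglyMeasurable h) :
    StronglyMeasurable (trivialParam h : (Fin m → S) × PUnit.{w + 1} → B) :=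
  hh.comp_measurable measurable_fst

variable [MeasurableSpace Ω] {μ : Measure Ω} {ξ : ℕ → Ω → S}

lemma tailIntegral_maxCondMoment_eq (hp : 0 < p) {s : ℝ} (hs : 0 ≤ s) :
    tailIntegral p q μ (fun ω => maxCondMoment μ ξ h p ω ^ p) (s ^ p)
      = ∫⁻ u in Set.Ioc (0 : ℝ) 1, ENNReal.ofReal (u ^ (q - 1)) *
          μ {ω | ENNReal.ofReal (s * u) < maxCondMoment μ ξ h p ω} := by
  rw [tailIntegral, lintegral_powWeight]
  refine setLIntegral_congr_fun measurableSet_Ioc fun u hu => ?_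
  have hlt (ω : Ω) : ENNReal.ofReal (s ^ p * u ^ p) < maxCondMoment μ ξ h p ω ^ p
      ↔ ENNReal.ofReal (s * u) < maxCondMoment μ ξ h p ω := by
    rw [← Real.mul_rpow hs hu.1.le, ← ENNReal.ofReal_rpow_of_nonneg (mul_nonneg hs hu.1.le) hp.le,
      ENNReal.rpow_lt_rpow_iff hp]
  simp only [hlt]

lemma condLExp_le_maxCondMoment_rpow (hp : 0 < p) {k : ℕ} (hk : k ≤ m) (ω : Ω) :
    condLExp (firstSigma ξ k) μ (fun ω' => ‖kernelAt h ξ ω'‖ₑ ^ p) ω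
      ≤ maxCondMoment μ ξ h p ω ^ p := by
  rw [← ENNReal.rpow_inv_le_iff hp, ← one_div]
  exact Finset.le_sup (f := fun k =>
    (condLExp (firstSigma ξ k) μ (fun ω' => ‖kernelAt h ξ ω'‖ₑ ^ p) ω) ^ (1 / p))
    (Finset.mem_range.2 (Nat.lt_succ_of_le hk))

lemma measure_lt_maxUStat_le.{w} (hp : 0 < p) (hq : 0 < q) (hξ : IsIID μ ξ)
    (hh : StronglyMeasurable h) (N : ℕ) {s : ℝ} (hs : 0 ≤ s) :
    μ {ω | s < (maxUStat h ξ N ω : ℝ)} ≤ ENNReal.ofReal q *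
      tailIntegral p q (iidLaw ℕ (μ.map (ξ 0)))
        (maxUPow p (Measure.dirac PUnit.unit.{w + 1}) (trivialParam h) N) (s ^ p) := by
  rw [← tailIntegral_comp hξ.measurePreserving
    (measurable_maxUPow (stronglyMeasurable_trivialParam hh) N)]
  exact (measure_mono fun ω hω => enorm_rpow_lt_maxUPow_of_lt_maxUStat hp hs h ξ hω).trans
    (measure_lt_le_tailIntegral hp hq (Real.rpow_nonneg hs p) _)

lemma condMoment_trivialParam.{w} {P : Measure S} [IsProbabilityMeasure P]
    (hh : StronglyMeasurable h) (hsym : IsSymmetricKernel h) (J : Finset (Fin m)) :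
    ∃ (σ : Equiv.Perm (Fin m)) (hJ : J.card ≤ m),
      condMoment p P (Measure.dirac PUnit.unit.{w + 1}) (trivialParam h) J = fun x =>
        ∫⁻ y, ‖h (glueFirst (Fin.take J.card hJ fun i => x (σ i)) y)‖ₑ ^ p ∂(iidLaw (Fin m) P) := by
  obtain ⟨σ, hJ, hσ⟩ := (hsym.comp fun b => ‖b‖ₑ ^ p).exists_piecewise_eq_glueFirst J
  refine ⟨σ, hJ, funext fun x => ?_⟩
  have hmeas : Measurable fun y =>
      ‖h (glueFirst (Fin.take J.card hJ fun i => x (σ i)) y)‖ₑ ^ p :=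
    ((hh.enorm.pow_const p).comp (measurePreserving_glueFirst P J.card m).measurable).comp
      measurable_prodMk_left
  rw [← (measurePreserving_comp_injective P σ.injective).lintegral_comp hmeas]
  simp only [condMoment, lpPow, trivialParam, lintegral_const, measure_univ, mul_one, hσ]

variable [IsProbabilityMeasure μ]

lemma tailIntegral_condMoment_trivialParam_le.{w} (hp : 0 < p) (hξ : IsIID μ ξ)
    (hh : StronglyMeasurable h) (hsym : IsSymmetricKernel h) (J : Finset (Fin m)) (s : ℝ) :
    tailIntegral p q (iidLaw (Fin m) (μ.map (ξ 0)))
      (condMoment p (μ.map (ξ 0)) (Measure.dirac PUnit.unit.{w + 1}) (trivialParam h) J) s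
      ≤ tailIntegral p q μ (fun ω => maxCondMoment μ ξ h p ω ^ p) s := by
  have := hξ.isProbabilityMeasure_map
  obtain ⟨σ, hJ, hmoment⟩ := condMoment_trivialParam (p := p) (P := μ.map (ξ 0)) hh hsym J
  have hf : Measurable fun x => ‖h x‖ₑ ^ p := hh.enorm.pow_const p
  have hQ := measurable_lintegral_glueFirst (P := μ.map (ξ 0)) (k := J.card) hf
  rw [hmoment, tailIntegral_comp (measurePreserving_take_perm hJ σ) hQ,
    ← tailIntegral_comp (hξ.measurePreserving_fin J.card) hQ]
  refine tailIntegral_mono_ae ?_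
  filter_upwards [hξ.lintegral_glueFirst_ae_eq_condLExp hJ hf] with ω hω
  exact hω.le.trans (condLExp_le_maxCondMoment_rpow hp hJ ω)

lemma momentTail_trivialParam_le.{w} (hp : 0 < p) (hξ : IsIID μ ξ) (hh : StronglyMeasurable h)
    (hsym : IsSymmetricKernel h) {s : ℝ} (hs : 0 ≤ s) :
    momentTail p q (μ.map (ξ 0)) (Measure.dirac PUnit.unit.{w + 1}) (trivialParam h) (s ^ p)
      ≤ 2 ^ m * ∫⁻ u in Set.Ioc (0 : ℝ) 1, ENNReal.ofReal (u ^ (q - 1)) *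
          μ {ω | ENNReal.ofReal (s * u) < maxCondMoment μ ξ h p ω} := by
  rw [← tailIntegral_maxCondMoment_eq hp hs]
  exact sum_finset_le_of_forall_le fun J =>
    tailIntegral_condMoment_trivialParam_le hp hξ hh hsym J _

variable [NormedSpace ℝ B]

lemma isDegenerateKernel_trivialParam.{w} [CompleteSpace B] (hξ : IsIID μ ξ)
    (hh : StronglyMeasurable h) (hsym : IsSymmetricKernel h)
    (hi : Integrable h (iidLaw (Fin m) (μ.map (ξ 0)))) {d : ℕ}
    (hd : ∀ k < d, μ[kernelAt h ξ | firstSigma ξ k] =ᵐ[μ] 0) :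
    IsDegenerateKernel (μ.map (ξ 0)) (Measure.dirac PUnit.unit.{w + 1}) (trivialParam h) d := by
  have := hξ.isProbabilityMeasure_map
  set P := μ.map (ξ 0)
  intro I hI
  obtain ⟨σ, hIm, hσ⟩ := hsym.exists_piecewise_eq_glueFirst I
  have hmk := hξ.measurePreserving_fin I.card
  have hzero : ∀ᵐ x ∂(iidLaw (Fin I.card) P), ∫ y, h (glueFirst x y) ∂(iidLaw (Fin m) P) = 0 := by
    rw [← hmk.map_eq, ae_map_iff hmk.measurable.aemeasurable
      ((stronglyMeasurable_integral_glueFirst hh).measurableSet_eq_fun stronglyMeasurable_const)]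
    exact (hξ.integral_glueFirst_ae_eq_condExp hIm hh hi).trans (hd I.card hI)
  have htake := (measurePreserving_take_perm (P := P) hIm σ).comp
    (measurePreserving_fst (ν := Measure.dirac PUnit.unit.{w + 1}))
  filter_upwards [htake.quasiMeasurePreserving.ae hzero] with z hz
  simp only [trivialParam, hσ]
  rw [← hz]
  exact integral_comp_of_measurePreserving (measurePreserving_comp_injective P σ.injective)
    ((hh.comp_measurable (measurePreserving_glueFirst P I.card m).measurable).comp_measurable
      measurable_prodMk_left).aestronglyMeasurable

end Transfer

section Conclusion

variable {B : Type*} [NormedAddCommGroup B] {m : ℕ} {p q : ℝ}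

lemma mul_growthExponent_root (hp : p ≠ 0) (m d : ℕ) :
    p * ((m : ℝ) - d + d / p) = growthExponent p m d := by
  rw [growthExponent]
  field_simp

lemma mul_tailExponent_root (hp : p ≠ 0) (d j : ℕ) :
    p * (((max d j : ℕ) - (d : ℝ)) * ((p - 1) / p) + j / p) = tailExponent p d j := by
  rw [tailExponent]
  field_simp

lemma mul_rpow_rpow {x t : ℝ} (ht : 0 ≤ t) (hx : 0 ≤ x) (a : ℝ) :
    (t * x ^ a) ^ p = t ^ p * x ^ (p * a) := by
  rw [Real.mul_rpow ht (Real.rpow_nonneg hx a), ← Real.rpow_mul hx, mul_comm a]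

variable {Ω S : Type*} [MeasurableSpace Ω] [MeasurableSpace S] {μ : Measure Ω}
  [IsProbabilityMeasure μ] {ξ : ℕ → Ω → S} {h : (Fin m → S) → B} {d N : ℕ} {t : ℝ}

lemma uTailBound_trivialParam_le.{w} (hp : 0 < p) (hξ : IsIID μ ξ) (hh : StronglyMeasurable h)
    (hsym : IsSymmetricKernel h) (ht : 0 ≤ t) :
    uTailBound p q (μ.map (ξ 0)) (Measure.dirac PUnit.unit.{w + 1}) (trivialParam h) d N (t ^ p)
      ≤ 2 ^ m * ∑ j ∈ Finset.range (m + 1), (N : ℝ≥0∞) ^ j *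
          ∫⁻ u in Set.Ioc (0 : ℝ) 1, ENNReal.ofReal (u ^ (q - 1)) *
            μ {ω | ENNReal.ofReal
                  (t * (N : ℝ) ^ (((max d j : ℕ) - (d : ℝ)) * ((p - 1) / p) + j / p) * u)
                < maxCondMoment μ ξ h p ω} := by
  rw [uTailBound, Finset.mul_sum]
  refine Finset.sum_le_sum fun j _ => ?_
  rw [mul_left_comm, ← mul_tailExponent_root hp.ne', ← mul_rpow_rpow ht N.cast_nonneg]
  gcongr
  exact momentTail_trivialParam_le hp hξ hh hsym (by positivity)

variable [NormedSpace ℝ B] [CompleteSpace B]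

variable (B m) in
lemma exists_hasUTailBound_of_isRSmooth.{u} (hp : 1 < p) (hq : 0 < q) :
    ∃ K : ℝ≥0∞, K ≠ ∞ ∧ ∀ r, p ≤ r → r ≤ 2 → IsRSmooth r B → HasUTailBound.{u} p q B m K := by
  by_cases hsmooth : ∃ r, p ≤ r ∧ r ≤ 2 ∧ IsRSmooth r B
  · obtain ⟨r, hpr, hr, hB⟩ := hsmooth
    obtain ⟨ν, C₀, hν⟩ := hB.exists_isPowerSmooth hp hpr hr
    obtain ⟨C, hC, htype⟩ := hν.exists_hasMartingaleType hp.le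
    obtain ⟨K, hK, hbound⟩ := exists_hasUTailBound hC htype hp.le (hpr.trans hr) hq m
    exact ⟨K, hK, fun _ _ _ _ => hbound⟩
  · exact ⟨0, ENNReal.zero_ne_top, fun r hpr hr hB => absurd ⟨r, hpr, hr, hB⟩ hsmooth⟩

lemma HasUTailBound.measure_lt_maxUStat_le.{u} {Ω : Type*} {S : Type u} [MeasurableSpace Ω]
    [MeasurableSpace S] {μ : Measure Ω} [IsProbabilityMeasure μ] {ξ : ℕ → Ω → S}
    {h : (Fin m → S) → B} {K : ℝ≥0∞} (hK : HasUTailBound.{u} p q B m K) (hp : 0 < p) (hq : 0 < q)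
    (hξ : IsIID μ ξ) (hh : StronglyMeasurable h) (hsym : IsSymmetricKernel h)
    (hint : Integrable (kernelAt h ξ) μ) (hd : ∀ k < d, μ[kernelAt h ξ | firstSigma ξ k] =ᵐ[μ] 0)
    (hN : 1 ≤ N) (ht : 0 < t) :
    μ {ω | t * (N : ℝ) ^ ((m : ℝ) - d + d / p) < (maxUStat h ξ N ω : ℝ)}
      ≤ ENNReal.ofReal q * (K * (2 ^ m * ∑ j ∈ Finset.range (m + 1), (N : ℝ≥0∞) ^ j *
          ∫⁻ u in Set.Ioc (0 : ℝ) 1, ENNReal.ofReal (u ^ (q - 1)) *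
            μ {ω | ENNReal.ofReal
                  (t * (N : ℝ) ^ (((max d j : ℕ) - (d : ℝ)) * ((p - 1) / p) + j / p) * u)
                < maxCondMoment μ ξ h p ω})) := by
  have := hξ.isProbabilityMeasure_map
  have hi : Integrable h (iidLaw (Fin m) (μ.map (ξ 0))) :=
    ((hξ.measurePreserving_fin m).integrable_comp hh.aestronglyMeasurable).1 hint
  have hbound := hK S PUnit (μ.map (ξ 0)) (Measure.dirac PUnit.unit) (trivialParam h)
    (stronglyMeasurable_trivialParam hh) ((measurePreserving_fst.integrable_comp hi.1).2 hi) d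
    (isDegenerateKernel_trivialParam hξ hh hsym hi hd) N hN (t ^ p) (by positivity)
  refine (_root_.measure_lt_maxUStat_le hp hq hξ hh N (by positivity)).trans ?_
  rw [mul_rpow_rpow ht.le N.cast_nonneg, mul_growthExponent_root hp.ne']
  gcongr
  exact hbound.trans (by gcongr; exact uTailBound_trivialParam_le hp hξ hh hsym ht.le)

end Conclusion

theorem mainTheorem3_general {B : Type*} [NormedAddCommGroup B] [NormedSpace ℝ B] [CompleteSpace B]
    (m : ℕ) (p q : ℝ) (hp : 1 < p) (hq : 0 < q) :
    ∃ K : ℝ, 0 < K ∧ ∀ r : ℝ, p ≤ r → r ≤ 2 → IsRSmooth r B →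
      ∀ (Ω S : Type*) [MeasurableSpace Ω] [MeasurableSpace S]
        (μ : Measure Ω) [IsProbabilityMeasure μ] (ξ : ℕ → Ω → S)
        (h : (Fin m → S) → B) (d : ℕ),
        1 ≤ m → IsIID μ ξ → StronglyMeasurable h → IsSymmetricKernel h →
        Integrable (kernelAt h ξ) μ → (∀ k < d, μ[kernelAt h ξ | firstSigma ξ k] =ᵐ[μ] 0) →
        ∀ (N : ℕ) (t : ℝ), 0 < t →
          μ {ω | t * (N : ℝ) ^ ((m : ℝ) - d + d / p) < (maxUStat h ξ N ω : ℝ)} ≤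
            ENNReal.ofReal K * ∑ j ∈ Finset.range (m + 1), (N : ℝ≥0∞) ^ j *
              ∫⁻ u in Set.Ioc (0 : ℝ) 1, ENNReal.ofReal (u ^ (q - 1)) *
                μ {ω | ENNReal.ofReal
                      (t * (N : ℝ) ^ (((max d j : ℕ) - (d : ℝ)) * ((p - 1) / p) + j / p) * u)
                    < maxCondMoment μ ξ h p ω} := by
  obtain ⟨K, hK, hbound⟩ := exists_hasUTailBound_of_isRSmooth B m hp hq
  refine ⟨(ENNReal.ofReal q * (K * 2 ^ m)).toReal + 1, by positivity, ?_⟩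
  intro r hpr hr hB Ω S _ _ μ _ ξ h d hm hξ hh hsym hint hd N t ht
  rcases N.eq_zero_or_pos with rfl | hN
  · have hle (ω : Ω) : (maxUStat h ξ 0 ω : ℝ) ≤ t * ((0 : ℕ) : ℝ) ^ ((m : ℝ) - d + d / p) := by
      rw [maxUStat_zero_right hm]
      positivity
    simp only [(hle _).not_gt, Set.ofPred_false, measure_empty, zero_le]
  · refine ((hbound r hpr hr hB).measure_lt_maxUStat_le (by linarith) hq hξ hh hsym hint hd hN
      ht).trans ?_
    rw [← mul_assoc K, ← mul_assoc]
    gcongr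
    rw [ENNReal.le_ofReal_iff_toReal_le (by finiteness) (by positivity)]
    linarith

theorem mainTheorem3 {B : Type*} [NormedAddCommGroup B] [NormedSpace ℝ B] [CompleteSpace B]
    [TopologicalSpace.SeparableSpace B] [MeasurableSpace B] [BorelSpace B]
    (m : ℕ) (p q : ℝ) (hp : 1 < p) (hq : 0 < q) :
    ∃ K : ℝ, 0 < K ∧ ∀ r : ℝ, p ≤ r → r ≤ 2 → IsRSmooth r B →
      ∀ (Ω S : Type*) [MeasurableSpace Ω] [MeasurableSpace S]
        (μ : Measure Ω) [IsProbabilityMeasure μ] (ξ : ℕ → Ω → S)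
        (h : (Fin m → S) → B) (d : ℕ),
        IsIID μ ξ → Measurable h → IsSymmetricKernel h → IsDegenerateOfOrder μ ξ h d →
        ∀ (N : ℕ) (t : ℝ), 0 < t →
          μ {ω | t * (N : ℝ) ^ ((m : ℝ) - d + d / p) < (maxUStat h ξ N ω : ℝ)} ≤
            ENNReal.ofReal K * ∑ j ∈ Finset.range (m + 1), (N : ℝ≥0∞) ^ j *
              ∫⁻ u in Set.Ioc (0 : ℝ) 1, ENNReal.ofReal (u ^ (q - 1)) *
                μ {ω | ENNReal.ofReal
                      (t * (N : ℝ) ^ (((max d j : ℕ) - (d : ℝ)) * ((p - 1) / p) + j / p) * u)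
                    < maxCondMoment μ ξ h p ω} := by
  obtain ⟨K, hK, hbound⟩ := mainTheorem3_general (B := B) m p q hp hq
  exact ⟨K, hK, fun r hpr hr hB Ω S _ _ μ _ ξ h d hξ hh hsym hd =>
    hbound r hpr hr hB Ω S μ ξ h d (hd.one_le.trans hd.le_order) hξ hh.stronglyMeasurable hsym
      hd.integrable fun k hk =>
        hξ.condExp_firstSigma_eq_zero_of_le (by omega : k ≤ d - 1) hd.condExp_eq_zero⟩
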